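/- **Conventions.** For a bicategory $\mathscr B$ write $U_X$ for the identity 1-cell of an object $X$; composites of 1-cells are written in functional order. The category $\mathrm{biHH}(\mathscr B)$ is the pseudo-colimit (the colimit in the $(2,1)$-category of categories) of the 2-truncated cyclic bar construction $$\coprod_{X}\mathscr B(X,X)\;\leftleftarrows\;\coprod_{X,Y}\mathscr B(X,Y)\times\mathscr B(Y,X)\;\underset{\textstyle\leftarrow}{\leftleftarrows}\;\coprod_{X,Y,Z}\mathscr B(X,Y)\times\mathscr B(Y,Z)\times\mathscr B(Z,X),$$ with the usual faces (composition of cyclically adjacent 1-cells) and degeneracies (insertion of an identity 1-cell; $F\mapsto(F,U)$ in lowest degree), whose simplicial identities hold up to the associators and unitors of $\mathscr B$. Every endo-1-cell $H$ of $\mathscr B$ gives an object $H$ of $\mathrm{biHH}(\mathscr B)$, every 2-cell between endo-1-cells gives a morphism, and for $F:X\to Y$, $G:Y\to X$ the faces give an isomorphism $\theta: GF\cong FG$ in $\mathrm{biHH}(\mathscr B)$. Let $\mathscr A\mathrm{dj}$ be the free strict bicategory on an adjunction: it has two objects $0,1$ and is generated by 1-cells $f:0\to1$, $g:1\to0$ and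 2-cells $u:U_0\to gf$, $c:fg\to U_1$, subject to the two triangle identities. For bicategories $\mathscr A,\mathscr B$ let $\mathrm{Fun}(\mathscr A,\mathscr B)$ be the category whose objects are the pseudofunctors $\mathscr A\to\mathscr B$ and whose morphisms are the pseudonatural equivalences up to invertible modification, and let $\mathscr A\mathrm{dj}(\mathscr B)=\mathrm{Fun}(\mathscr A\mathrm{dj},\mathscr B)$. Thus an object $\sigma$ of $\mathscr A\mathrm{dj}(\mathscr B)$ classifies an adjunction $(C,D,F,G,u_\sigma,c_\sigma)$ in $\mathscr B$ with $F:C\to D$ left adjoint to $G$. The Hochschild homology category defines a functor $\mathrm{biHH}:\mathrm{Fun}(\mathscr A,\mathscr B)\to\mathrm{Fun}(\mathrm{biHH}(\mathscr A),\mathrm{biHH}(\mathscr B))$; its value on a pseudonatural equivalence $\eta:\sigma\to\tau$ has, at an endo-1-cell $x$ of an object $X$, the component $\sigma(x)\cong KP\cong PK\cong\tau(x)$ obtained from the naturality 2-cell of $\eta$ at $x$, where $P=\eta_X$ and $\sigma(x)\cong KP$. Let $\widehat\chi:\mathscr A\mathrm{dj}(\mathscr B)\to\mathrm{Arr}(\mathrm{biHH}(\mathscr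 B))$ be the functor which sends $\sigma$ to its Euler characteristic $$\chi(\sigma):\;U_C\xrightarrow{\,u_\sigma\,}GF\xrightarrow{\ \theta\ }FG\xrightarrow{\,c_\sigma\,}U_D ,$$ and which sends $\eta:\sigma\to\tau$ to the commutative square formed by the isomorphisms $U_{\sigma(0)}\cong U_{\tau(0)}$ and $U_{\sigma(1)}\cong U_{\tau(1)}$ of $\mathrm{biHH}(\mathscr B)$ induced by the equivalences $\eta_0$ and $\eta_1$. Let $\Lambda_\infty$ be the paracyclic category: its objects are $[n]$, $n\in\mathbb N$, and its morphisms $[n]\to[m]$ are the weakly monotone maps $h:\mathbb Z\to\mathbb Z$ with $h(l+n+1)=h(l)+m+1$ for all $l$. Let $(\Lambda_\infty)^{\lhd\rhd}$ be the category obtained from $\Lambda_\infty$ by freely adjoining an initial and then a terminal object. **Statement.** 1. There is an equivalence of categories $\mathrm{biHH}(\mathscr A\mathrm{dj})\simeq(\Lambda_\infty)^{\lhd\rhd}$ which takes $U_0$ to the adjoined initial object and $U_1$ to the adjoined terminal object, up to isomorphism. In particular $U_0$ is an initial object and $U_1$ is a terminal object of $\mathrm{biHH}(\mathscr A\mathrm{dj})$.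 2. (Independence of choices.) For every isomorphism $\varphi:gf\cong fg$ in $\mathrm{biHH}(\mathscr A\mathrm{dj})$, the composite $U_0\xrightarrow{u}gf\xrightarrow{\varphi}fg\xrightarrow{c}U_1$ is the unique morphism $U_0\to U_1$ of $\mathrm{biHH}(\mathscr A\mathrm{dj})$. 3. For every bicategory $\mathscr B$, every initial object $I$ and every terminal object $T$ of $\mathrm{biHH}(\mathscr A\mathrm{dj})$, the functor $\widehat\chi$ is naturally isomorphic to the composite $$\mathscr A\mathrm{dj}(\mathscr B)\xrightarrow{\ \mathrm{biHH}\ }\mathrm{Fun}(\mathrm{biHH}(\mathscr A\mathrm{dj}),\mathrm{biHH}(\mathscr B))\xrightarrow{\ m^*\ }\mathrm{Arr}(\mathrm{biHH}(\mathscr B)),$$ where $m^*$ is restriction along the unique morphism $m:I\to T$, regarded as a functor $[1]\to\mathrm{biHH}(\mathscr A\mathrm{dj})$. 4. For $I=U_0$ and $T=U_1$ this holds on the nose up to the unit constraints: for every $\sigma\in\mathscr A\mathrm{dj}(\mathscr B)$ and $m:U_0\to U_1$, $$\chi(\sigma)=\bigl(U_C\cong\sigma(U_0)\xrightarrow{\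 \mathrm{biHH}(\sigma)(m)\ }\sigma(U_1)\cong U_D\bigr).$$ Hence the Euler characteristic is canonical and independent of any choice. -/

import Mathlib

open CategoryTheory

universe w v u w' v' u' v₁ u₁ v₂ u₂

namespace BiHH

/-! ### Pseudo-colimits of 2-truncated simplicial diagrams of categories -/

/-- The objects `[0]`, `[1]`, `[2]` of the truncated simplex category. -/
inductive Lvl : Type
  | zero | one | two

/-- The generating morphisms of the opposite of the truncated simplex category: the faces
`d₀, d₁ : [1] → [0]` and `e₀, e₁, e₂ : [2] → [1]`, and the degeneracies
`s₀ : [0] → [1]` and `t₀, t₁ : [1] → [2]`. -/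
inductive Str : Lvl → Lvl → Type
  | d₀ : Str .one .zero
  | d₁ : Str .one .zero
  | e₀ : Str .two .one
  | e₁ : Str .two .one
  | e₂ : Str .two .one
  | s₀ : Str .zero .one
  | t₀ : Str .one .two
  | t₁ : Str .one .two

/-- The simplicial identities of the form `p ≫ q = p' ≫ q'` (in order of application). -/
inductive Sq : ∀ {k l l' m : Lvl}, Str k l → Str l m → Str k l' → Str l' m → Type
  | dd₀₁ : Sq .e₁ .d₀ .e₀ .d₀
  | dd₀₂ : Sq .e₂ .d₀ .e₀ .d₁
  | dd₁₂ : Sq .e₂ .d₁ .e₁ .d₁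
  | ss : Sq .s₀ .t₀ .s₀ .t₁
  | ds₀₁ : Sq .t₁ .e₀ .d₀ .s₀
  | ds₂₀ : Sq .t₀ .e₂ .d₁ .s₀

/-- The simplicial identities of the form `p ≫ q = 𝟙` (in order of application). -/
inductive Tri : ∀ {k l : Lvl}, Str k l → Str l k → Type
  | s₀d₀ : Tri .s₀ .d₀
  | s₀d₁ : Tri .s₀ .d₁
  | t₀e₀ : Tri .t₀ .e₀
  | t₀e₁ : Tri .t₀ .e₁
  | t₁e₁ : Tri .t₁ .e₁
  | t₁e₂ : Tri .t₁ .e₂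

/-- The data of a pseudo-diagram of categories indexed by the opposite of the truncated simplex
category: the simplicial identities hold up to specified natural isomorphisms. -/
structure Diagram : Type (max (u + 1) (v + 1)) where
  obj : Lvl → Type u
  [cat : ∀ n, Category.{v} (obj n)]
  map : ∀ {m n : Lvl}, Str m n → (obj m ⥤ obj n)
  sq : ∀ {k l l' m : Lvl} {p : Str k l} {q : Str l m} {p' : Str k l'} {q' : Str l' m},
    Sq p q p' q' → (map p ⋙ map q ≅ map p' ⋙ map q')
  tri : ∀ {k l : Lvl} {p : Str k l} {q : Str l k}, Tri p q → (map p ⋙ map q ≅ 𝟭 (obj k))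

attribute [instance] Diagram.cat

namespace Diagram

/-- A pseudo-cocone under a diagram `D` with values in a category `E`. -/
structure Cocone (D : Diagram.{v, u}) (E : Type u') [Category.{v'} E] where
  leg : ∀ n, D.obj n ⥤ E
  iso : ∀ {m n : Lvl} (o : Str m n), leg m ≅ D.map o ⋙ leg n
  sq : ∀ {k l l' m : Lvl} {p : Str k l} {q : Str l m} {p' : Str k l'} {q' : Str l' m}
    (r : Sq p q p' q') (x : D.obj k),
    (iso p).hom.app x ≫ (iso q).hom.app ((D.map p).obj x) ≫ (leg m).map ((D.sq r).hom.app x) =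
      (iso p').hom.app x ≫ (iso q').hom.app ((D.map p').obj x)
  tri : ∀ {k l : Lvl} {p : Str k l} {q : Str l k} (r : Tri p q) (x : D.obj k),
    (iso p).hom.app x ≫ (iso q).hom.app ((D.map p).obj x) ≫ (leg k).map ((D.tri r).hom.app x) =
      𝟙 _

variable (D : Diagram.{v, u})

/-- The objects of the pseudo-colimit of `D`: pairs of a level and an object at that level. -/
structure Colim where
  lvl : Lvl
  pt : D.obj lvl

/-- Formal composites of the generating morphisms of the pseudo-colimit, which are the morphisms
of the categories in the diagram, and for every structure functor a comparison morphism together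
with its inverse. -/
inductive Word : D.Colim → D.Colim → Type (max u v)
  | id (a : D.Colim) : Word a a
  | comp {a b c : D.Colim} (f : Word a b) (g : Word b c) : Word a c
  | fib {n : Lvl} {x y : D.obj n} (f : x ⟶ y) : Word ⟨n, x⟩ ⟨n, y⟩
  | str {m n : Lvl} (o : Str m n) (x : D.obj m) : Word ⟨m, x⟩ ⟨n, (D.map o).obj x⟩
  | strInv {m n : Lvl} (o : Str m n) (x : D.obj m) : Word ⟨n, (D.map o).obj x⟩ ⟨m, x⟩

open Word in
/-- The defining relations of the pseudo-colimit: the laws of a category, functoriality of the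
legs, naturality and invertibility of the comparison morphisms, and compatibility with the
simplicial identities. -/
inductive Rel : ∀ {a b : D.Colim}, D.Word a b → D.Word a b → Prop
  | refl {a b : D.Colim} (f : D.Word a b) : Rel f f
  | symm {a b : D.Colim} {f g : D.Word a b} : Rel f g → Rel g f
  | trans {a b : D.Colim} {f g h : D.Word a b} : Rel f g → Rel g h → Rel f h
  | congr {a b c : D.Colim} {f f' : D.Word a b} {g g' : D.Word b c} :
      Rel f f' → Rel g g' → Rel (comp f g) (comp f' g')
  | id_comp {a b : D.Colim} (f : D.Word a b) : Rel (comp (id a) f) f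
  | comp_id {a b : D.Colim} (f : D.Word a b) : Rel (comp f (id b)) f
  | assoc {a b c d : D.Colim} (f : D.Word a b) (g : D.Word b c) (h : D.Word c d) :
      Rel (comp (comp f g) h) (comp f (comp g h))
  | fib_id {n : Lvl} (x : D.obj n) : Rel (fib (𝟙 x)) (id ⟨n, x⟩)
  | fib_comp {n : Lvl} {x y z : D.obj n} (f : x ⟶ y) (g : y ⟶ z) :
      Rel (fib (f ≫ g)) (comp (fib f) (fib g))
  | nat {m n : Lvl} (o : Str m n) {x y : D.obj m} (f : x ⟶ y) :
      Rel (comp (fib f) (str o y)) (comp (str o x) (fib ((D.map o).map f)))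
  | hom_inv {m n : Lvl} (o : Str m n) (x : D.obj m) :
      Rel (comp (str o x) (strInv o x)) (id ⟨m, x⟩)
  | inv_hom {m n : Lvl} (o : Str m n) (x : D.obj m) :
      Rel (comp (strInv o x) (str o x)) (id ⟨n, (D.map o).obj x⟩)
  | sq {k l l' m : Lvl} {p : Str k l} {q : Str l m} {p' : Str k l'} {q' : Str l' m}
      (r : Sq p q p' q') (x : D.obj k) :
      Rel (comp (str p x) (comp (str q _) (fib ((D.sq r).hom.app x))))
        (comp (str p' x) (str q' _))
  | tri {k l : Lvl} {p : Str k l} {q : Str l k} (r : Tri p q) (x : D.obj k) :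
      Rel (comp (str p x) (comp (str q _) (fib ((D.tri r).hom.app x)))) (id ⟨k, x⟩)

/-- The setoid of formal composites up to the defining relations. -/
def wordSetoid (a b : D.Colim) : Setoid (D.Word a b) := ⟨Rel D, Rel.refl, Rel.symm, Rel.trans⟩

/-- The pseudo-colimit of `D`, i.e. its colimit in the `(2,1)`-category of categories. -/
instance : Category.{max u v} D.Colim where
  Hom a b := _root_.Quotient (D.wordSetoid a b)
  id a := Quotient.mk _ (Word.id a)
  comp := Quotient.map₂ Word.comp (fun _ _ h _ _ h' => Rel.congr h h')
  id_comp := by rintro _ _ ⟨f⟩; exact Quotient.sound (Rel.id_comp f)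
  comp_id := by rintro _ _ ⟨f⟩; exact Quotient.sound (Rel.comp_id f)
  assoc := by rintro _ _ _ _ ⟨f⟩ ⟨g⟩ ⟨h⟩; exact Quotient.sound (Rel.assoc f g h)

variable {D}

/-- The morphism of the pseudo-colimit represented by a formal composite. -/
def Word.cls {a b : D.Colim} (f : D.Word a b) : a ⟶ b := Quotient.mk (D.wordSetoid a b) f

/-- The object of the pseudo-colimit given by an object of one of the categories in the diagram. -/
abbrev pt {n : Lvl} (x : D.obj n) : D.Colim := ⟨n, x⟩

/-- The morphism of the pseudo-colimit given by a morphism of one of the categories in the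
diagram. -/
def fib {n : Lvl} {x y : D.obj n} (f : x ⟶ y) : pt x ⟶ pt y := (Word.fib f).cls

/-- The comparison isomorphisms of the pseudo-colimit. -/
def str {m n : Lvl} (o : Str m n) (x : D.obj m) : pt x ≅ pt ((D.map o).obj x) where
  hom := (Word.str o x).cls
  inv := (Word.strInv o x).cls
  hom_inv_id := Quotient.sound (Rel.hom_inv o x)
  inv_hom_id := Quotient.sound (Rel.inv_hom o x)

lemma fib_id {n : Lvl} (x : D.obj n) : fib (𝟙 x) = 𝟙 (pt x) := Quotient.sound (Rel.fib_id x)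

lemma fib_comp {n : Lvl} {x y z : D.obj n} (f : x ⟶ y) (g : y ⟶ z) :
    fib (f ≫ g) = fib f ≫ fib g := Quotient.sound (Rel.fib_comp f g)

lemma fib_str {m n : Lvl} (o : Str m n) {x y : D.obj m} (f : x ⟶ y) :
    fib f ≫ (str o y).hom = (str o x).hom ≫ fib ((D.map o).map f) :=
  Quotient.sound (Rel.nat o f)

lemma str_sq {k l l' m : Lvl} {p : Str k l} {q : Str l m} {p' : Str k l'} {q' : Str l' m}
    (r : Sq p q p' q') (x : D.obj k) :
    (str p x).hom ≫ (str q _).hom ≫ fib ((D.sq r).hom.app x) =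
      (str p' x).hom ≫ (str q' _).hom := Quotient.sound (Rel.sq r x)

lemma str_tri {k l : Lvl} {p : Str k l} {q : Str l k} (r : Tri p q) (x : D.obj k) :
    (str p x).hom ≫ (str q _).hom ≫ fib ((D.tri r).hom.app x) = 𝟙 (pt x) :=
  Quotient.sound (Rel.tri r x)

lemma hom_induction (P : ∀ {a b : D.Colim}, (a ⟶ b) → Prop) (id : ∀ a, P (𝟙 a))
    (comp : ∀ {a b c : D.Colim} (f : a ⟶ b) (g : b ⟶ c), P f → P g → P (f ≫ g))
    (hfib : ∀ {n : Lvl} {x y : D.obj n} (f : x ⟶ y), P (fib f))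
    (hstr : ∀ {m n : Lvl} (o : Str m n) (x : D.obj m), P (str o x).hom)
    (hinv : ∀ {m n : Lvl} (o : Str m n) (x : D.obj m), P (str o x).inv)
    {a b : D.Colim} (f : a ⟶ b) : P f := by
  have key {a b : D.Colim} (f : D.Word a b) : P f.cls := by
    induction f with
    | id a => exact id a
    | comp f g ihf ihg => exact comp (Word.cls f) (Word.cls g) ihf ihg
    | fib f => exact hfib f
    | str o x => exact hstr o x
    | strInv o x => exact hinv o x
  exact Quotient.inductionOn f key

/-- The universal pseudo-cocone, with values in the pseudo-colimit. -/
def univ : D.Cocone D.Colim where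
  leg n :=
    { obj x := pt x
      map f := fib f
      map_id x := fib_id x
      map_comp f g := fib_comp f g }
  iso {m n} o := NatIso.ofComponents (fun x => str o x) (fun f => fib_str o f)
  sq r x := str_sq r x
  tri r x := str_tri r x

variable {E : Type u'} [Category.{v'} E]

namespace Cocone

/-- The value of a pseudo-cocone on a formal composite. -/
def onWord (c : D.Cocone E) {a b : D.Colim} :
    D.Word a b → ((c.leg a.lvl).obj a.pt ⟶ (c.leg b.lvl).obj b.pt)
  | .id _ => 𝟙 _
  | .comp f g => c.onWord f ≫ c.onWord g
  | .fib f => (c.leg _).map f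
  | .str o x => (c.iso o).hom.app x
  | .strInv o x => (c.iso o).inv.app x

lemma onWord_rel (c : D.Cocone E) {a b : D.Colim} {f g : D.Word a b} (h : D.Rel f g) :
    c.onWord f = c.onWord g := by
  induction h with
  | refl f => rfl
  | symm _ ih => exact ih.symm
  | trans _ _ ih ih' => exact ih.trans ih'
  | congr _ _ ih ih' => exact congrArg₂ (· ≫ ·) ih ih'
  | id_comp f => exact Category.id_comp _
  | comp_id f => exact Category.comp_id _
  | assoc f g h => exact Category.assoc _ _ _
  | fib_id x => exact (c.leg _).map_id x
  | fib_comp f g => exact (c.leg _).map_comp f g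
  | nat o f => exact (c.iso o).hom.naturality f
  | hom_inv o x => exact (c.iso o).hom_inv_id_app x
  | inv_hom o x => exact (c.iso o).inv_hom_id_app x
  | sq r x => exact c.sq r x
  | tri r x => exact c.tri r x

/-- The functor out of the pseudo-colimit induced by a pseudo-cocone. -/
def desc (c : D.Cocone E) : D.Colim ⥤ E where
  obj a := (c.leg a.lvl).obj a.pt
  map := Quotient.lift c.onWord (fun _ _ h => c.onWord_rel h)
  map_id _ := rfl
  map_comp := by rintro _ _ _ ⟨f⟩ ⟨g⟩; rfl

end Cocone

variable {F G : D.Colim ⥤ E}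

/-- Naturality of a family of morphisms with respect to a given morphism. -/
def Natl (a : ∀ v, F.obj v ⟶ G.obj v) {v v' : D.Colim} (f : v ⟶ v') : Prop :=
  F.map f ≫ a v' = a v ≫ G.map f

namespace Natl

variable {a : ∀ v, F.obj v ⟶ G.obj v} {v v' v'' : D.Colim}

lemma id (v : D.Colim) : Natl a (𝟙 v) := by simp [Natl]

lemma comp {f : v ⟶ v'} {g : v' ⟶ v''} (hf : Natl a f) (hg : Natl a g) : Natl a (f ≫ g) := by
  simp only [Natl, F.map_comp, G.map_comp, Category.assoc] at *
  rw [hg, reassoc_of% hf]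

lemma of_comp_left {f : v ⟶ v'} {g : v' ⟶ v''} [IsIso f] (hf : Natl a f) (h : Natl a (f ≫ g)) :
    Natl a g := by
  simp only [Natl, F.map_comp, G.map_comp, Category.assoc] at *
  rw [← cancel_epi (F.map f), h, reassoc_of% hf]

lemma of_comp_right {f : v ⟶ v'} {g : v' ⟶ v''} [IsIso g] (hg : Natl a g)
    (h : Natl a (f ≫ g)) : Natl a f := by
  simp only [Natl, F.map_comp, G.map_comp, Category.assoc] at *
  rw [← cancel_mono (G.map g), Category.assoc, ← hg, h, Category.assoc]

lemma inv {e : v ≅ v'} (h : Natl a e.hom) : Natl a e.inv :=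
  of_comp_left h (by rw [e.hom_inv_id]; exact id v)

end Natl

/-- A family of morphisms indexed by the pseudo-colimit, from one indexed by level zero. -/
def family (b : ∀ x : D.obj .zero, F.obj (pt x) ⟶ G.obj (pt x)) : ∀ v, F.obj v ⟶ G.obj v
  | ⟨.zero, x⟩ => b x
  | ⟨.one, x⟩ => F.map (str .d₀ x).hom ≫ b _ ≫ G.map (str .d₀ x).inv
  | ⟨.two, x⟩ => F.map ((str .e₀ x).hom ≫ (str .d₀ _).hom) ≫ b _ ≫
      G.map ((str .d₀ _).inv ≫ (str .e₀ x).inv)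

variable {b : ∀ x : D.obj .zero, F.obj (pt x) ⟶ G.obj (pt x)}

lemma family_d₀ (x : D.obj .one) : Natl (family b) (str .d₀ x).hom := by
  change F.map _ ≫ _ = (F.map _ ≫ _ ≫ G.map _) ≫ G.map _
  simp only [Category.assoc, ← G.map_comp, Iso.inv_hom_id, G.map_id, Category.comp_id]
  rfl

lemma family_e₀ (x : D.obj .two) : Natl (family b) (str .e₀ x).hom := by
  change F.map _ ≫ F.map _ ≫ _ ≫ G.map _ = (F.map _ ≫ _ ≫ G.map _) ≫ G.map _
  simp only [Category.assoc, ← G.map_comp, Iso.inv_hom_id, Category.comp_id, F.map_comp]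

lemma family_fib (h₀ : ∀ {x y : D.obj .zero} (f : x ⟶ y), Natl (family b) (fib f))
    {n : Lvl} {x y : D.obj n} (f : x ⟶ y) : Natl (family b) (fib f) := by
  have h1 {x y : D.obj .one} (f : x ⟶ y) : Natl (family b) (fib f) := by
    refine Natl.of_comp_right (family_d₀ y) ?_
    rw [fib_str]
    exact (family_d₀ x).comp (h₀ _)
  match n with
  | .zero => exact h₀ f
  | .one => exact h1 f
  | .two =>
    refine Natl.of_comp_right (family_e₀ y) ?_
    rw [fib_str]
    exact (family_e₀ x).comp (h1 _)

lemma family_sq (h₀ : ∀ {x y : D.obj .zero} (f : x ⟶ y), Natl (family b) (fib f))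
    {k l l' m : Lvl} {p : Str k l} {q : Str l m} {p' : Str k l'} {q' : Str l' m}
    (r : Sq p q p' q') (x : D.obj k) (hp' : Natl (family b) (str p' x).hom)
    (hq' : Natl (family b) (str q' ((D.map p').obj x)).hom)
    (hq : Natl (family b) (str q ((D.map p).obj x)).hom) : Natl (family b) (str p x).hom := by
  have h := str_sq r x
  rw [← Category.assoc] at h
  have : IsIso (fib ((D.sq r).hom.app x)) :=
    inferInstanceAs (IsIso ((D.univ.leg _).map ((D.sq r).hom.app x)))
  exact Natl.of_comp_right hq (Natl.of_comp_right (family_fib h₀ _) (by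
    rw [h]; exact hp'.comp hq'))

lemma family_tri (h₀ : ∀ {x y : D.obj .zero} (f : x ⟶ y), Natl (family b) (fib f))
    {k l : Lvl} {p : Str k l} {q : Str l k} (r : Tri p q) (x : D.obj k)
    (hq : Natl (family b) (str q ((D.map p).obj x)).hom) : Natl (family b) (str p x).hom := by
  have h := str_tri r x
  rw [← Category.assoc] at h
  have : IsIso (fib ((D.tri r).hom.app x)) :=
    inferInstanceAs (IsIso ((D.univ.leg _).map ((D.tri r).hom.app x)))
  exact Natl.of_comp_right hq (Natl.of_comp_right (family_fib h₀ _) (by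
    rw [h]; exact Natl.id _))

lemma family_str (h₀ : ∀ {x y : D.obj .zero} (f : x ⟶ y), Natl (family b) (fib f))
    (h₁ : ∀ x : D.obj .one, Natl (family b) (str .d₁ x).hom)
    {m n : Lvl} (o : Str m n) (x : D.obj m) : Natl (family b) (str o x).hom := by
  have hs (x : D.obj .zero) := family_tri h₀ .s₀d₀ x (family_d₀ _)
  cases o with
  | d₀ => exact family_d₀ x
  | d₁ => exact h₁ x
  | e₀ => exact family_e₀ x
  | e₁ => exact family_sq h₀ .dd₀₁ x (family_e₀ _) (family_d₀ _) (family_d₀ _)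
  | e₂ => exact family_sq h₀ .dd₀₂ x (family_e₀ _) (h₁ _) (family_d₀ _)
  | s₀ => exact hs x
  | t₀ => exact family_tri h₀ .t₀e₀ x (family_e₀ _)
  | t₁ => exact family_sq h₀ .ds₀₁ x (family_d₀ _) (hs _) (family_e₀ _)

lemma family_natural (h₀ : ∀ {x y : D.obj .zero} (f : x ⟶ y), Natl (family b) (fib f))
    (h₁ : ∀ x : D.obj .one, Natl (family b) (str .d₁ x).hom)
    {v v' : D.Colim} (f : v ⟶ v') : Natl (family b) f :=
  hom_induction (fun f => Natl (family b) f) Natl.id (fun _ _ => Natl.comp)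
    (fun f => family_fib h₀ f) (fun o x => family_str h₀ h₁ o x)
    (fun o x => (family_str h₀ h₁ o x).inv) f


/-- A natural transformation between functors on the pseudo-colimit, from a family of morphisms
indexed by level zero. -/
def natTransMk (b : ∀ x : D.obj .zero, F.obj (pt x) ⟶ G.obj (pt x))
    (h₀ : ∀ {x y : D.obj .zero} (f : x ⟶ y), F.map (fib f) ≫ b y = b x ≫ G.map (fib f))
    (h₁ : ∀ x : D.obj .one, F.map ((str .d₀ x).inv ≫ (str .d₁ x).hom) ≫ b _ =
      b _ ≫ G.map ((str .d₀ x).inv ≫ (str .d₁ x).hom)) : F ⟶ G where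
  app := family b
  naturality _ _ f := family_natural h₀
    (fun x => Natl.of_comp_left (family_d₀ x).inv (h₁ x)) f

lemma natTrans_ext {s t : F ⟶ G} (h : ∀ x : D.obj .zero, s.app (pt x) = t.app (pt x)) :
    s = t := by
  ext ⟨n, x⟩
  have h1 (x : D.obj .one) : s.app (pt x) = t.app (pt x) := by
    rw [← cancel_mono (G.map (str .d₀ x).hom), ← s.naturality, ← t.naturality, h]
  match n with
  | .zero => exact h x
  | .one => exact h1 x
  | .two =>
    change s.app (pt x) = t.app (pt x)
    rw [← cancel_mono (G.map (str .e₀ x).hom), ← s.naturality, ← t.naturality, h1]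

end Diagram
end BiHH

namespace BiHH

open Bicategory

/-! ### The cyclic bar construction of a bicategory and its truncation `biHH` -/

/-- The objects of the disjoint union of the categories `B(X, X)`. -/
structure Cyc₀ (B : Type u) [Bicategory.{w, v} B] where
  {X : B}
  F : X ⟶ X

/-- The objects of the disjoint union of the categories `B(X, Y) × B(Y, X)`. -/
structure Cyc₁ (B : Type u) [Bicategory.{w, v} B] where
  {X Y : B}
  F : X ⟶ Y
  G : Y ⟶ X

/-- The objects of the disjoint union of the categories `B(X, Y) × B(Y, Z) × B(Z, X)`. -/
structure Cyc₂ (B : Type u) [Bicategory.{w, v} B] where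
  {X Y Z : B}
  F : X ⟶ Y
  G : Y ⟶ Z
  H : Z ⟶ X

variable {B : Type u} [Bicategory.{w, v} B]

/-- The morphisms of the disjoint union of the categories `B(X, X)`. -/
inductive Cyc₀.Hom : Cyc₀ B → Cyc₀ B → Type (max u v w)
  | mk {X : B} {F F' : X ⟶ X} (a : F ⟶ F') : Hom ⟨F⟩ ⟨F'⟩

/-- The morphisms of the disjoint union of the categories `B(X, Y) × B(Y, X)`. -/
inductive Cyc₁.Hom : Cyc₁ B → Cyc₁ B → Type (max u v w)
  | mk {X Y : B} {F F' : X ⟶ Y} {G G' : Y ⟶ X} (a : F ⟶ F') (b : G ⟶ G') : Hom ⟨F, G⟩ ⟨F', G'⟩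

/-- The morphisms of the disjoint union of the categories `B(X, Y) × B(Y, Z) × B(Z, X)`. -/
inductive Cyc₂.Hom : Cyc₂ B → Cyc₂ B → Type (max u v w)
  | mk {X Y Z : B} {F F' : X ⟶ Y} {G G' : Y ⟶ Z} {H H' : Z ⟶ X} (a : F ⟶ F') (b : G ⟶ G')
      (c : H ⟶ H') : Hom ⟨F, G, H⟩ ⟨F', G', H'⟩

/-- Composition in the disjoint union of the categories `B(X, X)`. -/
def Cyc₀.Hom.comp : ∀ {x y z : Cyc₀ B}, Hom x y → Hom y z → Hom x z
  | _, _, _, mk a, mk a' => mk (a ≫ a')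

/-- Composition in the disjoint union of the categories `B(X, Y) × B(Y, X)`. -/
def Cyc₁.Hom.comp : ∀ {x y z : Cyc₁ B}, Hom x y → Hom y z → Hom x z
  | _, _, _, mk a b, mk a' b' => mk (a ≫ a') (b ≫ b')

/-- Composition in the disjoint union of the categories `B(X, Y) × B(Y, Z) × B(Z, X)`. -/
def Cyc₂.Hom.comp : ∀ {x y z : Cyc₂ B}, Hom x y → Hom y z → Hom x z
  | _, _, _, mk a b c, mk a' b' c' => mk (a ≫ a') (b ≫ b') (c ≫ c')

instance : Category.{max u v w} (Cyc₀ B) where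
  Hom := Cyc₀.Hom
  id x := Cyc₀.Hom.mk (𝟙 x.F)
  comp := Cyc₀.Hom.comp
  id_comp := by rintro _ _ ⟨a⟩; exact congrArg Cyc₀.Hom.mk (Category.id_comp a)
  comp_id := by rintro _ _ ⟨a⟩; exact congrArg Cyc₀.Hom.mk (Category.comp_id a)
  assoc := by
    rintro _ _ _ _ ⟨a⟩ ⟨b⟩ ⟨c⟩; exact congrArg Cyc₀.Hom.mk (Category.assoc a b c)

instance : Category.{max u v w} (Cyc₁ B) where
  Hom := Cyc₁.Hom
  id x := Cyc₁.Hom.mk (𝟙 x.F) (𝟙 x.G)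
  comp := Cyc₁.Hom.comp
  id_comp := by
    rintro _ _ ⟨a, b⟩; exact congrArg₂ Cyc₁.Hom.mk (Category.id_comp a) (Category.id_comp b)
  comp_id := by
    rintro _ _ ⟨a, b⟩; exact congrArg₂ Cyc₁.Hom.mk (Category.comp_id a) (Category.comp_id b)
  assoc := by
    rintro _ _ _ _ ⟨a, a'⟩ ⟨b, b'⟩ ⟨c, c'⟩
    exact congrArg₂ Cyc₁.Hom.mk (Category.assoc a b c) (Category.assoc a' b' c')

lemma Cyc₂.Hom.mk_congr {X Y Z : B} {F F' : X ⟶ Y} {G G' : Y ⟶ Z} {H H' : Z ⟶ X}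
    {a a' : F ⟶ F'} {b b' : G ⟶ G'} {c c' : H ⟶ H'} (ha : a = a') (hb : b = b') (hc : c = c') :
    Cyc₂.Hom.mk a b c = Cyc₂.Hom.mk a' b' c' := by rw [ha, hb, hc]

instance : Category.{max u v w} (Cyc₂ B) where
  Hom := Cyc₂.Hom
  id x := Cyc₂.Hom.mk (𝟙 x.F) (𝟙 x.G) (𝟙 x.H)
  comp := Cyc₂.Hom.comp
  id_comp := by
    rintro _ _ ⟨a, b, c⟩
    exact Cyc₂.Hom.mk_congr (Category.id_comp a) (Category.id_comp b) (Category.id_comp c)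
  comp_id := by
    rintro _ _ ⟨a, b, c⟩
    exact Cyc₂.Hom.mk_congr (Category.comp_id a) (Category.comp_id b) (Category.comp_id c)
  assoc := by
    rintro _ _ _ _ ⟨a, a', a''⟩ ⟨b, b', b''⟩ ⟨c, c', c''⟩
    exact Cyc₂.Hom.mk_congr (Category.assoc a b c) (Category.assoc a' b' c')
      (Category.assoc a'' b'' c'')

/-- The morphism of the disjoint union of the `B(X, X)` given by a 2-cell. -/
def cell₀ {X : B} {F F' : X ⟶ X} (a : F ⟶ F') : Cyc₀.mk F ⟶ Cyc₀.mk F' := Cyc₀.Hom.mk a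

/-- The morphism of the disjoint union of the `B(X, Y) × B(Y, X)` given by two 2-cells. -/
def cell₁ {X Y : B} {F F' : X ⟶ Y} {G G' : Y ⟶ X} (a : F ⟶ F') (b : G ⟶ G') :
    Cyc₁.mk F G ⟶ Cyc₁.mk F' G' := Cyc₁.Hom.mk a b

/-- The morphism of the disjoint union of the `B(X, Y) × B(Y, Z) × B(Z, X)` given by three
2-cells. -/
def cell₂ {X Y Z : B} {F F' : X ⟶ Y} {G G' : Y ⟶ Z} {H H' : Z ⟶ X} (a : F ⟶ F') (b : G ⟶ G')
    (c : H ⟶ H') : Cyc₂.mk F G H ⟶ Cyc₂.mk F' G' H' := Cyc₂.Hom.mk a b c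

@[simp]
lemma cell₀_comp {X : B} {F F' F'' : X ⟶ X} (a : F ⟶ F') (a' : F' ⟶ F'') :
    cell₀ a ≫ cell₀ a' = cell₀ (a ≫ a') := rfl

@[simp]
lemma cell₁_comp {X Y : B} {F F' F'' : X ⟶ Y} {G G' G'' : Y ⟶ X} (a : F ⟶ F') (b : G ⟶ G')
    (a' : F' ⟶ F'') (b' : G' ⟶ G'') : cell₁ a b ≫ cell₁ a' b' = cell₁ (a ≫ a') (b ≫ b') := rfl

@[simp]
lemma cell₀_id {X : B} (F : X ⟶ X) : cell₀ (𝟙 F) = 𝟙 (Cyc₀.mk F) := rfl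

@[simp]
lemma cell₁_id {X Y : B} (F : X ⟶ Y) (G : Y ⟶ X) : cell₁ (𝟙 F) (𝟙 G) = 𝟙 (Cyc₁.mk F G) := rfl

/-- A 2-isomorphism, as an isomorphism of the disjoint union of the `B(X, X)`. -/
@[simps]
def iso₀ {X : B} {F F' : X ⟶ X} (a : F ≅ F') : Cyc₀.mk F ≅ Cyc₀.mk F' where
  hom := cell₀ a.hom
  inv := cell₀ a.inv

/-- A pair of 2-isomorphisms, as an isomorphism of the disjoint union of the
`B(X, Y) × B(Y, X)`. -/
@[simps]
def iso₁ {X Y : B} {F F' : X ⟶ Y} {G G' : Y ⟶ X} (a : F ≅ F') (b : G ≅ G') :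
    Cyc₁.mk F G ≅ Cyc₁.mk F' G' where
  hom := cell₁ a.hom b.hom
  inv := cell₁ a.inv b.inv

/-- The multiplication `(F, G) ↦ FG`. -/
@[simps obj]
def faceD₀ : Cyc₁ B ⥤ Cyc₀ B where
  obj x := ⟨x.F ≫ x.G⟩
  map
    | .mk a b => cell₀ (a ▷ _ ≫ _ ◁ b)
  map_id x := by
    change cell₀ (𝟙 x.F ▷ _ ≫ _ ◁ 𝟙 x.G) = _
    simp
  map_comp := by
    rintro _ _ _ ⟨a, b⟩ ⟨a', b'⟩
    change cell₀ ((a ≫ a') ▷ _ ≫ _ ◁ (b ≫ b')) = cell₀ _ ≫ cell₀ _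
    simp [whisker_exchange_assoc]

/-- The cyclic multiplication `(F, G) ↦ GF`. -/
@[simps obj]
def faceD₁ : Cyc₁ B ⥤ Cyc₀ B where
  obj x := ⟨x.G ≫ x.F⟩
  map
    | .mk a b => cell₀ (b ▷ _ ≫ _ ◁ a)
  map_id x := by
    change cell₀ (𝟙 x.G ▷ _ ≫ _ ◁ 𝟙 x.F) = _
    simp
  map_comp := by
    rintro _ _ _ ⟨a, b⟩ ⟨a', b'⟩
    change cell₀ ((b ≫ b') ▷ _ ≫ _ ◁ (a ≫ a')) = cell₀ _ ≫ cell₀ _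
    simp [whisker_exchange_assoc]

/-- The multiplication `(F, G, H) ↦ (FG, H)`. -/
@[simps obj]
def faceE₀ : Cyc₂ B ⥤ Cyc₁ B where
  obj x := ⟨x.F ≫ x.G, x.H⟩
  map
    | .mk a b c => cell₁ (a ▷ _ ≫ _ ◁ b) c
  map_id x := by
    change cell₁ (𝟙 x.F ▷ _ ≫ _ ◁ 𝟙 x.G) (𝟙 x.H) = _
    simp
  map_comp := by
    rintro _ _ _ ⟨a, b, c⟩ ⟨a', b', c'⟩
    change cell₁ ((a ≫ a') ▷ _ ≫ _ ◁ (b ≫ b')) (c ≫ c') = cell₁ _ _ ≫ cell₁ _ _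
    simp [whisker_exchange_assoc]

/-- The multiplication `(F, G, H) ↦ (F, GH)`. -/
@[simps obj]
def faceE₁ : Cyc₂ B ⥤ Cyc₁ B where
  obj x := ⟨x.F, x.G ≫ x.H⟩
  map
    | .mk a b c => cell₁ a (b ▷ _ ≫ _ ◁ c)
  map_id x := by
    change cell₁ (𝟙 x.F) (𝟙 x.G ▷ _ ≫ _ ◁ 𝟙 x.H) = _
    simp
  map_comp := by
    rintro _ _ _ ⟨a, b, c⟩ ⟨a', b', c'⟩
    change cell₁ (a ≫ a') ((b ≫ b') ▷ _ ≫ _ ◁ (c ≫ c')) = cell₁ _ _ ≫ cell₁ _ _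
    simp [whisker_exchange_assoc]

/-- The cyclic multiplication `(F, G, H) ↦ (HF, G)`. -/
@[simps obj]
def faceE₂ : Cyc₂ B ⥤ Cyc₁ B where
  obj x := ⟨x.H ≫ x.F, x.G⟩
  map
    | .mk a b c => cell₁ (c ▷ _ ≫ _ ◁ a) b
  map_id x := by
    change cell₁ (𝟙 x.H ▷ _ ≫ _ ◁ 𝟙 x.F) (𝟙 x.G) = _
    simp
  map_comp := by
    rintro _ _ _ ⟨a, b, c⟩ ⟨a', b', c'⟩
    change cell₁ ((c ≫ c') ▷ _ ≫ _ ◁ (a ≫ a')) (b ≫ b') = cell₁ _ _ ≫ cell₁ _ _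
    simp [whisker_exchange_assoc]

/-- The insertion of a unit `F ↦ (F, U)`. -/
@[simps obj]
def degenS₀ : Cyc₀ B ⥤ Cyc₁ B where
  obj x := ⟨x.F, 𝟙 x.X⟩
  map
    | .mk a => cell₁ a (𝟙 _)
  map_id x := rfl
  map_comp := by
    rintro _ _ _ ⟨a⟩ ⟨a'⟩
    change cell₁ (a ≫ a') (𝟙 _) = cell₁ _ _ ≫ cell₁ _ _
    simp

/-- The insertion of a unit `(F, G) ↦ (F, U, G)`. -/
@[simps obj]
def degenT₀ : Cyc₁ B ⥤ Cyc₂ B where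
  obj x := ⟨x.F, 𝟙 x.Y, x.G⟩
  map
    | .mk a b => cell₂ a (𝟙 _) b
  map_id x := rfl
  map_comp := by
    rintro _ _ _ ⟨a, b⟩ ⟨a', b'⟩
    exact Cyc₂.Hom.mk_congr rfl (Category.comp_id _).symm rfl

/-- The insertion of a unit `(F, G) ↦ (F, G, U)`. -/
@[simps obj]
def degenT₁ : Cyc₁ B ⥤ Cyc₂ B where
  obj x := ⟨x.F, x.G, 𝟙 x.X⟩
  map
    | .mk a b => cell₂ a b (𝟙 _)
  map_id x := rfl
  map_comp := by
    rintro _ _ _ ⟨a, b⟩ ⟨a', b'⟩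
    exact Cyc₂.Hom.mk_congr rfl rfl (Category.comp_id _).symm

variable (B) in
/-- The objects of the truncated cyclic bar construction. -/
def CycObj : Lvl → Type (max u v)
  | .zero => Cyc₀ B
  | .one => Cyc₁ B
  | .two => Cyc₂ B

end BiHH

namespace BiHH

open Bicategory

variable {B : Type u} [Bicategory.{w, v} B]

instance cycCategory : ∀ n, Category.{max u v w} (CycObj B n)
  | .zero => inferInstanceAs (Category (Cyc₀ B))
  | .one => inferInstanceAs (Category (Cyc₁ B))
  | .two => inferInstanceAs (Category (Cyc₂ B))

/-- The structure functors of the truncated cyclic bar construction. -/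
def cycMap : ∀ {m n : Lvl}, Str m n → (CycObj B m ⥤ CycObj B n)
  | _, _, .d₀ => faceD₀ (B := B)
  | _, _, .d₁ => faceD₁ (B := B)
  | _, _, .e₀ => faceE₀ (B := B)
  | _, _, .e₁ => faceE₁ (B := B)
  | _, _, .e₂ => faceE₂ (B := B)
  | _, _, .s₀ => degenS₀ (B := B)
  | _, _, .t₀ => degenT₀ (B := B)
  | _, _, .t₁ => degenT₁ (B := B)

lemma assoc_hom_nat {X Y Z W : B} {F F' : X ⟶ Y} {G G' : Y ⟶ Z} {H H' : Z ⟶ W} (a : F ⟶ F')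
    (b : G ⟶ G') (c : H ⟶ H') :
    ((a ▷ G ≫ F' ◁ b) ▷ H ≫ (F' ≫ G') ◁ c) ≫ (α_ F' G' H').hom =
      (α_ F G H).hom ≫ a ▷ (G ≫ H) ≫ F' ◁ (b ▷ H ≫ G' ◁ c) := by
  simp

lemma assoc_inv_nat {X Y Z W : B} {F F' : X ⟶ Y} {G G' : Y ⟶ Z} {H H' : Z ⟶ W} (a : F ⟶ F')
    (b : G ⟶ G') (c : H ⟶ H') :
    (a ▷ (G ≫ H) ≫ F' ◁ (b ▷ H ≫ G' ◁ c)) ≫ (α_ F' G' H').inv =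
      (α_ F G H).inv ≫ (a ▷ G ≫ F' ◁ b) ▷ H ≫ (F' ≫ G') ◁ c := by
  simp

lemma rightUnitor_nat {X Y : B} {F F' : X ⟶ Y} (a : F ⟶ F') :
    (a ▷ 𝟙 Y ≫ F' ◁ 𝟙 (𝟙 Y)) ≫ (ρ_ F').hom = (ρ_ F).hom ≫ a := by
  simp

lemma leftUnitor_nat {X Y : B} {F F' : X ⟶ Y} (a : F ⟶ F') :
    (𝟙 (𝟙 X) ▷ F ≫ 𝟙 X ◁ a) ≫ (λ_ F').hom = (λ_ F).hom ≫ a := by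
  simp

lemma id_nat {X Y : B} {F F' : X ⟶ Y} (a : F ⟶ F') : a ≫ 𝟙 F' = 𝟙 F ≫ a := by
  simp

/-- The simplicial identities of the form `p ≫ q ≅ p' ≫ q'` in the truncated cyclic bar
construction, given by associators and identities. -/
def cycSq : ∀ {k l l' m : Lvl} {p : Str k l} {q : Str l m} {p' : Str k l'} {q' : Str l' m},
    Sq p q p' q' → (cycMap (B := B) p ⋙ cycMap q ≅ cycMap p' ⋙ cycMap q')
  | _, _, _, _, _, _, _, _, .dd₀₁ =>
    (NatIso.ofComponents (fun x : Cyc₂ B => iso₀ (α_ x.F x.G x.H).symm) (by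
      rintro _ _ ⟨a, b, c⟩
      exact congrArg cell₀ (assoc_inv_nat a b c)) : faceE₁ ⋙ faceD₀ ≅ faceE₀ ⋙ faceD₀)
  | _, _, _, _, _, _, _, _, .dd₀₂ =>
    (NatIso.ofComponents (fun x : Cyc₂ B => iso₀ (α_ x.H x.F x.G)) (by
      rintro _ _ ⟨a, b, c⟩
      exact congrArg cell₀ (assoc_hom_nat c a b)) : faceE₂ ⋙ faceD₀ ≅ faceE₀ ⋙ faceD₁)
  | _, _, _, _, _, _, _, _, .dd₁₂ =>
    (NatIso.ofComponents (fun x : Cyc₂ B => iso₀ (α_ x.G x.H x.F).symm) (by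
      rintro _ _ ⟨a, b, c⟩
      exact congrArg cell₀ (assoc_inv_nat b c a)) : faceE₂ ⋙ faceD₁ ≅ faceE₁ ⋙ faceD₁)
  | _, _, _, _, _, _, _, _, .ss =>
    (NatIso.ofComponents (fun x : Cyc₀ B => Iso.refl _) (by
      rintro _ _ ⟨a⟩
      exact (Category.comp_id _).trans (Category.id_comp _).symm) :
        degenS₀ (B := B) ⋙ degenT₀ ≅ degenS₀ ⋙ degenT₁)
  | _, _, _, _, _, _, _, _, .ds₀₁ =>
    (NatIso.ofComponents (fun x : Cyc₁ B => Iso.refl _) (by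
      rintro _ _ ⟨a, b⟩
      exact (Category.comp_id _).trans (Category.id_comp _).symm) :
        degenT₁ (B := B) ⋙ faceE₀ ≅ faceD₀ ⋙ degenS₀)
  | _, _, _, _, _, _, _, _, .ds₂₀ =>
    (NatIso.ofComponents (fun x : Cyc₁ B => Iso.refl _) (by
      rintro _ _ ⟨a, b⟩
      exact (Category.comp_id _).trans (Category.id_comp _).symm) :
        degenT₀ (B := B) ⋙ faceE₂ ≅ faceD₁ ⋙ degenS₀)

/-- The simplicial identities of the form `p ≫ q ≅ 𝟭` in the truncated cyclic bar construction,
given by unitors. -/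
def cycTri : ∀ {k l : Lvl} {p : Str k l} {q : Str l k},
    Tri p q → (cycMap (B := B) p ⋙ cycMap q ≅ 𝟭 (CycObj B k))
  | _, _, _, _, .s₀d₀ =>
    (NatIso.ofComponents (fun x : Cyc₀ B => iso₀ (ρ_ x.F)) (by
      rintro _ _ ⟨a⟩
      exact congrArg cell₀ (rightUnitor_nat a)) : degenS₀ ⋙ faceD₀ ≅ 𝟭 (Cyc₀ B))
  | _, _, _, _, .s₀d₁ =>
    (NatIso.ofComponents (fun x : Cyc₀ B => iso₀ (λ_ x.F)) (by
      rintro _ _ ⟨a⟩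
      exact congrArg cell₀ (leftUnitor_nat a)) : degenS₀ ⋙ faceD₁ ≅ 𝟭 (Cyc₀ B))
  | _, _, _, _, .t₀e₀ =>
    (NatIso.ofComponents (fun x : Cyc₁ B => iso₁ (ρ_ x.F) (Iso.refl x.G)) (by
      rintro _ _ ⟨a, b⟩
      exact congrArg₂ cell₁ (rightUnitor_nat a) (id_nat b)) : degenT₀ ⋙ faceE₀ ≅ 𝟭 (Cyc₁ B))
  | _, _, _, _, .t₀e₁ =>
    (NatIso.ofComponents (fun x : Cyc₁ B => iso₁ (Iso.refl x.F) (λ_ x.G)) (by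
      rintro _ _ ⟨a, b⟩
      exact congrArg₂ cell₁ (id_nat a) (leftUnitor_nat b)) : degenT₀ ⋙ faceE₁ ≅ 𝟭 (Cyc₁ B))
  | _, _, _, _, .t₁e₁ =>
    (NatIso.ofComponents (fun x : Cyc₁ B => iso₁ (Iso.refl x.F) (ρ_ x.G)) (by
      rintro _ _ ⟨a, b⟩
      exact congrArg₂ cell₁ (id_nat a) (rightUnitor_nat b)) : degenT₁ ⋙ faceE₁ ≅ 𝟭 (Cyc₁ B))
  | _, _, _, _, .t₁e₂ =>
    (NatIso.ofComponents (fun x : Cyc₁ B => iso₁ (λ_ x.F) (Iso.refl x.G)) (by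
      rintro _ _ ⟨a, b⟩
      exact congrArg₂ cell₁ (leftUnitor_nat a) (id_nat b)) : degenT₁ ⋙ faceE₂ ≅ 𝟭 (Cyc₁ B))

variable (B) in
/-- The truncated cyclic bar construction of a bicategory `B`. -/
def cyc : Diagram.{max u v w, max u v} where
  obj := CycObj B
  cat := cycCategory
  map := cycMap
  sq := cycSq
  tri := cycTri

end BiHH

/-- The Hochschild homology category `biHH(B)` of a bicategory `B`: the pseudo-colimit
of its truncated cyclic bar construction
`∐ B(X, X) ⇐ ∐ B(X, Y) × B(Y, X) ⇚ ∐ B(X, Y) × B(Y, Z) × B(Z, X)`. -/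
abbrev BiHH (B : Type u) [Bicategory.{w, v} B] : Type (max u v) := (BiHH.cyc B).Colim

namespace BiHH

open Bicategory Diagram

variable {B : Type u} [Bicategory.{w, v} B]

/-- The object of `biHH(B)` represented by an endo-1-cell. -/
abbrev ob {X : B} (F : X ⟶ X) : BiHH B := pt (D := cyc B) (n := .zero) (Cyc₀.mk F)

/-- The morphism of `biHH(B)` represented by a 2-cell between endo-1-cells. -/
def ofCell {X : B} {F F' : X ⟶ X} (a : F ⟶ F') : ob F ⟶ ob F' :=
  fib (D := cyc B) (n := .zero) (cell₀ a)

/-- The object of `biHH(B)` represented by a pair of composable 1-cells. -/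
abbrev ob₁ {X Y : B} (F : X ⟶ Y) (G : Y ⟶ X) : BiHH B :=
  pt (D := cyc B) (n := .one) (Cyc₁.mk F G)

/-- The morphism of `biHH(B)` represented by a pair of 2-cells. -/
def ofCell₁ {X Y : B} {F F' : X ⟶ Y} {G G' : Y ⟶ X} (a : F ⟶ F') (b : G ⟶ G') :
    ob₁ F G ⟶ ob₁ F' G' := fib (D := cyc B) (n := .one) (cell₁ a b)

/-- The comparison isomorphism `(F, G) ≅ FG` of `biHH(B)`. -/
def mulL {X Y : B} (F : X ⟶ Y) (G : Y ⟶ X) : ob₁ F G ≅ ob (F ≫ G) :=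
  str (D := cyc B) .d₀ (Cyc₁.mk F G)

/-- The comparison isomorphism `(F, G) ≅ GF` of `biHH(B)`. -/
def mulR {X Y : B} (F : X ⟶ Y) (G : Y ⟶ X) : ob₁ F G ≅ ob (G ≫ F) :=
  str (D := cyc B) .d₁ (Cyc₁.mk F G)

/-- The cyclicity isomorphism `FG ≅ GF` of `biHH(B)`. -/
def theta {X Y : B} (F : X ⟶ Y) (G : Y ⟶ X) : ob (F ≫ G) ≅ ob (G ≫ F) :=
  (mulL F G).symm ≪≫ mulR F G

@[simp]
lemma ofCell_id {X : B} (F : X ⟶ X) : ofCell (𝟙 F) = 𝟙 (ob F) := fib_id (D := cyc B) _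

lemma ofCell_comp {X : B} {F F' F'' : X ⟶ X} (a : F ⟶ F') (b : F' ⟶ F'') :
    ofCell (a ≫ b) = ofCell a ≫ ofCell b :=
  fib_comp (D := cyc B) (n := .zero) (cell₀ a) (cell₀ b)

/-- The isomorphism of `biHH(B)` represented by a 2-isomorphism between endo-1-cells. -/
@[simps]
def ofIso {X : B} {F F' : X ⟶ X} (a : F ≅ F') : ob F ≅ ob F' where
  hom := ofCell a.hom
  inv := ofCell a.inv
  hom_inv_id := by rw [← ofCell_comp, a.hom_inv_id, ofCell_id]
  inv_hom_id := by rw [← ofCell_comp, a.inv_hom_id, ofCell_id]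

lemma mulL_naturality {X Y : B} {F F' : X ⟶ Y} {G G' : Y ⟶ X} (a : F ⟶ F') (b : G ⟶ G') :
    ofCell₁ a b ≫ (mulL F' G').hom = (mulL F G).hom ≫ ofCell (a ▷ G ≫ F' ◁ b) :=
  fib_str (D := cyc B) .d₀ (cell₁ a b)

lemma mulR_naturality {X Y : B} {F F' : X ⟶ Y} {G G' : Y ⟶ X} (a : F ⟶ F') (b : G ⟶ G') :
    ofCell₁ a b ≫ (mulR F' G').hom = (mulR F G).hom ≫ ofCell (b ▷ F ≫ G' ◁ a) :=
  fib_str (D := cyc B) .d₁ (cell₁ a b)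

lemma theta_naturality {X Y : B} {F F' : X ⟶ Y} {G G' : Y ⟶ X} (a : F ⟶ F') (b : G ⟶ G') :
    ofCell (a ▷ G ≫ F' ◁ b) ≫ (theta F' G').hom =
      (theta F G).hom ≫ ofCell (b ▷ F ≫ G' ◁ a) := by
  rw [← cancel_epi (mulL F G).hom]
  simp only [theta, Iso.trans_hom, Iso.symm_hom, Category.assoc, Iso.hom_inv_id_assoc]
  rw [← mulR_naturality, ← Category.assoc, ← mulL_naturality, Category.assoc,
    Iso.hom_inv_id_assoc]

/-- The hexagon relation of the cyclicity isomorphisms. -/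
lemma theta_hexagon {X Y Z : B} (F : X ⟶ Y) (G : Y ⟶ Z) (H : Z ⟶ X) :
    (theta F (G ≫ H)).hom = ofCell (α_ F G H).inv ≫ (theta (F ≫ G) H).hom ≫
      ofCell (α_ H F G).inv ≫ (theta (H ≫ F) G).hom ≫ ofCell (α_ G H F).inv := by
  let x : Cyc₂ B := ⟨F, G, H⟩
  let p : BiHH B := pt (D := cyc B) (n := .two) x
  let e₀ : p ≅ ob₁ (F ≫ G) H := str (D := cyc B) (m := .two) .e₀ x
  let e₁ : p ≅ ob₁ F (G ≫ H) := str (D := cyc B) (m := .two) .e₁ x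
  let e₂ : p ≅ ob₁ (H ≫ F) G := str (D := cyc B) (m := .two) .e₂ x
  have h₀₁ : e₁.hom ≫ (mulL F (G ≫ H)).hom ≫ (ofIso (α_ F G H)).inv =
      e₀.hom ≫ (mulL (F ≫ G) H).hom := str_sq (D := cyc B) .dd₀₁ x
  have h₀₂ : e₂.hom ≫ (mulL (H ≫ F) G).hom ≫ (ofIso (α_ H F G)).hom =
      e₀.hom ≫ (mulR (F ≫ G) H).hom := str_sq (D := cyc B) .dd₀₂ x
  have h₁₂ : e₂.hom ≫ (mulR (H ≫ F) G).hom ≫ (ofIso (α_ G H F)).inv =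
      e₁.hom ≫ (mulR F (G ≫ H)).hom := str_sq (D := cyc B) .dd₁₂ x
  change _ = (ofIso (α_ F G H)).inv ≫ _ ≫ (ofIso (α_ H F G)).inv ≫ _ ≫ (ofIso (α_ G H F)).inv
  simp only [theta, Iso.trans_hom, Iso.symm_hom, Category.assoc]
  rw [Iso.inv_comp_eq, ← cancel_epi e₁.hom, ← h₁₂, reassoc_of% h₀₁, Iso.hom_inv_id_assoc,
    ← reassoc_of% h₀₂, Iso.hom_inv_id_assoc, Iso.hom_inv_id_assoc]

/-- The unit relation of the cyclicity isomorphisms. -/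
lemma theta_unit {X : B} (F : X ⟶ X) :
    (theta F (𝟙 X)).hom = ofCell (ρ_ F).hom ≫ ofCell (λ_ F).inv := by
  let s : ob F ≅ ob₁ F (𝟙 X) := str (D := cyc B) (m := .zero) .s₀ (Cyc₀.mk F)
  have h₀ : s.hom ≫ (mulL F (𝟙 X)).hom ≫ (ofIso (ρ_ F)).hom = 𝟙 _ :=
    str_tri (D := cyc B) .s₀d₀ (Cyc₀.mk F)
  have h₁ : s.hom ≫ (mulR F (𝟙 X)).hom ≫ (ofIso (λ_ F)).hom = 𝟙 _ :=
    str_tri (D := cyc B) .s₀d₁ (Cyc₀.mk F)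
  change _ = (ofIso (ρ_ F)).hom ≫ (ofIso (λ_ F)).inv
  rw [← Category.assoc, ← Iso.eq_comp_inv, Category.id_comp] at h₁
  simp only [theta, Iso.trans_hom, Iso.symm_hom]
  rw [Iso.inv_comp_eq, ← cancel_epi s.hom, h₁, reassoc_of% h₀]

end BiHH

namespace BiHH

namespace Diagram

/-- A pseudonatural transformation between diagrams. -/
structure Hom (D : Diagram.{v, u}) (D' : Diagram.{v', u'}) where
  app : ∀ n, D.obj n ⥤ D'.obj n
  comm : ∀ {m n : Lvl} (o : Str m n), app m ⋙ D'.map o ≅ D.map o ⋙ app n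
  sq : ∀ {k l l' m : Lvl} {p : Str k l} {q : Str l m} {p' : Str k l'} {q' : Str l' m}
    (r : Sq p q p' q') (x : D.obj k),
    (D'.map q).map ((comm p).hom.app x) ≫ (comm q).hom.app ((D.map p).obj x) ≫
      (app m).map ((D.sq r).hom.app x) =
    (D'.sq r).hom.app ((app k).obj x) ≫ (D'.map q').map ((comm p').hom.app x) ≫
      (comm q').hom.app ((D.map p').obj x)
  tri : ∀ {k l : Lvl} {p : Str k l} {q : Str l k} (r : Tri p q) (x : D.obj k),
    (D'.map q).map ((comm p).hom.app x) ≫ (comm q).hom.app ((D.map p).obj x) ≫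
      (app k).map ((D.tri r).hom.app x) = (D'.tri r).hom.app ((app k).obj x)

variable {D : Diagram.{v, u}} {D' : Diagram.{v', u'}}

lemma str_fib_fib {m n : Lvl} (o : Str m n) (x : D.obj m) {y z : D.obj n}
    (f : (D.map o).obj x ⟶ y) (g : y ⟶ z) :
    ((str o x).hom ≫ fib f) ≫ fib g = (str o x).hom ≫ fib (f ≫ g) := by
  rw [fib_comp, Category.assoc]

lemma str_fib_str_fib {k l m : Lvl} (p : Str k l) (q : Str l m) (x : D.obj k) {y : D.obj l}
    {z : D.obj m} (f : (D.map p).obj x ⟶ y) (g : (D.map q).obj y ⟶ z) :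
    ((str p x).hom ≫ fib f) ≫ (str q y).hom ≫ fib g =
      (str p x).hom ≫ (str q _).hom ≫ fib ((D.map q).map f ≫ g) := by
  rw [fib_comp, Category.assoc, ← Category.assoc (fib f), fib_str, Category.assoc]

lemma str_str_fib_sq {k l l' m : Lvl} {p : Str k l} {q : Str l m} {p' : Str k l'}
    {q' : Str l' m} (r : Sq p q p' q') (x : D.obj k) {z : D.obj m}
    (f : (D.map q').obj ((D.map p').obj x) ⟶ z) :
    (str p x).hom ≫ (str q _).hom ≫ fib ((D.sq r).hom.app x ≫ f) =
      (str p' x).hom ≫ (str q' _).hom ≫ fib f := by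
  have h := str_sq r x
  rw [← Category.assoc] at h ⊢
  rw [← Category.assoc (str p' x).hom, ← h, fib_comp]
  simp only [Category.assoc]

/-- The pseudo-cocone under `D` induced by a transformation from `D` to `D'`. -/
def Hom.cocone (h : Hom D D') : D.Cocone D'.Colim where
  leg n := h.app n ⋙ D'.univ.leg n
  iso {m n} o := NatIso.ofComponents
    (fun x => str o ((h.app m).obj x) ≪≫ (D'.univ.leg n).mapIso ((h.comm o).app x))
    (fun {x y} f => by
      change fib _ ≫ (str _ _).hom ≫ fib _ = ((str _ _).hom ≫ fib _) ≫ fib _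
      have hn : (D'.map o).map ((h.app m).map f) ≫ (h.comm o).hom.app y =
        (h.comm o).hom.app x ≫ (h.app n).map ((D.map o).map f) := (h.comm o).hom.naturality f
      rw [← Category.assoc, fib_str, Category.assoc, Category.assoc]
      refine congrArg (_ ≫ ·) ?_
      exact (fib_comp _ _).symm.trans ((congrArg fib hn).trans (fib_comp _ _)))
  sq {k l l' m p q p' q'} r x := by
    refine (congrArg (_ ≫ ·) (str_fib_fib _ _ _ _)).trans ?_
    refine (str_fib_str_fib p q _ _ _).trans (Eq.trans ?_ (str_fib_str_fib p' q' _ _ _).symm)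
    refine (congrArg (fun t => _ ≫ _ ≫ fib t) (h.sq r x)).trans ?_
    exact str_str_fib_sq r _ _
  tri {k l p q} r x := by
    refine (congrArg (_ ≫ ·) (str_fib_fib _ _ _ _)).trans ?_
    refine (str_fib_str_fib p q _ _ _).trans ?_
    refine (congrArg (fun t => _ ≫ _ ≫ fib t) (h.tri r x)).trans ?_
    exact str_tri r _

/-- The functor on pseudo-colimits induced by a transformation of diagrams. -/
def Hom.colim (h : Hom D D') : D.Colim ⥤ D'.Colim := h.cocone.desc

end Diagram

end BiHH

namespace BiHH

open Bicategory Diagram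

variable {A : Type u} [Bicategory.{w, v} A] {B : Type u'} [Bicategory.{w', v'} B]

/-- The functor on `∐ A(X, X)` induced by a pseudofunctor. -/
@[simps obj]
def lvlMap₀ (σ : A ⥤ᵖ B) : Cyc₀ A ⥤ Cyc₀ B where
  obj x := ⟨σ.map x.F⟩
  map
    | .mk a => cell₀ (σ.map₂ a)
  map_id x := congrArg cell₀ (σ.map₂_id x.F)
  map_comp := by
    rintro _ _ _ ⟨a⟩ ⟨a'⟩
    exact congrArg cell₀ (σ.map₂_comp a a')

/-- The functor on `∐ A(X, Y) × A(Y, X)` induced by a pseudofunctor. -/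
@[simps obj]
def lvlMap₁ (σ : A ⥤ᵖ B) : Cyc₁ A ⥤ Cyc₁ B where
  obj x := ⟨σ.map x.F, σ.map x.G⟩
  map
    | .mk a b => cell₁ (σ.map₂ a) (σ.map₂ b)
  map_id x := congrArg₂ cell₁ (σ.map₂_id x.F) (σ.map₂_id x.G)
  map_comp := by
    rintro _ _ _ ⟨a, b⟩ ⟨a', b'⟩
    exact congrArg₂ cell₁ (σ.map₂_comp a a') (σ.map₂_comp b b')

/-- The functor on `∐ A(X, Y) × A(Y, Z) × A(Z, X)` induced by a pseudofunctor. -/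
@[simps obj]
def lvlMap₂ (σ : A ⥤ᵖ B) : Cyc₂ A ⥤ Cyc₂ B where
  obj x := ⟨σ.map x.F, σ.map x.G, σ.map x.H⟩
  map
    | .mk a b c => cell₂ (σ.map₂ a) (σ.map₂ b) (σ.map₂ c)
  map_id x := Cyc₂.Hom.mk_congr (σ.map₂_id x.F) (σ.map₂_id x.G) (σ.map₂_id x.H)
  map_comp := by
    rintro _ _ _ ⟨a, b, c⟩ ⟨a', b', c'⟩
    exact Cyc₂.Hom.mk_congr (σ.map₂_comp a a') (σ.map₂_comp b b') (σ.map₂_comp c c')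

/-- A triple of 2-isomorphisms, as an isomorphism of the disjoint union of the
`B(X, Y) × B(Y, Z) × B(Z, X)`. -/
@[simps]
def iso₂ {X Y Z : B} {F F' : X ⟶ Y} {G G' : Y ⟶ Z} {H H' : Z ⟶ X} (a : F ≅ F') (b : G ≅ G')
    (c : H ≅ H') : Cyc₂.mk F G H ≅ Cyc₂.mk F' G' H' where
  hom := cell₂ a.hom b.hom c.hom
  inv := cell₂ a.inv b.inv c.inv
  hom_inv_id := Cyc₂.Hom.mk_congr a.hom_inv_id b.hom_inv_id c.hom_inv_id
  inv_hom_id := Cyc₂.Hom.mk_congr a.inv_hom_id b.inv_hom_id c.inv_hom_id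

/-- The functors on the levels of the truncated cyclic bar constructions induced by a
pseudofunctor. -/
def lvlMap (σ : A ⥤ᵖ B) : ∀ n, CycObj A n ⥤ CycObj B n
  | .zero => lvlMap₀ σ
  | .one => lvlMap₁ σ
  | .two => lvlMap₂ σ

lemma mapComp_inv_nat (σ : A ⥤ᵖ B) {X Y Z : A} {F F' : X ⟶ Y} {G G' : Y ⟶ Z} (a : F ⟶ F')
    (b : G ⟶ G') : (σ.map₂ a ▷ σ.map G ≫ σ.map F' ◁ σ.map₂ b) ≫ (σ.mapComp F' G').inv =
      (σ.mapComp F G).inv ≫ σ.map₂ (a ▷ G ≫ F' ◁ b) := by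
  simp

lemma mapId_inv_nat (σ : A ⥤ᵖ B) (X : A) :
    𝟙 (𝟙 (σ.obj X)) ≫ (σ.mapId X).inv = (σ.mapId X).inv ≫ σ.map₂ (𝟙 (𝟙 X)) := by
  simp

/-- The compatibility of the functors induced by a pseudofunctor with the structure functors of
the truncated cyclic bar constructions. -/
def lvlComm (σ : A ⥤ᵖ B) : ∀ {m n : Lvl} (o : Str m n),
    lvlMap σ m ⋙ (cyc B).map o ≅ (cyc A).map o ⋙ lvlMap σ n
  | _, _, .d₀ =>
    (NatIso.ofComponents (fun x : Cyc₁ A => iso₀ (σ.mapComp x.F x.G).symm) (by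
      rintro _ _ ⟨a, b⟩
      exact congrArg cell₀ (mapComp_inv_nat σ a b)) : lvlMap₁ σ ⋙ faceD₀ ≅ faceD₀ ⋙ lvlMap₀ σ)
  | _, _, .d₁ =>
    (NatIso.ofComponents (fun x : Cyc₁ A => iso₀ (σ.mapComp x.G x.F).symm) (by
      rintro _ _ ⟨a, b⟩
      exact congrArg cell₀ (mapComp_inv_nat σ b a)) : lvlMap₁ σ ⋙ faceD₁ ≅ faceD₁ ⋙ lvlMap₀ σ)
  | _, _, .e₀ =>
    (NatIso.ofComponents
      (fun x : Cyc₂ A => iso₁ (σ.mapComp x.F x.G).symm (Iso.refl (σ.map x.H))) (by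
      rintro _ _ ⟨a, b, c⟩
      exact congrArg₂ cell₁ (mapComp_inv_nat σ a b) (id_nat (σ.map₂ c))) :
        lvlMap₂ σ ⋙ faceE₀ ≅ faceE₀ ⋙ lvlMap₁ σ)
  | _, _, .e₁ =>
    (NatIso.ofComponents
      (fun x : Cyc₂ A => iso₁ (Iso.refl (σ.map x.F)) (σ.mapComp x.G x.H).symm) (by
      rintro _ _ ⟨a, b, c⟩
      exact congrArg₂ cell₁ (id_nat (σ.map₂ a)) (mapComp_inv_nat σ b c)) :
        lvlMap₂ σ ⋙ faceE₁ ≅ faceE₁ ⋙ lvlMap₁ σ)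
  | _, _, .e₂ =>
    (NatIso.ofComponents
      (fun x : Cyc₂ A => iso₁ (σ.mapComp x.H x.F).symm (Iso.refl (σ.map x.G))) (by
      rintro _ _ ⟨a, b, c⟩
      exact congrArg₂ cell₁ (mapComp_inv_nat σ c a) (id_nat (σ.map₂ b))) :
        lvlMap₂ σ ⋙ faceE₂ ≅ faceE₂ ⋙ lvlMap₁ σ)
  | _, _, .s₀ =>
    (NatIso.ofComponents
      (fun x : Cyc₀ A => iso₁ (Iso.refl (σ.map x.F)) (σ.mapId x.X).symm) (by
      rintro _ _ ⟨a⟩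
      exact congrArg₂ cell₁ (id_nat (σ.map₂ a))
        (mapId_inv_nat σ _)) :
        lvlMap₀ σ ⋙ degenS₀ ≅ degenS₀ ⋙ lvlMap₁ σ)
  | _, _, .t₀ =>
    (NatIso.ofComponents
      (fun x : Cyc₁ A => iso₂ (Iso.refl (σ.map x.F)) (σ.mapId x.Y).symm (Iso.refl (σ.map x.G))) (by
      rintro _ _ ⟨a, b⟩
      exact Cyc₂.Hom.mk_congr (id_nat (σ.map₂ a))
        (mapId_inv_nat σ _) (id_nat (σ.map₂ b))) :
        lvlMap₁ σ ⋙ degenT₀ ≅ degenT₀ ⋙ lvlMap₂ σ)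
  | _, _, .t₁ =>
    (NatIso.ofComponents
      (fun x : Cyc₁ A => iso₂ (Iso.refl (σ.map x.F)) (Iso.refl (σ.map x.G)) (σ.mapId x.X).symm) (by
      rintro _ _ ⟨a, b⟩
      exact Cyc₂.Hom.mk_congr (id_nat (σ.map₂ a)) (id_nat (σ.map₂ b))
        (mapId_inv_nat σ _)) :
        lvlMap₁ σ ⋙ degenT₁ ≅ degenT₁ ⋙ lvlMap₂ σ)

lemma mapComp_assoc_hom (σ : A ⥤ᵖ B) {X Y Z W : A} (F : X ⟶ Y) (G : Y ⟶ Z) (H : Z ⟶ W) :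
    ((σ.mapComp F G).inv ▷ σ.map H ≫ σ.map (F ≫ G) ◁ 𝟙 (σ.map H)) ≫
        (σ.mapComp (F ≫ G) H).inv ≫ σ.map₂ (α_ F G H).hom =
    (α_ (σ.map F) (σ.map G) (σ.map H)).hom ≫
      (𝟙 (σ.map F) ▷ (σ.map G ≫ σ.map H) ≫ σ.map F ◁ (σ.mapComp G H).inv) ≫
      (σ.mapComp F (G ≫ H)).inv := by
  simp

lemma mapComp_assoc_inv (σ : A ⥤ᵖ B) {X Y Z W : A} (F : X ⟶ Y) (G : Y ⟶ Z) (H : Z ⟶ W) :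
    (𝟙 (σ.map F) ▷ (σ.map G ≫ σ.map H) ≫ σ.map F ◁ (σ.mapComp G H).inv) ≫
      (σ.mapComp F (G ≫ H)).inv ≫ σ.map₂ (α_ F G H).inv =
    (α_ (σ.map F) (σ.map G) (σ.map H)).inv ≫
      ((σ.mapComp F G).inv ▷ σ.map H ≫ σ.map (F ≫ G) ◁ 𝟙 (σ.map H)) ≫
        (σ.mapComp (F ≫ G) H).inv := by
  have h := mapComp_assoc_hom σ F G H
  rw [← Category.assoc, ← Iso.inv_comp_eq] at h
  have h2 : σ.map₂ (α_ F G H).hom ≫ σ.map₂ (α_ F G H).inv = 𝟙 _ := by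
    rw [← σ.map₂_comp, Iso.hom_inv_id, σ.map₂_id]
  rw [← Category.assoc, ← h]
  simp only [Category.assoc, h2, Category.comp_id]

lemma mapComp_right_unit (σ : A ⥤ᵖ B) {X Y : A} (F : X ⟶ Y) :
    (𝟙 (σ.map F) ▷ 𝟙 (σ.obj Y) ≫ σ.map F ◁ (σ.mapId Y).inv) ≫ (σ.mapComp F (𝟙 Y)).inv ≫
      σ.map₂ (ρ_ F).hom = (ρ_ (σ.map F)).hom := by
  simp

lemma mapComp_left_unit (σ : A ⥤ᵖ B) {X Y : A} (F : X ⟶ Y) :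
    ((σ.mapId X).inv ▷ σ.map F ≫ σ.map (𝟙 X) ◁ 𝟙 (σ.map F)) ≫ (σ.mapComp (𝟙 X) F).inv ≫
      σ.map₂ (λ_ F).hom = (λ_ (σ.map F)).hom := by
  simp

lemma id_comp_map₂_id (σ : A ⥤ᵖ B) {X Y : A} (F : X ⟶ Y) :
    𝟙 (σ.map F) ≫ 𝟙 (σ.map F) ≫ σ.map₂ (𝟙 F) = 𝟙 (σ.map F) := by
  simp

lemma unit_aux₁ (σ : A ⥤ᵖ B) {X Y : A} (F : X ⟶ Y) :
    𝟙 (σ.map F) ≫ 𝟙 (σ.map F) ≫ σ.map₂ (𝟙 F) =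
      𝟙 (σ.map F) ≫ 𝟙 (σ.map F) ≫ 𝟙 (σ.map F) := by
  simp

lemma unit_aux₂ (σ : A ⥤ᵖ B) (X : A) :
    𝟙 (𝟙 (σ.obj X)) ≫ (σ.mapId X).inv ≫ σ.map₂ (𝟙 (𝟙 X)) =
      𝟙 (𝟙 (σ.obj X)) ≫ (σ.mapId X).inv ≫ 𝟙 (σ.map (𝟙 X)) := by
  simp

lemma unit_aux₃ (σ : A ⥤ᵖ B) (X : A) :
    (σ.mapId X).inv ≫ 𝟙 (σ.map (𝟙 X)) ≫ σ.map₂ (𝟙 (𝟙 X)) =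
      𝟙 (𝟙 (σ.obj X)) ≫ 𝟙 (𝟙 (σ.obj X)) ≫ (σ.mapId X).inv := by
  simp

lemma unit_aux₄ (σ : A ⥤ᵖ B) {X Y Z : A} (F : X ⟶ Y) (G : Y ⟶ Z) :
    (𝟙 (σ.map F) ▷ σ.map G ≫ σ.map F ◁ 𝟙 (σ.map G)) ≫ (σ.mapComp F G).inv ≫
      σ.map₂ (𝟙 (F ≫ G)) = 𝟙 (σ.map F ≫ σ.map G) ≫ (σ.mapComp F G).inv ≫ 𝟙 (σ.map (F ≫ G)) := by
  simp

/-- The transformation of truncated cyclic bar constructions induced by a pseudofunctor. -/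
def cycHom (σ : A ⥤ᵖ B) : Diagram.Hom (cyc A) (cyc B) where
  app := lvlMap σ
  comm := lvlComm σ
  sq r x := by
    cases r with
    | dd₀₁ =>
      obtain ⟨F, G, H⟩ := x
      exact congrArg cell₀ (mapComp_assoc_inv σ F G H)
    | dd₀₂ =>
      obtain ⟨F, G, H⟩ := x
      exact congrArg cell₀ (mapComp_assoc_hom σ H F G)
    | dd₁₂ =>
      obtain ⟨F, G, H⟩ := x
      exact congrArg cell₀ (mapComp_assoc_inv σ G H F)
    | ss =>
      exact Cyc₂.Hom.mk_congr (unit_aux₁ σ x.F) (unit_aux₂ σ x.X) (unit_aux₃ σ x.X)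
    | ds₀₁ => exact congrArg₂ cell₁ (unit_aux₄ σ x.F x.G) (unit_aux₃ σ x.X)
    | ds₂₀ => exact congrArg₂ cell₁ (unit_aux₄ σ x.G x.F) (unit_aux₃ σ x.Y)
  tri r x := by
    cases r with
    | s₀d₀ => exact congrArg cell₀ (mapComp_right_unit σ x.F)
    | s₀d₁ => exact congrArg cell₀ (mapComp_left_unit σ x.F)
    | t₀e₀ => exact congrArg₂ cell₁ (mapComp_right_unit σ x.F) (id_comp_map₂_id σ x.G)
    | t₀e₁ => exact congrArg₂ cell₁ (id_comp_map₂_id σ x.F) (mapComp_left_unit σ x.G)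
    | t₁e₁ => exact congrArg₂ cell₁ (id_comp_map₂_id σ x.F) (mapComp_right_unit σ x.G)
    | t₁e₂ => exact congrArg₂ cell₁ (mapComp_left_unit σ x.F) (id_comp_map₂_id σ x.G)

/-- The functor `biHH(σ) : biHH(A) ⥤ biHH(B)` induced by a pseudofunctor `σ : A ⥤ᵖ B`. -/
def map (σ : A ⥤ᵖ B) : BiHH A ⥤ BiHH B := (cycHom σ).colim

lemma map_mulL (σ : A ⥤ᵖ B) {X Y : A} (F : X ⟶ Y) (G : Y ⟶ X) :
    (map σ).map (mulL F G).hom =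
      (mulL (σ.map F) (σ.map G)).hom ≫ ofCell (σ.mapComp F G).inv := rfl

lemma map_mulR (σ : A ⥤ᵖ B) {X Y : A} (F : X ⟶ Y) (G : Y ⟶ X) :
    (map σ).map (mulR F G).hom =
      (mulR (σ.map F) (σ.map G)).hom ≫ ofCell (σ.mapComp G F).inv := rfl

lemma map_mulL_inv (σ : A ⥤ᵖ B) {X Y : A} (F : X ⟶ Y) (G : Y ⟶ X) :
    (map σ).map (mulL F G).inv =
      ofCell (σ.mapComp F G).hom ≫ (mulL (σ.map F) (σ.map G)).inv := rfl

lemma map_theta (σ : A ⥤ᵖ B) {X Y : A} (F : X ⟶ Y) (G : Y ⟶ X) :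
    (map σ).map (theta F G).hom = ofCell (σ.mapComp F G).hom ≫
      (theta (σ.map F) (σ.map G)).hom ≫ ofCell (σ.mapComp G F).inv := by
  refine ((map σ).map_comp (mulL F G).inv (mulR F G).hom).trans ?_
  rw [map_mulL_inv, map_mulR]
  simp only [theta, Iso.trans_hom, Iso.symm_hom, Category.assoc]
  exact Category.assoc _ _ _

end BiHH

namespace BiHH

open Bicategory Diagram

variable {B : Type u} [Bicategory.{w, v} B]

/-- A 1-cell is an equivalence. -/
def IsEquiv₁ {X Y : B} (P : X ⟶ Y) : Prop :=
  ∃ Q : Y ⟶ X, Nonempty (P ≫ Q ≅ 𝟙 X) ∧ Nonempty (Q ≫ P ≅ 𝟙 Y)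

namespace IsEquiv₁

lemma id (X : B) : IsEquiv₁ (𝟙 X) := ⟨𝟙 X, ⟨λ_ (𝟙 X)⟩, ⟨λ_ (𝟙 X)⟩⟩

lemma comp {X Y Z : B} {P : X ⟶ Y} {R : Y ⟶ Z} (hP : IsEquiv₁ P) (hR : IsEquiv₁ R) :
    IsEquiv₁ (P ≫ R) := by
  obtain ⟨Q, ⟨e⟩, ⟨e'⟩⟩ := hP
  obtain ⟨S, ⟨d⟩, ⟨d'⟩⟩ := hR
  refine ⟨S ≫ Q, ⟨?_⟩, ⟨?_⟩⟩
  · exact α_ P R (S ≫ Q) ≪≫ whiskerLeftIso P ((α_ R S Q).symm ≪≫ whiskerRightIso d Q ≪≫ λ_ Q) ≪≫ e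
  · exact α_ S Q (P ≫ R) ≪≫ whiskerLeftIso S ((α_ Q P R).symm ≪≫ whiskerRightIso e' R ≪≫ λ_ R) ≪≫
      d'

lemma unit_nat {X Y Z : B} {P : X ⟶ Y} {Q : Y ⟶ X} (e' : Q ≫ P ≅ 𝟙 Y) {K L : Y ⟶ Z}
    (f : K ⟶ L) : f ≫ (λ_ L).inv ≫ e'.inv ▷ L ≫ (α_ Q P L).hom =
      ((λ_ K).inv ≫ e'.inv ▷ K ≫ (α_ Q P K).hom) ≫ Q ◁ P ◁ f := by
  have h := whisker_exchange e'.inv f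
  rw [comp_whiskerLeft, id_whiskerLeft] at h
  have h' := congrArg (fun t => (λ_ K).inv ≫ t ≫ (α_ Q P L).hom) h
  simpa using h'

lemma counit_nat {X Y Z : B} {P : X ⟶ Y} {Q : Y ⟶ X} (e : P ≫ Q ≅ 𝟙 X) {K L : X ⟶ Z}
    (f : K ⟶ L) : P ◁ Q ◁ f ≫ (α_ P Q L).inv ≫ e.hom ▷ L ≫ (λ_ L).hom =
      ((α_ P Q K).inv ≫ e.hom ▷ K ≫ (λ_ K).hom) ≫ f := by
  have h := whisker_exchange e.hom f
  rw [comp_whiskerLeft, id_whiskerLeft] at h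
  have h' := congrArg (fun t => (α_ P Q K).inv ≫ t ≫ (λ_ L).hom) h
  simpa using h'

lemma isEquivalence {X Y : B} {P : X ⟶ Y} (hP : IsEquiv₁ P) (Z : B) :
    (precomp Z P).IsEquivalence := by
  obtain ⟨Q, ⟨e⟩, ⟨e'⟩⟩ := hP
  refine (CategoryTheory.Equivalence.mk (precomp Z P) (precomp Z Q) ?_ ?_).isEquivalence_functor
  · exact NatIso.ofComponents (fun K => (λ_ K).symm ≪≫ whiskerRightIso e'.symm K ≪≫ α_ Q P K)
      (fun f => unit_nat e' f)
  · exact NatIso.ofComponents (fun K => (α_ P Q K).symm ≪≫ whiskerRightIso e K ≪≫ λ_ K)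
      (fun f => counit_nat e f)

lemma whiskerLeft_injective {X Y Z : B} {P : X ⟶ Y} (hP : IsEquiv₁ P) {K L : Y ⟶ Z} {k l : K ⟶ L}
    (h : P ◁ k = P ◁ l) : k = l := by
  have := hP.isEquivalence Z
  exact (precomp Z P).map_injective h

lemma whiskerLeft_surjective {X Y Z : B} {P : X ⟶ Y} (hP : IsEquiv₁ P) {K L : Y ⟶ Z}
    (l : P ≫ K ⟶ P ≫ L) : ∃ k : K ⟶ L, P ◁ k = l := by
  have := hP.isEquivalence Z
  exact (precomp Z P).map_surjective l

lemma exists_iso {X Y Z : B} {P : X ⟶ Y} (hP : IsEquiv₁ P) (L : X ⟶ Z) :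
    ∃ K : Y ⟶ Z, Nonempty (L ≅ P ≫ K) := by
  have := hP.isEquivalence Z
  exact ⟨(precomp Z P).objPreimage L, ⟨((precomp Z P).objObjPreimageIso L).symm⟩⟩

end IsEquiv₁

/-- A factorization of a 2-cell `a : F ≫ R ⟶ P ≫ F'` as `F ≫ R ≅ (P ≫ K) ≫ R ≅ P ≫ (K ≫ R) ⟶ P ≫ F'`.
If `P` is an equivalence with inverse `Q`, then such a factorization exists, with `K ≅ Q ≫ F`. -/
structure Fac {X Y X' Y' : B} {F : X ⟶ Y} {R : Y ⟶ Y'} {P : X ⟶ X'} {F' : X' ⟶ Y'}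
    (a : F ≫ R ⟶ P ≫ F') where
  K : X' ⟶ Y
  c : F ≅ P ≫ K
  d : K ≫ R ⟶ F'
  fac : c.hom ▷ R ≫ (α_ P K R).hom ≫ P ◁ d = a

lemma Fac.nonempty {X Y X' Y' : B} {F : X ⟶ Y} {R : Y ⟶ Y'} {P : X ⟶ X'} {F' : X' ⟶ Y'}
    (a : F ≫ R ⟶ P ≫ F') (hP : IsEquiv₁ P) : Nonempty (Fac a) := by
  obtain ⟨K, ⟨c⟩⟩ := hP.exists_iso F
  obtain ⟨d, hd⟩ := hP.whiskerLeft_surjective ((α_ P K R).inv ≫ c.inv ▷ R ≫ a)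
  exact ⟨⟨K, c, d, by rw [hd]; simp⟩⟩

/-- The morphism `[x] ≅ [P ≫ K] ≅ [K ≫ P] ⟶ [y]` of `biHH(B)` associated to a factorization of a
2-cell `a : x ≫ P ⟶ P ≫ y`. -/
def Fac.conj {X Y : B} {P : X ⟶ Y} {x : X ⟶ X} {y : Y ⟶ Y} {a : x ≫ P ⟶ P ≫ y} (f : Fac a) :
    ob x ⟶ ob y :=
  ofCell f.c.hom ≫ (theta f.K P).inv ≫ ofCell f.d

lemma theta_inv_naturality {X Y : B} {F F' : X ⟶ Y} {G G' : Y ⟶ X} (a : F ⟶ F') (b : G ⟶ G') :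
    ofCell (b ▷ F ≫ G' ◁ a) ≫ (theta F' G').inv =
      (theta F G).inv ≫ ofCell (a ▷ G ≫ F' ◁ b) := by
  rw [Iso.eq_inv_comp, ← Category.assoc, Iso.comp_inv_eq, theta_naturality]

lemma theta_inv_left {X Y : B} {F F' : X ⟶ Y} (a : F ⟶ F') (G : Y ⟶ X) :
    ofCell (G ◁ a) ≫ (theta F' G).inv = (theta F G).inv ≫ ofCell (a ▷ G) := by
  simpa using theta_inv_naturality a (𝟙 G)

lemma theta_inv_right {X Y : B} (F : X ⟶ Y) {G G' : Y ⟶ X} (b : G ⟶ G') :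
    ofCell (b ▷ F) ≫ (theta F G').inv = (theta F G).inv ≫ ofCell (F ◁ b) := by
  simpa using theta_inv_naturality (𝟙 F) b

/-- Naturality of the conjugation morphisms. -/
lemma Fac.conj_naturality {X Y : B} {P P' : X ⟶ Y} {x x' : X ⟶ X} {y y' : Y ⟶ Y}
    {a : x ≫ P ⟶ P ≫ y} {a' : x' ≫ P' ⟶ P' ≫ y'} (f : Fac a) (f' : Fac a') (hP : IsEquiv₁ P')
    (p : P ≅ P') (m : x ⟶ x') (n : y ⟶ y')
    (h : a ≫ p.hom ▷ y ≫ P' ◁ n = m ▷ P ≫ x' ◁ p.hom ≫ a') :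
    ofCell m ≫ f'.conj = f.conj ≫ ofCell n := by
  obtain ⟨k, hk⟩ := hP.whiskerLeft_surjective (p.inv ▷ f.K ≫ f.c.inv ≫ m ≫ f'.c.hom)
  have hd : k ▷ P ≫ f'.K ◁ p.hom ≫ f'.d = f.d ≫ n := by
    refine hP.whiskerLeft_injective ?_
    rw [← cancel_epi (α_ P' f.K P).hom, ← cancel_epi (p.hom ▷ f.K ▷ P), ← cancel_epi (f.c.hom ▷ P)]
    calc
      _ = f.c.hom ▷ P ≫ p.hom ▷ f.K ▷ P ≫ (P' ◁ k) ▷ P ≫ (α_ P' f'.K P).hom ≫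
          P' ◁ f'.K ◁ p.hom ≫ P' ◁ f'.d := by simp
      _ = m ▷ P ≫ x' ◁ p.hom ≫ f'.c.hom ▷ P' ≫ (α_ P' f'.K P').hom ≫ P' ◁ f'.d := by
          rw [hk, whisker_exchange_assoc]; simp
      _ = f.c.hom ▷ P ≫ (α_ P f.K P).hom ≫ P ◁ f.d ≫ p.hom ▷ y ≫ P' ◁ n := by
          have h1 := f.fac
          have h2 := f'.fac
          have h3 := congrArg (· ≫ p.hom ▷ y ≫ P' ◁ n) h1
          rw [h2, ← h, ← h3]; simp
      _ = _ := by rw [whisker_exchange_assoc]; simp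
  have hc : m ≫ f'.c.hom = f.c.hom ≫ p.hom ▷ f.K ≫ P' ◁ k := by
    rw [hk]; simp
  unfold Fac.conj
  rw [← Category.assoc, ← ofCell_comp, hc]
  have h1 := theta_inv_naturality k p.hom
  rw [ofCell_comp, Category.assoc, reassoc_of% h1, Category.assoc, Category.assoc]
  rw [← ofCell_comp, ← ofCell_comp, Category.assoc, hd]

end BiHH

namespace BiHH

open Bicategory Diagram

variable {B : Type u} [Bicategory.{w, v} B]

/-- The conjugation morphism `[x] ≅ [P ≫ K] ≅ [K ≫ P] ⟶ [y]` of `biHH(B)` associated to an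
equivalence `P` and a 2-cell `a : x ≫ P ⟶ P ≫ y`. It does not depend on the choice of the
factorization of `a`, by `conj_eq`. -/
noncomputable def conj {X Y : B} {P : X ⟶ Y} (hP : IsEquiv₁ P) {x : X ⟶ X} {y : Y ⟶ Y}
    (a : x ≫ P ⟶ P ≫ y) : ob x ⟶ ob y :=
  (Fac.nonempty a hP).some.conj

lemma conj_eq {X Y : B} {P : X ⟶ Y} (hP : IsEquiv₁ P) {x : X ⟶ X} {y : Y ⟶ Y}
    {a : x ≫ P ⟶ P ≫ y} (f : Fac a) : conj hP a = f.conj := by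
  have h := Fac.conj_naturality (Fac.nonempty a hP).some f hP (Iso.refl P) (𝟙 x) (𝟙 y) (by simp)
  simpa [conj] using h.symm

lemma conj_naturality {X Y : B} {P P' : X ⟶ Y} (hP : IsEquiv₁ P) (hP' : IsEquiv₁ P')
    {x x' : X ⟶ X} {y y' : Y ⟶ Y} {a : x ≫ P ⟶ P ≫ y} {a' : x' ≫ P' ⟶ P' ≫ y'}
    (p : P ≅ P') (m : x ⟶ x') (n : y ⟶ y')
    (h : a ≫ p.hom ▷ y ≫ P' ◁ n = m ▷ P ≫ x' ◁ p.hom ≫ a') :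
    ofCell m ≫ conj hP' a' = conj hP a ≫ ofCell n :=
  Fac.conj_naturality _ _ hP' p m n h

lemma conj_id {X : B} (x : X ⟶ X) :
    conj (IsEquiv₁.id X) ((ρ_ x).hom ≫ (λ_ x).inv) = 𝟙 (ob x) := by
  let f : Fac ((ρ_ x).hom ≫ (λ_ x).inv) := ⟨x, (λ_ x).symm, (ρ_ x).hom, by simp⟩
  rw [conj_eq _ f]
  have h := theta_unit x
  change _ = (ofIso (ρ_ x)).hom ≫ (ofIso (λ_ x)).inv at h
  change (ofIso (λ_ x)).inv ≫ (theta x (𝟙 X)).inv ≫ (ofIso (ρ_ x)).hom = _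
  rw [Iso.inv_comp_eq, Iso.inv_comp_eq, h]
  simp only [Category.assoc, Category.comp_id, Iso.inv_hom_id]

/-- The composite of two squares. -/
def hcomp {X Y Z : B} {P : X ⟶ Y} {R : Y ⟶ Z} {X' Y' Z' : B} {P' : X' ⟶ Y'} {R' : Y' ⟶ Z'}
    {x : X ⟶ X'} {y : Y ⟶ Y'} {z : Z ⟶ Z'} (a : x ≫ P' ⟶ P ≫ y) (b : y ≫ R' ⟶ R ≫ z) :
    x ≫ P' ≫ R' ⟶ (P ≫ R) ≫ z :=
  (α_ x P' R').inv ≫ a ▷ R' ≫ (α_ P y R').hom ≫ P ◁ b ≫ (α_ P R z).inv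

lemma theta_inv_hexagon {X Y Z : B} (F : X ⟶ Y) (G : Y ⟶ Z) (H : Z ⟶ X) :
    (theta F (G ≫ H)).inv = ofCell (α_ G H F).hom ≫ (theta (H ≫ F) G).inv ≫
      ofCell (α_ H F G).hom ≫ (theta (F ≫ G) H).inv ≫ ofCell (α_ F G H).hom := by
  have h := theta_hexagon F G H
  change _ = (ofIso (α_ F G H)).inv ≫ _ ≫ (ofIso (α_ H F G)).inv ≫ _ ≫ (ofIso (α_ G H F)).inv at h
  change _ = (ofIso (α_ G H F)).hom ≫ _ ≫ (ofIso (α_ H F G)).hom ≫ _ ≫ (ofIso (α_ F G H)).hom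
  rw [← cancel_epi (theta F (G ≫ H)).hom, Iso.hom_inv_id, h]
  simp only [Category.assoc, Iso.inv_hom_id_assoc, Iso.hom_inv_id_assoc, Iso.inv_hom_id]

lemma conj_comp {X Y Z : B} {P : X ⟶ Y} {R : Y ⟶ Z} (hP : IsEquiv₁ P) (hR : IsEquiv₁ R)
    {x : X ⟶ X} {y : Y ⟶ Y} {z : Z ⟶ Z} (a : x ≫ P ⟶ P ≫ y) (b : y ≫ R ⟶ R ≫ z) :
    conj (hP.comp hR) (hcomp a b) = conj hP a ≫ conj hR b := by
  obtain ⟨K, c, d, rfl⟩ := (Fac.nonempty a hP).some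
  obtain ⟨L, c', d', rfl⟩ := (Fac.nonempty b hR).some
  obtain ⟨M, ⟨m⟩⟩ := hR.exists_iso K
  obtain ⟨n, hn⟩ := hR.whiskerLeft_surjective ((α_ R M P).inv ≫ m.inv ▷ P ≫ d ≫ c'.hom)
  have hd : d ≫ c'.hom = m.hom ▷ P ≫ (α_ R M P).hom ≫ R ◁ n := by
    rw [hn]; simp
  have hd' : P ◁ d ▷ R ≫ P ◁ c'.hom ▷ R =
      P ◁ (m.hom ▷ P ≫ (α_ R M P).hom ≫ R ◁ n) ▷ R := by
    rw [← hd]; simp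
  let k : Fac (hcomp (c.hom ▷ P ≫ (α_ P K P).hom ≫ P ◁ d)
      (c'.hom ▷ R ≫ (α_ R L R).hom ≫ R ◁ d')) :=
    { K := M
      c := c ≪≫ whiskerLeftIso P m ≪≫ (α_ P R M).symm
      d := (α_ M P R).inv ≫ n ▷ R ≫ d'
      fac := by
        simp only [hcomp, comp_whiskerRight, whisker_assoc, Category.assoc, whiskerLeft_comp,
          Iso.inv_hom_id_assoc, reassoc_of% hd']
        simp only [Iso.trans_hom, whiskerLeftIso_hom, Iso.symm_hom]
        bicategory }
  rw [conj_eq _ k, conj_eq hP ⟨K, c, d, rfl⟩, conj_eq hR ⟨L, c', d', rfl⟩]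
  have h1 := theta_inv_left m.hom P
  have h2 := theta_inv_left n R
  have h3 : ofCell (α_ P R M).inv ≫ ofCell (α_ P R M).hom = 𝟙 _ := (ofIso (α_ P R M)).inv_hom_id
  have h4 : ofCell (α_ M P R).hom ≫ ofCell (α_ M P R).inv = 𝟙 _ := (ofIso (α_ M P R)).hom_inv_id
  have h5 := congrArg ofCell hd
  simp only [ofCell_comp] at h5
  simp only [Fac.conj, k, Iso.trans_hom, whiskerLeftIso_hom, Iso.symm_hom, ofCell_comp,
    theta_inv_hexagon M P R, Category.assoc, reassoc_of% h3, reassoc_of% h4]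
  rw [reassoc_of% h1, reassoc_of% h5, reassoc_of% h2]

end BiHH

namespace BiHH

open Bicategory Diagram

variable {B : Type u} [Bicategory.{w, v} B]

/-- The pasting of two squares. -/
def vpaste {X Y Z X' Y' Z' : B} {P : X ⟶ X'} {R : Y ⟶ Y'} {Q : Z ⟶ Z'} {F : X ⟶ Y} {G : Y ⟶ Z}
    {F' : X' ⟶ Y'} {G' : Y' ⟶ Z'} (a : F ≫ R ⟶ P ≫ F') (b : G ≫ Q ⟶ R ≫ G') :
    (F ≫ G) ≫ Q ⟶ P ≫ (F' ≫ G') :=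
  (α_ F G Q).hom ≫ F ◁ b ≫ (α_ F R G').inv ≫ a ▷ G' ≫ (α_ P F' G').hom

/-- A factorization of a pasting of two squares. -/
def Fac.vpaste {X Y Z X' Y' Z' : B} {P : X ⟶ X'} {R : Y ⟶ Y'} {Q : Z ⟶ Z'} {F : X ⟶ Y}
    {G : Y ⟶ Z} {F' : X' ⟶ Y'} {G' : Y' ⟶ Z'} {a : F ≫ R ⟶ P ≫ F'} {b : G ≫ Q ⟶ R ≫ G'}
    (f : Fac a) (g : Fac b) : Fac (vpaste a b) where
  K := f.K ≫ R ≫ g.K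
  c := whiskerRightIso f.c G ≪≫ whiskerLeftIso (P ≫ f.K) g.c ≪≫ α_ P f.K (R ≫ g.K)
  d := (α_ f.K (R ≫ g.K) Q).hom ≫ f.K ◁ (α_ R g.K Q).hom ≫ (α_ f.K R (g.K ≫ Q)).inv ≫
    f.d ▷ (g.K ≫ Q) ≫ F' ◁ g.d
  fac := by
    obtain ⟨S, c, d, rfl⟩ := f
    obtain ⟨T, e, d', rfl⟩ := g
    have h1 : F ◁ (e.hom ▷ Q ≫ (α_ R T Q).hom ≫ R ◁ d') ≫ (α_ F R G').inv ≫ c.hom ▷ R ▷ G' =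
        c.hom ▷ (G ≫ Q) ≫ (P ≫ S) ◁ (e.hom ▷ Q ≫ (α_ R T Q).hom ≫ R ◁ d') ≫
          (α_ (P ≫ S) R G').inv := by
      rw [← associator_inv_naturality_left, whisker_exchange_assoc]
    have h2 : S ◁ R ◁ d' ≫ (α_ S R G').inv ≫ d ▷ G' =
        (α_ S R (T ≫ Q)).inv ≫ d ▷ (T ≫ Q) ≫ F' ◁ d' := by
      rw [← whisker_exchange]; simp
    symm
    calc
      _ = (α_ F G Q).hom ≫ (F ◁ (e.hom ▷ Q ≫ (α_ R T Q).hom ≫ R ◁ d') ≫ (α_ F R G').inv ≫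
            c.hom ▷ R ▷ G') ≫ (α_ P S R).hom ▷ G' ≫ (P ◁ d) ▷ G' ≫ (α_ P F' G').hom := by
          simp [BiHH.vpaste]
      _ = c.hom ▷ G ▷ Q ≫ (α_ (P ≫ S) G Q).hom ≫ (P ≫ S) ◁ e.hom ▷ Q ≫
            (P ≫ S) ◁ (α_ R T Q).hom ≫ (α_ P S (R ≫ T ≫ Q)).hom ≫
            P ◁ (S ◁ R ◁ d' ≫ (α_ S R G').inv ≫ d ▷ G') := by
          rw [h1]; simp
      _ = _ := by
          rw [h2]
          simp only [Iso.trans_hom, whiskerLeftIso_hom, whiskerRightIso_hom]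
          bicategory

lemma theta_left {X Y : B} {F F' : X ⟶ Y} (a : F ⟶ F') (G : Y ⟶ X) :
    ofCell (a ▷ G) ≫ (theta F' G).hom = (theta F G).hom ≫ ofCell (G ◁ a) := by
  simpa using theta_naturality a (𝟙 G)

lemma theta_rotate {X Y X' Y' : B} (P : X ⟶ X') (S : X' ⟶ Y) (R : Y ⟶ Y') (T : Y' ⟶ X) :
    ofCell (α_ P S (R ≫ T)).hom ≫ (theta (S ≫ R ≫ T) P).inv ≫ ofCell (α_ S (R ≫ T) P).hom ≫
      ofCell (S ◁ (α_ R T P).hom) ≫ ofCell (α_ S R (T ≫ P)).inv ≫ (theta (S ≫ R) (T ≫ P)).hom =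
    (theta (P ≫ S) (R ≫ T)).hom ≫ ofCell (α_ R T (P ≫ S)).hom ≫ (theta (T ≫ P ≫ S) R).inv ≫
      ofCell (α_ T (P ≫ S) R).hom ≫ ofCell (T ◁ (α_ P S R).hom) ≫
      ofCell (α_ T P (S ≫ R)).inv := by
  have e1 : ofCell (α_ R T (P ≫ S)).inv ≫ ofCell (α_ R T (P ≫ S)).hom = 𝟙 _ :=
    (ofIso (α_ R T (P ≫ S))).inv_hom_id
  have e2 : ofCell (α_ T (P ≫ S) R).inv ≫ ofCell (α_ T (P ≫ S) R).hom = 𝟙 _ :=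
    (ofIso (α_ T (P ≫ S) R)).inv_hom_id
  have e3 : (α_ S (R ≫ T) P).hom ≫ S ◁ (α_ R T P).hom ≫ (α_ S R (T ≫ P)).inv ≫
      (α_ (S ≫ R) T P).inv = (α_ S R T).inv ▷ P := by bicategory
  have e3' := congrArg ofCell e3
  simp only [ofCell_comp] at e3'
  have e4 : (α_ P S (R ≫ T)).hom ≫ P ◁ (α_ S R T).inv ≫ (α_ P (S ≫ R) T).inv =
      (α_ (P ≫ S) R T).inv ≫ (α_ P S R).hom ▷ T := by bicategory
  have e4' := congrArg ofCell e4
  simp only [ofCell_comp] at e4'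
  have h1 := theta_inv_left (α_ S R T).inv P
  have h2 := theta_left (α_ P S R).hom T
  rw [theta_hexagon (S ≫ R) T P, theta_hexagon (P ≫ S) R T]
  simp only [Category.assoc, reassoc_of% e1, reassoc_of% e2, Iso.hom_inv_id_assoc]
  rw [reassoc_of% e3', ← reassoc_of% h1, Iso.inv_hom_id_assoc, reassoc_of% e4', reassoc_of% h2]

lemma conj_theta {X Y X' Y' : B} {P : X ⟶ X'} {R : Y ⟶ Y'} (hP : IsEquiv₁ P) (hR : IsEquiv₁ R)
    {F : X ⟶ Y} {G : Y ⟶ X} {F' : X' ⟶ Y'} {G' : Y' ⟶ X'} (a : F ≫ R ⟶ P ≫ F')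
    (b : G ≫ P ⟶ R ≫ G') :
    conj hP (vpaste a b) ≫ (theta F' G').hom = (theta F G).hom ≫ conj hR (vpaste b a) := by
  obtain ⟨f⟩ := Fac.nonempty a hP
  obtain ⟨g⟩ := Fac.nonempty b hR
  rw [conj_eq hP (f.vpaste g), conj_eq hR (g.vpaste f)]
  have h1 := theta_naturality f.d g.d
  have h2 := theta_naturality f.c.hom g.c.hom
  have h3 := theta_rotate P f.K R g.K
  simp only [ofCell_comp, Category.assoc] at h1 h2
  simp only [Fac.conj, Fac.vpaste, Iso.trans_hom, whiskerLeftIso_hom, whiskerRightIso_hom,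
    ofCell_comp, Category.assoc]
  rw [h1, ← reassoc_of% h2, ← reassoc_of% h3]

end BiHH

namespace BiHH

open Bicategory Diagram

open scoped Pseudofunctor.StrongTrans

variable {A : Type u} [Bicategory.{w, v} A] {B : Type u'} [Bicategory.{w', v'} B]

/-- The pseudonatural equivalences between two pseudofunctors: the pseudonatural transformations
all of whose components are equivalences. -/
def PsEquiv (σ τ : A ⥤ᵖ B) := { η : σ ⟶ τ // ∀ X : A, IsEquiv₁ (η.app X) }

/-- Two pseudonatural equivalences are identified if there is an invertible modification between
them. -/
def psSetoid (σ τ : A ⥤ᵖ B) : Setoid (PsEquiv σ τ) where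
  r η η' := Nonempty (η.1 ≅ η'.1)
  iseqv := ⟨fun η => ⟨Iso.refl η.1⟩, fun ⟨e⟩ => ⟨e.symm⟩, fun ⟨e⟩ ⟨e'⟩ => ⟨e ≪≫ e'⟩⟩

end BiHH

/-- The category `Fun(A, B)`, for bicategories `A` and `B`. Its objects are the pseudofunctors
from `A` to `B`, and its morphisms are the pseudonatural equivalences, up to invertible
modifications. -/
structure FunCat (A : Type u) [Bicategory.{w, v} A] (B : Type u') [Bicategory.{w', v'} B] where
  toPseudofunctor : Pseudofunctor A B

namespace BiHH

open Bicategory Diagram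

open scoped Pseudofunctor.StrongTrans

variable {A : Type u} [Bicategory.{w, v} A] {B : Type u'} [Bicategory.{w', v'} B]

/-- The identity pseudonatural equivalence. -/
def PsEquiv.id (σ : A ⥤ᵖ B) : PsEquiv σ σ := ⟨𝟙 σ, fun _ => IsEquiv₁.id _⟩

/-- The composite of two pseudonatural equivalences. -/
def PsEquiv.comp {σ τ υ : A ⥤ᵖ B} (η : PsEquiv σ τ) (κ : PsEquiv τ υ) : PsEquiv σ υ :=
  ⟨η.1 ≫ κ.1, fun X => (η.2 X).comp (κ.2 X)⟩

instance : Category (FunCat A B) where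
  Hom σ τ := _root_.Quotient (psSetoid σ.toPseudofunctor τ.toPseudofunctor)
  id σ := Quotient.mk _ (PsEquiv.id σ.toPseudofunctor)
  comp := Quotient.map₂ PsEquiv.comp
    (fun _ _ ⟨e⟩ _ _ ⟨e'⟩ => ⟨whiskerRightIso e _ ≪≫ whiskerLeftIso _ e'⟩)
  id_comp := by rintro _ _ ⟨η⟩; exact Quotient.sound ⟨λ_ η.1⟩
  comp_id := by rintro _ _ ⟨η⟩; exact Quotient.sound ⟨ρ_ η.1⟩
  assoc := by rintro _ _ _ _ ⟨η⟩ ⟨κ⟩ ⟨μ⟩; exact Quotient.sound ⟨α_ η.1 κ.1 μ.1⟩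

/-- The morphism of `Fun(A, B)` represented by a pseudonatural equivalence. -/
def PsEquiv.cls {σ τ : A ⥤ᵖ B} (η : PsEquiv σ τ) : FunCat.mk σ ⟶ FunCat.mk τ := Quotient.mk _ η

/-- The component at `[x]` of the natural transformation `biHH(σ) ⟶ biHH(τ)` induced by a
pseudonatural equivalence `η`: the conjugation morphism `[σ x] ⟶ [τ x]` of the naturality 2-cell
of `η`. -/
noncomputable def comp₀ {σ τ : A ⥤ᵖ B} (η : PsEquiv σ τ) (x : Cyc₀ A) :
    ob (σ.map x.F) ⟶ ob (τ.map x.F) :=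
  conj (η.2 x.X) (η.1.naturality x.F).hom

lemma comp₀_naturality {σ τ : A ⥤ᵖ B} (η : PsEquiv σ τ) {X : A} {F F' : X ⟶ X} (a : F ⟶ F') :
    ofCell (σ.map₂ a) ≫ comp₀ η ⟨F'⟩ = comp₀ η ⟨F⟩ ≫ ofCell (τ.map₂ a) :=
  conj_naturality _ _ (Iso.refl _) _ _ (by simp)

lemma conj_comp_cell {σ τ : A ⥤ᵖ B} (η : PsEquiv σ τ) {X Y : A} (F : X ⟶ Y) (G : Y ⟶ X) :
    ofCell (σ.mapComp F G).hom ≫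
      conj (η.2 X) (vpaste (η.1.naturality F).hom (η.1.naturality G).hom) =
    comp₀ η ⟨F ≫ G⟩ ≫ ofCell (τ.mapComp F G).hom :=
  conj_naturality _ _ (Iso.refl _) _ _ (by
    have h := η.1.naturality_comp F G
    simp only [vpaste, Iso.refl_hom, id_whiskerRight, whiskerLeft_id, Category.id_comp]
    exact h)

lemma comp₀_theta {σ τ : A ⥤ᵖ B} (η : PsEquiv σ τ) {X Y : A} (F : X ⟶ Y) (G : Y ⟶ X) :
    (ofCell (σ.mapComp F G).hom ≫ (theta (σ.map F) (σ.map G)).hom ≫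
        ofCell (σ.mapComp G F).inv) ≫ comp₀ η ⟨G ≫ F⟩ =
      comp₀ η ⟨F ≫ G⟩ ≫ ofCell (τ.mapComp F G).hom ≫ (theta (τ.map F) (τ.map G)).hom ≫
        ofCell (τ.mapComp G F).inv := by
  have h1 := conj_comp_cell η F G
  have h2 := conj_comp_cell η G F
  have h3 := conj_theta (η.2 X) (η.2 Y) (η.1.naturality F).hom (η.1.naturality G).hom
  have e : ∀ (υ : A ⥤ᵖ B), ofCell (υ.mapComp G F).inv ≫ ofCell (υ.mapComp G F).hom = 𝟙 _ :=
    fun υ => (ofIso (υ.mapComp G F)).inv_hom_id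
  have e' : ∀ (υ : A ⥤ᵖ B), ofCell (υ.mapComp G F).hom ≫ ofCell (υ.mapComp G F).inv = 𝟙 _ :=
    fun υ => (ofIso (υ.mapComp G F)).hom_inv_id
  have h4 : ofCell (σ.mapComp G F).inv ≫ comp₀ η ⟨G ≫ F⟩ =
      conj (η.2 Y) (vpaste (η.1.naturality G).hom (η.1.naturality F).hom) ≫
        ofCell (τ.mapComp G F).inv := by
    rw [← Category.comp_id (comp₀ η ⟨G ≫ F⟩), ← e', ← reassoc_of% h2, reassoc_of% e]
  rw [Category.assoc, Category.assoc, h4, ← reassoc_of% h3, reassoc_of% h1]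

/-- The natural transformation `biHH(σ) ⟶ biHH(τ)` induced by a pseudonatural equivalence. -/
noncomputable def natTrans {σ τ : A ⥤ᵖ B} (η : PsEquiv σ τ) : map σ ⟶ map τ :=
  natTransMk (D := cyc A) (F := map σ) (G := map τ) (fun x => comp₀ η x)
    (by rintro _ _ ⟨a⟩; exact comp₀_naturality η a)
    (fun x => (congrArg (· ≫ _) (map_theta σ x.F x.G)).trans
      ((comp₀_theta η x.F x.G).trans (congrArg (_ ≫ ·) (map_theta τ x.F x.G)).symm))

lemma natTrans_app {σ τ : A ⥤ᵖ B} (η : PsEquiv σ τ) {X : A} (F : X ⟶ X) :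
    (natTrans η).app (ob F) = conj (η.2 X) (η.1.naturality F).hom := rfl

lemma natTrans_congr {σ τ : A ⥤ᵖ B} {η η' : PsEquiv σ τ} (e : η.1 ≅ η'.1) :
    natTrans η = natTrans η' := by
  refine natTrans_ext (D := cyc A) (fun x => ?_)
  have h := conj_naturality (η.2 x.X) (η'.2 x.X) (a := (η.1.naturality x.F).hom)
    (a' := (η'.1.naturality x.F).hom)
    ⟨e.hom.as.app x.X, e.inv.as.app x.X,
      congrArg (fun m => m.as.app x.X) e.hom_inv_id,
      congrArg (fun m => m.as.app x.X) e.inv_hom_id⟩ (𝟙 _) (𝟙 _) (by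
      have h' := (e.hom.as.naturality x.F).symm
      simpa using h')
  simp only [ofCell_id, Category.id_comp, Category.comp_id] at h
  exact h.symm

lemma natTrans_id (σ : A ⥤ᵖ B) : natTrans (PsEquiv.id σ) = 𝟙 (map σ) :=
  natTrans_ext (D := cyc A) (fun x => conj_id (σ.map x.F))

lemma natTrans_comp {σ τ υ : A ⥤ᵖ B} (η : PsEquiv σ τ) (κ : PsEquiv τ υ) :
    natTrans (η.comp κ) = natTrans η ≫ natTrans κ := by
  refine natTrans_ext (D := cyc A) (fun x => ?_)
  have h : ((η.1 ≫ κ.1).naturality x.F).hom =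
      hcomp (η.1.naturality x.F).hom (κ.1.naturality x.F).hom :=
    Pseudofunctor.StrongTrans.categoryStruct_comp_naturality_hom η.1 κ.1 x.F
  exact (congrArg (conj ((η.2 x.X).comp (κ.2 x.X))) h).trans (conj_comp (η.2 x.X) (κ.2 x.X) _ _)

variable (A B) in
/-- The functor `biHH : Fun(A, B) ⥤ Fun(biHH(A), biHH(B))`. -/
noncomputable def functor : FunCat A B ⥤ (BiHH A ⥤ BiHH B) where
  obj σ := map σ.toPseudofunctor
  map {σ τ} := Quotient.lift (s := psSetoid σ.toPseudofunctor τ.toPseudofunctor) natTrans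
    (fun _ _ ⟨e⟩ => natTrans_congr e)
  map_id σ := natTrans_id σ.toPseudofunctor
  map_comp := by rintro _ _ _ ⟨η⟩ ⟨κ⟩; exact natTrans_comp η κ

end BiHH

/-! ### The walking adjunction -/

/-- The objects of the walking adjunction. -/
inductive WalkingAdj : Type
  | zero | one

namespace WalkingAdj

open Bicategory

/-- The generating 1-cells `f : 0 ⟶ 1` and `g : 1 ⟶ 0` of the walking adjunction. -/
inductive Gen : WalkingAdj → WalkingAdj → Type
  | f : Gen .zero .one
  | g : Gen .one .zero

/-- The 1-cells of the walking adjunction: composable strings of generating 1-cells. -/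
inductive Path : WalkingAdj → WalkingAdj → Type
  | nil (a : WalkingAdj) : Path a a
  | cons {a b c : WalkingAdj} (p : Path a b) (e : Gen b c) : Path a c

/-- Concatenation of 1-cells, in diagrammatic order. -/
def Path.comp {a b : WalkingAdj} (p : Path a b) : ∀ {c : WalkingAdj}, Path b c → Path a c
  | _, .nil _ => p
  | _, .cons q e => .cons (p.comp q) e

lemma Path.nil_comp {a b : WalkingAdj} (p : Path a b) : (Path.nil a).comp p = p := by
  induction p with
  | nil => rfl
  | cons p e ih => exact congrArg (Path.cons · e) ih

lemma Path.comp_nil {a b : WalkingAdj} (p : Path a b) : p.comp (.nil b) = p := rfl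

lemma Path.comp_assoc {a b c d : WalkingAdj} (p : Path a b) (q : Path b c) (r : Path c d) :
    (p.comp q).comp r = p.comp (q.comp r) := by
  induction r with
  | nil => rfl
  | cons r e ih => exact congrArg (Path.cons · e) ih

/-- The 1-cell `f`. -/
abbrev pathF : Path .zero .one := .cons (.nil _) .f

/-- The 1-cell `g`. -/
abbrev pathG : Path .one .zero := .cons (.nil _) .g

/-- Formal composites of the generating 2-cells `u : 1 ⟶ fg` and `c : gf ⟶ 1` (in diagrammatic
order) of the walking adjunction. -/
inductive Cell : ∀ {a b : WalkingAdj}, Path a b → Path a b → Type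
  | id {a b : WalkingAdj} (p : Path a b) : Cell p p
  | vcomp {a b : WalkingAdj} {p q r : Path a b} (x : Cell p q) (y : Cell q r) : Cell p r
  | whiskerLeft {a b c : WalkingAdj} (p : Path a b) {q r : Path b c} (x : Cell q r) :
      Cell (p.comp q) (p.comp r)
  | whiskerRight {a b c : WalkingAdj} {p q : Path a b} (x : Cell p q) (r : Path b c) :
      Cell (p.comp r) (q.comp r)
  | unit : Cell (.nil .zero) (pathF.comp pathG)
  | counit : Cell (pathG.comp pathF) (.nil .one)

/-- The identity 2-cell between equal 1-cells. -/
def Cell.ofEq {a b : WalkingAdj} {p q : Path a b} (h : p = q) : Cell p q := h ▸ Cell.id p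

open Cell in
/-- The defining relations of the 2-cells of the walking adjunction: the laws of a strict
2-category and the two triangle identities. -/
inductive Rel : ∀ {a b : WalkingAdj} {p q : Path a b}, Cell p q → Cell p q → Prop
  | refl {a b : WalkingAdj} {p q : Path a b} (x : Cell p q) : Rel x x
  | symm {a b : WalkingAdj} {p q : Path a b} {x y : Cell p q} : Rel x y → Rel y x
  | trans {a b : WalkingAdj} {p q : Path a b} {x y z : Cell p q} : Rel x y → Rel y z → Rel x z
  | vcomp_congr {a b : WalkingAdj} {p q r : Path a b} {x x' : Cell p q} {y y' : Cell q r} :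
      Rel x x' → Rel y y' → Rel (vcomp x y) (vcomp x' y')
  | whiskerLeft_congr {a b c : WalkingAdj} (p : Path a b) {q r : Path b c} {x x' : Cell q r} :
      Rel x x' → Rel (whiskerLeft p x) (whiskerLeft p x')
  | whiskerRight_congr {a b c : WalkingAdj} {p q : Path a b} {x x' : Cell p q} (r : Path b c) :
      Rel x x' → Rel (whiskerRight x r) (whiskerRight x' r)
  | id_vcomp {a b : WalkingAdj} {p q : Path a b} (x : Cell p q) : Rel (vcomp (id p) x) x
  | vcomp_id {a b : WalkingAdj} {p q : Path a b} (x : Cell p q) : Rel (vcomp x (id q)) x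
  | vcomp_assoc {a b : WalkingAdj} {p q r s : Path a b} (x : Cell p q) (y : Cell q r) (z : Cell r s) :
      Rel (vcomp (vcomp x y) z) (vcomp x (vcomp y z))
  | whiskerLeft_id {a b c : WalkingAdj} (p : Path a b) (q : Path b c) :
      Rel (whiskerLeft p (id q)) (id (p.comp q))
  | whiskerLeft_vcomp {a b c : WalkingAdj} (p : Path a b) {q r s : Path b c} (x : Cell q r)
      (y : Cell r s) :
      Rel (whiskerLeft p (vcomp x y)) (vcomp (whiskerLeft p x) (whiskerLeft p y))
  | id_whiskerRight {a b c : WalkingAdj} (p : Path a b) (q : Path b c) :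
      Rel (whiskerRight (id p) q) (id (p.comp q))
  | vcomp_whiskerRight {a b c : WalkingAdj} {p q r : Path a b} (x : Cell p q) (y : Cell q r)
      (s : Path b c) :
      Rel (whiskerRight (vcomp x y) s) (vcomp (whiskerRight x s) (whiskerRight y s))
  | nil_whiskerLeft {a b : WalkingAdj} {p q : Path a b} (x : Cell p q) :
      Rel (vcomp (whiskerLeft (.nil a) x) (ofEq q.nil_comp)) (vcomp (ofEq p.nil_comp) x)
  | comp_whiskerLeft {a b c d : WalkingAdj} (p : Path a b) (q : Path b c) {r s : Path c d}
      (x : Cell r s) :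
      Rel (vcomp (whiskerLeft (p.comp q) x) (ofEq (p.comp_assoc q s)))
        (vcomp (ofEq (p.comp_assoc q r)) (whiskerLeft p (whiskerLeft q x)))
  | whiskerRight_nil {a b : WalkingAdj} {p q : Path a b} (x : Cell p q) :
      Rel (whiskerRight x (.nil b)) x
  | whiskerRight_comp {a b c d : WalkingAdj} {p q : Path a b} (x : Cell p q) (r : Path b c)
      (s : Path c d) :
      Rel (vcomp (whiskerRight (whiskerRight x r) s) (ofEq (q.comp_assoc r s)))
        (vcomp (ofEq (p.comp_assoc r s)) (whiskerRight x (r.comp s)))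
  | whisker_assoc {a b c d : WalkingAdj} (p : Path a b) {q r : Path b c} (x : Cell q r) (s : Path c d) :
      Rel (vcomp (whiskerRight (whiskerLeft p x) s) (ofEq (p.comp_assoc r s)))
        (vcomp (ofEq (p.comp_assoc q s)) (whiskerLeft p (whiskerRight x s)))
  | whisker_exchange {a b c : WalkingAdj} {p q : Path a b} {r s : Path b c} (x : Cell p q)
      (y : Cell r s) :
      Rel (vcomp (whiskerLeft p y) (whiskerRight x s))
        (vcomp (whiskerRight x r) (whiskerLeft q y))
  | left_triangle :
      Rel (vcomp (whiskerRight unit pathF) (whiskerLeft pathF counit)) (id pathF)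
  | right_triangle :
      Rel (vcomp (whiskerLeft pathG unit) (whiskerRight counit pathG)) (id pathG)

/-- The setoid of formal composites of 2-cells up to the defining relations. -/
def cellSetoid {a b : WalkingAdj} (p q : Path a b) : Setoid (Cell p q) := ⟨Rel, Rel.refl, Rel.symm, Rel.trans⟩

instance (a b : WalkingAdj) : Category (Path a b) where
  Hom p q := _root_.Quotient (cellSetoid p q)
  id p := Quotient.mk _ (Cell.id p)
  comp := Quotient.map₂ Cell.vcomp (fun _ _ h _ _ h' => Rel.vcomp_congr h h')
  id_comp := by rintro _ _ ⟨x⟩; exact Quotient.sound (Rel.id_vcomp x)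
  comp_id := by rintro _ _ ⟨x⟩; exact Quotient.sound (Rel.vcomp_id x)
  assoc := by rintro _ _ _ _ ⟨x⟩ ⟨y⟩ ⟨z⟩; exact Quotient.sound (Rel.vcomp_assoc x y z)

/-- The 2-cell represented by a formal composite. -/
def Cell.cls {a b : WalkingAdj} {p q : Path a b} (x : Cell p q) : p ⟶ q := Quotient.mk (cellSetoid p q) x

/-- Left whiskering of 2-cells. -/
def wL {a b c : WalkingAdj} (p : Path a b) {q r : Path b c} : (q ⟶ r) → (p.comp q ⟶ p.comp r) :=
  Quotient.map (Cell.whiskerLeft p) (fun _ _ h => Rel.whiskerLeft_congr p h)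

/-- Right whiskering of 2-cells. -/
def wR {a b c : WalkingAdj} {p q : Path a b} (x : p ⟶ q) (r : Path b c) : p.comp r ⟶ q.comp r :=
  Quotient.map (fun x => Cell.whiskerRight x r) (fun _ _ h => Rel.whiskerRight_congr r h) x

lemma ofEq_cls {a b : WalkingAdj} {p q : Path a b} (h : p = q) : (Cell.ofEq h).cls = eqToHom h := by
  subst h; rfl

lemma wL_eqToHom {a b c : WalkingAdj} (p : Path a b) {q r : Path b c} (h : q = r) :
    wL p (eqToHom h) = eqToHom (congrArg p.comp h) := by
  subst h; exact Quotient.sound (Rel.whiskerLeft_id p q)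

lemma wR_eqToHom {a b c : WalkingAdj} {p q : Path a b} (h : p = q) (r : Path b c) :
    wR (eqToHom h) r = eqToHom (congrArg (fun t => t.comp r) h) := by
  subst h; exact Quotient.sound (Rel.id_whiskerRight p r)

lemma eq_of_comp_eqToHom {a b : WalkingAdj} {p q p' q' : Path a b} {x : p ⟶ q} {y : p' ⟶ q'}
    {h : p = p'} {h' : q = q'} (e : x ≫ eqToHom h' = eqToHom h ≫ y) :
    x = eqToHom h ≫ y ≫ eqToHom h'.symm := by
  subst h h'; simpa using e

instance : Bicategory WalkingAdj where
  Hom := Path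
  id := Path.nil
  comp p q := p.comp q
  whiskerLeft p _ _ x := wL p x
  whiskerRight x r := wR x r
  associator p q r := eqToIso (p.comp_assoc q r)
  leftUnitor p := eqToIso p.nil_comp
  rightUnitor p := eqToIso p.comp_nil
  whiskerLeft_id p q := Quotient.sound (Rel.whiskerLeft_id p q)
  whiskerLeft_comp := by
    rintro _ _ _ p _ _ _ ⟨x⟩ ⟨y⟩; exact Quotient.sound (Rel.whiskerLeft_vcomp p x y)
  id_whiskerLeft := by
    rintro _ _ p q ⟨x⟩
    have h : wL (.nil _) x.cls ≫ (Cell.ofEq q.nil_comp).cls = (Cell.ofEq p.nil_comp).cls ≫ x.cls :=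
      Quotient.sound (Rel.nil_whiskerLeft x)
    rw [ofEq_cls, ofEq_cls] at h
    exact eq_of_comp_eqToHom h
  comp_whiskerLeft := by
    rintro _ _ _ _ p q r s ⟨x⟩
    have h : wL (p.comp q) x.cls ≫ (Cell.ofEq (p.comp_assoc q s)).cls =
      (Cell.ofEq (p.comp_assoc q r)).cls ≫ wL p (wL q x.cls) :=
      Quotient.sound (Rel.comp_whiskerLeft p q x)
    rw [ofEq_cls, ofEq_cls] at h
    exact eq_of_comp_eqToHom h
  id_whiskerRight p q := Quotient.sound (Rel.id_whiskerRight p q)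
  comp_whiskerRight := by
    rintro _ _ _ _ _ _ ⟨x⟩ ⟨y⟩ s; exact Quotient.sound (Rel.vcomp_whiskerRight x y s)
  whiskerRight_id := by
    rintro _ _ p q ⟨x⟩
    have h : wR x.cls (.nil _) = x.cls := Quotient.sound (Rel.whiskerRight_nil x)
    exact eq_of_comp_eqToHom (h := p.comp_nil) (h' := q.comp_nil)
      ((Category.comp_id _).trans (h.trans (Category.id_comp _).symm))
  whiskerRight_comp := by
    rintro _ _ _ _ p q ⟨x⟩ r s
    have h : wR (wR x.cls r) s ≫ (Cell.ofEq (q.comp_assoc r s)).cls =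
      (Cell.ofEq (p.comp_assoc r s)).cls ≫ wR x.cls (r.comp s) :=
      Quotient.sound (Rel.whiskerRight_comp x r s)
    rw [ofEq_cls, ofEq_cls] at h
    refine eq_of_comp_eqToHom (h := (p.comp_assoc r s).symm) (h' := (q.comp_assoc r s).symm) ?_
    have h' : wR (wR x.cls r) s = eqToHom (p.comp_assoc r s) ≫ wR x.cls (r.comp s) ≫
      eqToHom (q.comp_assoc r s).symm := eq_of_comp_eqToHom h
    change wR x.cls (r.comp s) ≫ _ = _ ≫ wR (wR x.cls r) s
    rw [h']
    simp
  whisker_assoc := by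
    rintro _ _ _ _ p q r ⟨x⟩ s
    have h : wR (wL p x.cls) s ≫ (Cell.ofEq (p.comp_assoc r s)).cls =
      (Cell.ofEq (p.comp_assoc q s)).cls ≫ wL p (wR x.cls s) :=
      Quotient.sound (Rel.whisker_assoc p x s)
    rw [ofEq_cls, ofEq_cls] at h
    exact eq_of_comp_eqToHom h
  whisker_exchange := by
    rintro _ _ _ p q r s ⟨x⟩ ⟨y⟩; exact Quotient.sound (Rel.whisker_exchange x y)
  pentagon p q r s := by
    have h : wR (eqToHom (p.comp_assoc q r)) s ≫ eqToHom (p.comp_assoc (q.comp r) s) ≫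
        wL p (eqToHom (q.comp_assoc r s)) =
        eqToHom ((p.comp q).comp_assoc r s) ≫ eqToHom (p.comp_assoc q (r.comp s)) := by
      rw [wR_eqToHom, wL_eqToHom]
      simp only [eqToHom_trans]
    exact h
  triangle p q := by
    have h : eqToHom (p.comp_assoc (.nil _) q) ≫ wL p (eqToHom q.nil_comp) =
        wR (eqToHom p.comp_nil) q := by
      rw [wR_eqToHom, wL_eqToHom]
      simp only [eqToHom_trans]
    exact h

/-- The walking adjunction is a strict bicategory. -/
instance : Bicategory.Strict WalkingAdj where
  id_comp p := p.nil_comp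
  comp_id p := p.comp_nil
  assoc p q r := p.comp_assoc q r
  leftUnitor_eqToIso _ := rfl
  rightUnitor_eqToIso _ := rfl
  associator_eqToIso _ _ _ := rfl

/-- The 1-cell `f : 0 ⟶ 1` of the walking adjunction. -/
def f : WalkingAdj.zero ⟶ WalkingAdj.one := pathF

/-- The 1-cell `g : 1 ⟶ 0` of the walking adjunction. -/
def g : WalkingAdj.one ⟶ WalkingAdj.zero := pathG

/-- The unit `u` of the walking adjunction. -/
def u : 𝟙 WalkingAdj.zero ⟶ f ≫ g := Cell.unit.cls

/-- The counit `c` of the walking adjunction. -/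
def c : g ≫ f ⟶ 𝟙 WalkingAdj.one := Cell.counit.cls

/-- The universal adjunction `f ⊣ g`. -/
def adjunction : f ⊣ g where
  unit := u
  counit := c
  left_triangle := by
    have h : wR Cell.unit.cls pathF ≫ wL pathF Cell.counit.cls = 𝟙 pathF :=
      Quotient.sound Rel.left_triangle
    have h₁ : leftZigzag u c = u ▷ f ≫ (α_ f g f).hom ≫ f ◁ c := by bicategory
    have h₂ : u ▷ f ≫ (α_ f g f).hom ≫ f ◁ c = (λ_ f).hom ≫ (ρ_ f).inv :=
      (congrArg (u ▷ f ≫ ·) (Category.id_comp (f ◁ c))).trans (h.trans (Category.comp_id _).symm)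
    exact h₁.trans h₂
  right_triangle := by
    have h : wL pathG Cell.unit.cls ≫ wR Cell.counit.cls pathG = 𝟙 pathG :=
      Quotient.sound Rel.right_triangle
    have h₁ : rightZigzag u c = g ◁ u ≫ (α_ g f g).inv ≫ c ▷ g := by bicategory
    have h₂ : g ◁ u ≫ (α_ g f g).inv ≫ c ▷ g = (ρ_ g).hom ≫ (λ_ g).inv :=
      (congrArg (g ◁ u ≫ ·) (Category.id_comp (c ▷ g))).trans (h.trans (Category.comp_id _).symm)
    exact h₁.trans h₂

end WalkingAdj

/-! ### The paracyclic category -/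

/-- The objects `[n]`, for `n ∈ ℕ`, of the paracyclic category. -/
structure Paracyclic where
  deg : ℕ

namespace Paracyclic

/-- The morphisms `[n] ⟶ [m]` of the paracyclic category: the weakly monotone maps `f : ℤ → ℤ`
such that `f (l + n + 1) = f l + m + 1` for all `l`. -/
@[ext]
structure Hom (n m : Paracyclic) where
  toFun : ℤ → ℤ
  monotone : Monotone toFun
  shift : ∀ l : ℤ, toFun (l + (n.deg + 1)) = toFun l + (m.deg + 1)

/-- The paracyclic category `Λ_∞`, in which composition is the composition of maps. -/
instance : Category Paracyclic where
  Hom := Hom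
  id n := ⟨fun l => l, monotone_id, fun _ => rfl⟩
  comp f g := ⟨fun l => g.toFun (f.toFun l), g.monotone.comp f.monotone, fun l => by
    rw [f.shift, g.shift]⟩

end Paracyclic

namespace BiHH

open Bicategory Diagram

/-! ### The Euler characteristic -/

section

variable {B : Type u} [Bicategory.{w, v} B]

/-- The Euler characteristic `[1] ⟶ [FG] ≅ [GF] ⟶ [1]` of an adjunction `F ⊣ G`, in diagrammatic
order, as a morphism of `biHH(B)`. -/
def eulerChar {X Y : B} {F : X ⟶ Y} {G : Y ⟶ X} (adj : F ⊣ G) : ob (𝟙 X) ⟶ ob (𝟙 Y) :=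
  ofCell adj.unit ≫ (theta F G).hom ≫ ofCell adj.counit

/-- The morphism `[1_X] ⟶ [1_Y]` of `biHH(B)` induced by an equivalence `P : X ⟶ Y`, that is,
`[1_X] ≅ [P ≫ K] ≅ [K ≫ P] ≅ [1_Y]` where `K` is an inverse of `P`. -/
noncomputable def unitConj {X Y : B} {P : X ⟶ Y} (hP : IsEquiv₁ P) : ob (𝟙 X) ⟶ ob (𝟙 Y) :=
  conj hP ((λ_ P).hom ≫ (ρ_ P).inv)

end

section

open scoped Pseudofunctor.StrongTrans

variable {A : Type u} [Bicategory.{w, v} A] {B : Type u'} [Bicategory.{w', v'} B]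

/-- The image in `biHH(B)` of the unit isomorphism `σ(1) ≅ 1` of a pseudofunctor. -/
def unitIso (σ : A ⥤ᵖ B) (X : A) : ob (σ.map (𝟙 X)) ≅ ob (𝟙 (σ.obj X)) := ofIso (σ.mapId X)

lemma unitConj_eq {σ τ : A ⥤ᵖ B} (η : PsEquiv σ τ) (X : A) :
    unitConj (η.2 X) = (unitIso σ X).inv ≫ comp₀ η ⟨𝟙 X⟩ ≫ (unitIso τ X).hom := by
  rw [Iso.eq_inv_comp]
  exact conj_naturality (η.2 X) (η.2 X) (Iso.refl _) _ _ (by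
    have h := η.1.naturality_id X
    simp only [Iso.refl_hom, id_whiskerRight, whiskerLeft_id, Category.id_comp]
    exact h)

lemma map_eulerChar (σ : A ⥤ᵖ B) {X Y : A} {F : X ⟶ Y} {G : Y ⟶ X} (adj : F ⊣ G) :
    (map σ).map (eulerChar adj) =
      (unitIso σ X).hom ≫ eulerChar (σ.mapAdjunction adj) ≫ (unitIso σ Y).inv := by
  have h : (map σ).map (eulerChar adj) = ofCell (σ.map₂ adj.unit) ≫
      (ofCell (σ.mapComp F G).hom ≫ (theta (σ.map F) (σ.map G)).hom ≫
        ofCell (σ.mapComp G F).inv) ≫ ofCell (σ.map₂ adj.counit) := by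
    refine ((map σ).map_comp _ _).trans ?_
    refine (congrArg (_ ≫ ·) ((map σ).map_comp _ _)).trans ?_
    rw [map_theta]
    rfl
  have e : ∀ X, ofCell (σ.mapId X).hom ≫ ofCell (σ.mapId X).inv = 𝟙 _ :=
    fun X => (ofIso (σ.mapId X)).hom_inv_id
  rw [h]
  simp only [eulerChar, Pseudofunctor.mapAdjunction_unit, Pseudofunctor.mapAdjunction_counit,
    ofCell_comp, unitIso, ofIso_hom, ofIso_inv, Category.assoc]
  rw [reassoc_of% (e X), e Y, Category.comp_id]

lemma eulerChar_unitConj {σ τ : A ⥤ᵖ B} (η : PsEquiv σ τ) {X Y : A} {F : X ⟶ Y} {G : Y ⟶ X}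
    (adj : F ⊣ G) :
    unitConj (η.2 X) ≫ eulerChar (τ.mapAdjunction adj) =
      eulerChar (σ.mapAdjunction adj) ≫ unitConj (η.2 Y) := by
  have h : (map σ).map (eulerChar adj) ≫ comp₀ η ⟨𝟙 Y⟩ =
      comp₀ η ⟨𝟙 X⟩ ≫ (map τ).map (eulerChar adj) := (natTrans η).naturality (eulerChar adj)
  rw [map_eulerChar, map_eulerChar] at h
  have h' : (unitIso σ X).hom ≫ (eulerChar (σ.mapAdjunction adj) ≫ (unitIso σ Y).inv ≫
      comp₀ η ⟨𝟙 Y⟩) = comp₀ η ⟨𝟙 X⟩ ≫ (unitIso τ X).hom ≫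
        eulerChar (τ.mapAdjunction adj) ≫ (unitIso τ Y).inv := by
    refine Eq.trans (b := ((unitIso σ X).hom ≫ eulerChar (σ.mapAdjunction adj) ≫
      (unitIso σ Y).inv) ≫ comp₀ η ⟨𝟙 Y⟩) ?_ h
    simp only [Category.assoc]
  rw [unitConj_eq, unitConj_eq, Category.assoc, Category.assoc, Iso.inv_comp_eq,
    reassoc_of% h', Iso.inv_hom_id, Category.comp_id]

end

variable (B : Type u) [Bicategory.{w, v} B]

/-- The category `Adj(B) = Fun(Adj, B)` of adjunctions in a bicategory `B`. -/
abbrev AdjCat : Type _ := FunCat WalkingAdj B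

variable {B} in
/-- The adjunction in `B` classified by an object of `Adj(B)`. -/
def AdjCat.adj (σ : AdjCat B) :
    σ.toPseudofunctor.map WalkingAdj.f ⊣ σ.toPseudofunctor.map WalkingAdj.g :=
  σ.toPseudofunctor.mapAdjunction WalkingAdj.adjunction

/-- The functor `χ̂ : Adj(B) ⥤ Arr(biHH(B))`, which sends an adjunction to its Euler
characteristic, and which sends an equivalence of adjunctions to the isomorphisms of the units that
it induces. -/
noncomputable def chiHat : AdjCat B ⥤ Arrow (BiHH B) where
  obj σ := Arrow.mk (eulerChar σ.adj)
  map {σ τ} := Quotient.lift (s := psSetoid σ.toPseudofunctor τ.toPseudofunctor)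
    (fun η => Arrow.homMk (unitConj (η.2 .zero)) (unitConj (η.2 .one)) (eulerChar_unitConj η _))
    (fun η η' ⟨e⟩ => by
      have h := natTrans_congr e
      have h' : ∀ X, comp₀ η ⟨𝟙 X⟩ = comp₀ η' ⟨𝟙 X⟩ := fun X =>
        congrArg (fun t => t.app (ob (𝟙 X))) h
      ext
      · change unitConj (η.2 .zero) = unitConj (η'.2 .zero)
        rw [unitConj_eq, unitConj_eq, h']
      · change unitConj (η.2 .one) = unitConj (η'.2 .one)
        rw [unitConj_eq, unitConj_eq, h'])
  map_id σ := by
    have h' : ∀ X, comp₀ (PsEquiv.id σ.toPseudofunctor) ⟨𝟙 X⟩ = 𝟙 _ := fun X =>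
      congrArg (fun t => t.app (ob (𝟙 X))) (natTrans_id σ.toPseudofunctor)
    have h (X) : unitConj ((PsEquiv.id σ.toPseudofunctor).2 X) = 𝟙 _ := by
      rw [unitConj_eq, h', Category.id_comp, Iso.inv_hom_id]
    ext
    · exact h .zero
    · exact h .one
  map_comp := by
    rintro σ τ υ ⟨η⟩ ⟨κ⟩
    have h' : ∀ X, comp₀ (η.comp κ) ⟨𝟙 X⟩ = comp₀ η ⟨𝟙 X⟩ ≫ comp₀ κ ⟨𝟙 X⟩ := fun X =>
      congrArg (fun t => t.app (ob (𝟙 X))) (natTrans_comp η κ)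
    have h (X) : unitConj ((η.comp κ).2 X) = unitConj (η.2 X) ≫ unitConj (κ.2 X) := by
      rw [unitConj_eq, unitConj_eq, unitConj_eq, h']
      simp
    ext
    · exact h .zero
    · exact h .one

/-- Restriction of functors on a category along a morphism `m`, regarded as a functor from the
walking arrow. -/
@[simps]
def restrict {C : Type u₁} [Category.{v₁} C] {D : Type u₂} [Category.{v₂} D] {x y : C}
    (m : x ⟶ y) : (C ⥤ D) ⥤ Arrow D where
  obj F := Arrow.mk (F.map m)
  map t := Arrow.homMk (t.app x) (t.app y) (t.naturality m).symm

end BiHH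

namespace BiHH

open Bicategory Diagram

/-! ### The universal property of `biHH` in terms of traces -/

/-! Everything reduces to the walking adjunction. A pseudofunctor sends the Euler characteristic of
the universal adjunction to that of the classified adjunction, up to unit constraints
(`map_eulerChar`). If the identity of 0 is initial in `biHH` of the walking adjunction, and the
identity of 1 terminal, then this universal Euler characteristic is the only morphism between them,
and no choice can enter.

Functors out of `biHH(B)` are given by traces: a functor on endo-1-cells, with cyclicity
isomorphisms subject to naturality, a hexagon and a unit law (`Trace.desc`). The tautological trace
shows that 2-cells and cyclicity isomorphisms generate all morphisms between endo-1-cells (`gen`).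
Composites below are in diagrammatic order.

For initiality and terminality, the endo-1-cells of 0 form the augmented simplex category, with the
identity initial and the monad `f ≫ g` terminal, and the identity of 1 is terminal among the
endo-1-cells of 1. To reach the identity of 1 from an endo-1-cell `p` of 0, insert a unit, rotate
the new `f` to the end, and contract `g ≫ p ≫ f` by counits. The triangle identities make this
compatible with cyclicity, up to the full rotation `twist`. That is natural and trivial on
identities, hence absorbed. The initial object is treated in the same way.

For the equivalence, a 2-cell is read as a monotone map between the regions labelled 1 in its source
and target strings, numbered by the occurrences of `f` to their left. When an endo-1-cell is closed
up to a circle this becomes a periodic monotone map of the integers, and the cyclicity isomorphism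
moving `G` to the front is the shift by the number of `f` in `G`. This is a trace with values in the
extended paracyclic category, which gives `toParacyclic`.

Full faithfulness rests on a standard form. Every morphism from a nontrivial power of `f ≫ g` to an
endo-1-cell of 0 is a power of the rotation followed by a 2-cell (`standard`), because a 2-cell
splits along any decomposition of its codomain (`splits`), so that a later rotation can be moved to
the front. A periodic monotone map factors uniquely in the same way: the rotation is read off where
the map becomes nonnegative, and the 2-cell from one period, by `cell_ext` and `exists_cell`. The
identities and the powers of `f ≫ g` represent all objects. -/

/-- A trace on a bicategory with values in a category: a functor on the endo-1-cells together with
cyclicity isomorphisms. -/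
structure Trace (B : Type u) [Bicategory.{w, v} B] (E : Type u') [Category.{v'} E] where
  obj : ∀ {X : B}, (X ⟶ X) → E
  map : ∀ {X : B} {F F' : X ⟶ X}, (F ⟶ F') → (obj F ⟶ obj F')
  map_id : ∀ {X : B} (F : X ⟶ X), map (𝟙 F) = 𝟙 _
  map_comp : ∀ {X : B} {F F' F'' : X ⟶ X} (a : F ⟶ F') (b : F' ⟶ F''),
    map (a ≫ b) = map a ≫ map b
  tr : ∀ {X Y : B} (F : X ⟶ Y) (G : Y ⟶ X), obj (F ≫ G) ≅ obj (G ≫ F)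
  tr_nat : ∀ {X Y : B} {F F' : X ⟶ Y} {G G' : Y ⟶ X} (a : F ⟶ F') (b : G ⟶ G'),
    map (a ▷ G ≫ F' ◁ b) ≫ (tr F' G').hom = (tr F G).hom ≫ map (b ▷ F ≫ G' ◁ a)
  tr_hexagon : ∀ {X Y Z : B} (F : X ⟶ Y) (G : Y ⟶ Z) (H : Z ⟶ X),
    (tr F (G ≫ H)).hom = map (α_ F G H).inv ≫ (tr (F ≫ G) H).hom ≫ map (α_ H F G).inv ≫
      (tr (H ≫ F) G).hom ≫ map (α_ G H F).inv
  tr_unit : ∀ {X : B} (F : X ⟶ X), (tr F (𝟙 X)).hom = map (ρ_ F).hom ≫ map (λ_ F).inv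

namespace Trace

variable {B : Type u} [Bicategory.{w, v} B] {E : Type u'} [Category.{v'} E] (T : Trace B E)

/-- The image of a 2-isomorphism under a trace. -/
@[simps]
def mapIso {X : B} {F F' : X ⟶ X} (a : F ≅ F') : T.obj F ≅ T.obj F' where
  hom := T.map a.hom
  inv := T.map a.inv
  hom_inv_id := by rw [← T.map_comp, a.hom_inv_id, T.map_id]
  inv_hom_id := by rw [← T.map_comp, a.inv_hom_id, T.map_id]

/-- The functor on `∐ B(X, X)` given by a trace. -/
@[simps obj]
def leg₀ : Cyc₀ B ⥤ E where
  obj x := T.obj x.F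
  map
    | .mk a => T.map a
  map_id x := T.map_id x.F
  map_comp := by
    rintro _ _ _ ⟨a⟩ ⟨a'⟩
    exact T.map_comp a a'

/-- The legs of the pseudo-cocone given by a trace. -/
def leg : ∀ n, (cyc B).obj n ⥤ E
  | .zero => T.leg₀
  -- The upper legs are pulled back along `d₀` and along `e₀` followed by `d₀`. The comparisons for
  -- `d₀` and `e₀` are then identities, and the remaining data is that of a trace.
  | .one => faceD₀ (B := B) ⋙ T.leg₀
  | .two => faceE₀ (B := B) ⋙ faceD₀ ⋙ T.leg₀

lemma map_nat {X : B} {F F' : X ⟶ X} {G G' : X ⟶ X} {a : F ⟶ F'} {b : G ⟶ G'} (e : F ≅ G)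
    (e' : F' ≅ G') (h : a ≫ e'.hom = e.hom ≫ b) :
    T.map a ≫ (T.mapIso e').hom = (T.mapIso e).hom ≫ T.map b := by
  simp [← T.map_comp, h]

lemma rightUnitor_inv_nat {X Y : B} {F F' : X ⟶ Y} (a : F ⟶ F') :
    a ≫ (ρ_ F').inv = (ρ_ F).inv ≫ (a ▷ 𝟙 Y ≫ F' ◁ 𝟙 (𝟙 Y)) := by
  simp

lemma rightUnitor_inv_whiskerRight_nat {X Y Z : B} {F F' : X ⟶ Y} {G G' : Y ⟶ Z} (a : F ⟶ F')
    (b : G ⟶ G') : (a ▷ G ≫ F' ◁ b) ≫ (ρ_ F').inv ▷ G' =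
      (ρ_ F).inv ▷ G ≫ (a ▷ 𝟙 Y ≫ F' ◁ 𝟙 (𝟙 Y)) ▷ G ≫ (F' ≫ 𝟙 Y) ◁ b := by
  have h := rightUnitor_inv_nat a
  rw [Category.assoc, whisker_exchange, ← comp_whiskerRight_assoc, h]
  simp

/-- The comparison isomorphisms of the pseudo-cocone given by a trace. -/
def legIso : ∀ {m n : Lvl} (o : Str m n), T.leg m ≅ (cyc B).map o ⋙ T.leg n
  | _, _, .d₀ => Iso.refl (faceD₀ (B := B) ⋙ T.leg₀)
  | _, _, .d₁ => (NatIso.ofComponents (fun x : Cyc₁ B => T.tr x.F x.G) (by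
      rintro _ _ ⟨a, b⟩
      exact T.tr_nat a b) : faceD₀ (B := B) ⋙ T.leg₀ ≅ faceD₁ ⋙ T.leg₀)
  | _, _, .e₀ => Iso.refl (faceE₀ (B := B) ⋙ faceD₀ ⋙ T.leg₀)
  | _, _, .e₁ => (NatIso.ofComponents (fun x : Cyc₂ B => T.mapIso (α_ x.F x.G x.H)) (by
      rintro _ _ ⟨a, b, c⟩
      exact T.map_nat (α_ _ _ _) (α_ _ _ _) (assoc_hom_nat a b c)) :
        faceE₀ (B := B) ⋙ faceD₀ ⋙ T.leg₀ ≅ faceE₁ ⋙ faceD₀ ⋙ T.leg₀)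
  -- Forced by `dd₀₂`: `e₂` then `d₀` must agree, up to an associator, with `e₀` then `d₁`, and the
  -- comparison for `d₁` is the cyclicity isomorphism.
  | _, _, .e₂ => (NatIso.ofComponents
      (fun x : Cyc₂ B => T.tr (x.F ≫ x.G) x.H ≪≫ T.mapIso (α_ x.H x.F x.G).symm) (by
      rintro _ _ ⟨a, b, c⟩
      refine (Category.assoc _ _ _).symm.trans ?_
      refine (congrArg (· ≫ _) (T.tr_nat (a ▷ _ ≫ _ ◁ b) c)).trans ?_
      refine (Category.assoc _ _ _).trans (Eq.trans ?_ (Category.assoc _ _ _).symm)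
      refine congrArg (_ ≫ ·) ?_
      exact T.map_nat (α_ _ _ _).symm (α_ _ _ _).symm (assoc_inv_nat c a b)) :
        faceE₀ (B := B) ⋙ faceD₀ ⋙ T.leg₀ ≅ faceE₂ ⋙ faceD₀ ⋙ T.leg₀)
  | _, _, .s₀ => (NatIso.ofComponents (fun x : Cyc₀ B => T.mapIso (ρ_ x.F).symm) (by
      rintro _ _ ⟨a⟩
      exact T.map_nat (ρ_ _).symm (ρ_ _).symm (rightUnitor_inv_nat a)) : T.leg₀ ≅ degenS₀ (B := B) ⋙ faceD₀ ⋙ T.leg₀)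
  | _, _, .t₀ => (NatIso.ofComponents
      (fun x : Cyc₁ B => T.mapIso (whiskerRightIso (ρ_ x.F).symm x.G)) (by
      rintro _ _ ⟨a, b⟩
      exact T.map_nat (whiskerRightIso (ρ_ _).symm _) (whiskerRightIso (ρ_ _).symm _)
        (rightUnitor_inv_whiskerRight_nat a b)) :
        faceD₀ (B := B) ⋙ T.leg₀ ≅ degenT₀ (B := B) ⋙ faceE₀ ⋙ faceD₀ ⋙ T.leg₀)
  | _, _, .t₁ => (NatIso.ofComponents (fun x : Cyc₁ B => T.mapIso (ρ_ (x.F ≫ x.G)).symm) (by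
      rintro _ _ ⟨a, b⟩
      exact T.map_nat (ρ_ _).symm (ρ_ _).symm
        (rightUnitor_inv_nat (a ▷ _ ≫ _ ◁ b))) : faceD₀ (B := B) ⋙ T.leg₀ ≅ degenT₁ (B := B) ⋙ faceE₀ ⋙ faceD₀ ⋙ T.leg₀)

/-- The pseudo-cocone given by a trace. -/
def cocone : (cyc B).Cocone E where
  leg := T.leg
  iso := T.legIso
  sq r x := by
    cases r with
    | dd₀₁ =>
      obtain ⟨F, G, H⟩ := x
      change T.map (α_ F G H).hom ≫ 𝟙 _ ≫ T.map (α_ F G H).inv = 𝟙 _ ≫ 𝟙 _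
      simp [← T.map_comp, T.map_id]
    | dd₀₂ =>
      obtain ⟨F, G, H⟩ := x
      change ((T.tr (F ≫ G) H).hom ≫ T.map (α_ H F G).inv) ≫ 𝟙 _ ≫ T.map (α_ H F G).hom =
        𝟙 _ ≫ (T.tr (F ≫ G) H).hom
      simp [← T.map_comp, T.map_id]
    -- This identity is the hexagon axiom; the two before it hold by the choice of the comparisons
    -- for `e₁` and `e₂`.
    | dd₁₂ =>
      obtain ⟨F, G, H⟩ := x
      change ((T.tr (F ≫ G) H).hom ≫ T.map (α_ H F G).inv) ≫ (T.tr (H ≫ F) G).hom ≫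
        T.map (α_ G H F).inv = T.map (α_ F G H).hom ≫ (T.tr F (G ≫ H)).hom
      rw [T.tr_hexagon, ← reassoc_of% T.map_comp, Iso.hom_inv_id, T.map_id]
      simp
    | ss =>
      obtain ⟨F⟩ := x
      change T.map (ρ_ F).inv ≫ T.map ((ρ_ F).inv ▷ 𝟙 _) ≫
        T.map ((𝟙 F ▷ 𝟙 _ ≫ F ◁ 𝟙 (𝟙 _)) ▷ 𝟙 _ ≫ (F ≫ 𝟙 _) ◁ 𝟙 (𝟙 _)) = T.map (ρ_ F).inv ≫ T.map (ρ_ (F ≫ 𝟙 _)).inv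
      simp [← T.map_comp]
    | ds₀₁ =>
      obtain ⟨F, G⟩ := x
      change T.map (ρ_ (F ≫ G)).inv ≫ 𝟙 _ ≫
        T.map (𝟙 (F ≫ G) ▷ 𝟙 _ ≫ (F ≫ G) ◁ 𝟙 (𝟙 _)) = 𝟙 _ ≫ T.map (ρ_ (F ≫ G)).inv
      simp [T.map_id]
    | ds₂₀ =>
      obtain ⟨F, G⟩ := x
      change T.map ((ρ_ F).inv ▷ G) ≫ ((T.tr (F ≫ 𝟙 _) G).hom ≫ T.map (α_ G F (𝟙 _)).inv) ≫
        T.map (𝟙 (G ≫ F) ▷ 𝟙 _ ≫ (G ≫ F) ◁ 𝟙 (𝟙 _)) = (T.tr F G).hom ≫ T.map (ρ_ (G ≫ F)).inv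
      have h := T.tr_nat (ρ_ F).inv (𝟙 G)
      simp only [whiskerLeft_id, Category.comp_id, id_whiskerRight, Category.id_comp] at h
      simp [reassoc_of% h, ← T.map_comp]
  tri r x := by
    cases r with
    | s₀d₀ =>
      obtain ⟨F⟩ := x
      change T.map (ρ_ F).inv ≫ 𝟙 _ ≫ T.map (ρ_ F).hom = 𝟙 _
      simp [← T.map_comp, T.map_id]
    | s₀d₁ =>
      obtain ⟨F⟩ := x
      change T.map (ρ_ F).inv ≫ (T.tr F (𝟙 _)).hom ≫ T.map (λ_ F).hom = 𝟙 _
      simp [T.tr_unit, ← T.map_comp, T.map_id]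
    | t₀e₀ =>
      obtain ⟨F, G⟩ := x
      change T.map ((ρ_ F).inv ▷ G) ≫ 𝟙 _ ≫ T.map ((ρ_ F).hom ▷ G ≫ F ◁ 𝟙 G) = 𝟙 _
      simp [← T.map_comp, T.map_id]
    | t₀e₁ =>
      obtain ⟨F, G⟩ := x
      change T.map ((ρ_ F).inv ▷ G) ≫ T.map (α_ F (𝟙 _) G).hom ≫
        T.map (𝟙 F ▷ _ ≫ F ◁ (λ_ G).hom) = 𝟙 _
      simp [← T.map_comp, T.map_id]
    | t₁e₁ =>
      obtain ⟨F, G⟩ := x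
      change T.map (ρ_ (F ≫ G)).inv ≫ T.map (α_ F G (𝟙 _)).hom ≫
        T.map (𝟙 F ▷ _ ≫ F ◁ (ρ_ G).hom) = 𝟙 _
      simp [← T.map_comp, T.map_id]
    | t₁e₂ =>
      obtain ⟨F, G⟩ := x
      change T.map (ρ_ (F ≫ G)).inv ≫ ((T.tr (F ≫ G) (𝟙 _)).hom ≫ T.map (α_ (𝟙 _) F G).inv) ≫
        T.map ((λ_ F).hom ▷ G ≫ F ◁ 𝟙 G) = 𝟙 _
      simp [T.tr_unit, ← T.map_comp, T.map_id]

/-- The functor on `biHH(B)` given by a trace. -/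
def desc : BiHH B ⥤ E := T.cocone.desc

lemma desc_theta {X Y : B} (F : X ⟶ Y) (G : Y ⟶ X) :
    T.desc.map (theta F G).hom = (T.tr F G).hom := by
  refine (T.desc.map_comp _ _).trans ?_
  exact Category.id_comp _

end Trace

/-! ### Generation of `biHH` by 2-cells and cyclicity isomorphisms -/

variable {B : Type u} [Bicategory.{w, v} B]

/-- The morphisms of `biHH(B)` generated by the 2-cells and the cyclicity isomorphisms. -/
inductive Gen : ∀ {x y : Cyc₀ B}, (ob x.F ⟶ ob y.F) → Prop
  | cell {X : B} {F F' : X ⟶ X} (a : F ⟶ F') : Gen (x := ⟨F⟩) (y := ⟨F'⟩) (ofCell a)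
  | theta {X Y : B} (F : X ⟶ Y) (G : Y ⟶ X) :
      Gen (x := ⟨F ≫ G⟩) (y := ⟨G ≫ F⟩) (theta F G).hom
  | theta_inv {X Y : B} (F : X ⟶ Y) (G : Y ⟶ X) :
      Gen (x := ⟨G ≫ F⟩) (y := ⟨F ≫ G⟩) (BiHH.theta F G).inv
  | comp {x y z : Cyc₀ B} (f : ob x.F ⟶ ob y.F) (g : ob y.F ⟶ ob z.F) :
      Gen f → Gen g → Gen (f ≫ g)

variable (B) in
/-- The category of endo-1-cells whose morphisms are the morphisms of `biHH(B)` generated by 2-cells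
and cyclicity isomorphisms. -/
structure GenCat where
  x : Cyc₀ B

instance : Category (GenCat B) where
  Hom a b := { f : ob a.x.F ⟶ ob b.x.F // Gen f }
  id a := ⟨𝟙 _, by rw [← ofCell_id]; exact Gen.cell _⟩
  comp f g := ⟨f.1 ≫ g.1, Gen.comp _ _ f.2 g.2⟩

variable (B) in
/-- The tautological trace with values in the generated category. -/
def genTrace : Trace B (GenCat B) where
  obj F := ⟨⟨F⟩⟩
  map a := ⟨ofCell a, Gen.cell a⟩
  map_id F := Subtype.ext (ofCell_id F)
  map_comp a b := Subtype.ext (ofCell_comp a b)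
  tr F G :=
    { hom := ⟨(theta F G).hom, Gen.theta F G⟩
      inv := ⟨(theta F G).inv, Gen.theta_inv F G⟩
      hom_inv_id := Subtype.ext (theta F G).hom_inv_id
      inv_hom_id := Subtype.ext (theta F G).inv_hom_id }
  tr_nat a b := Subtype.ext (theta_naturality a b)
  tr_hexagon F G H := Subtype.ext (theta_hexagon F G H)
  tr_unit F := Subtype.ext (theta_unit F)

variable (B) in
/-- The inclusion of the generated category. -/
def genIncl : GenCat B ⥤ BiHH B where
  obj a := ob a.x.F
  map f := f.1

/-- Every morphism of `biHH(B)` between endo-1-cells is generated by 2-cells and cyclicity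
isomorphisms. -/
lemma gen {x y : Cyc₀ B} (f : ob x.F ⟶ ob y.F) : Gen f := by
  -- The endofunctor of `biHH(B)` that factors through the generated category is compared with the
  -- identity functor. The components on endo-1-cells are identities, so naturality exhibits `f` as
  -- a generated morphism.
  let t : (genTrace B).desc ⋙ genIncl B ⟶ 𝟭 (BiHH B) :=
    natTransMk (D := cyc B) (F := (genTrace B).desc ⋙ genIncl B) (G := 𝟭 (BiHH B))
      (fun x => 𝟙 (ob x.F))
      (by
        rintro _ _ ⟨a⟩
        exact (Category.comp_id _).trans (Category.id_comp _).symm)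
      (fun x => by
        refine (Category.comp_id _).trans (Eq.trans ?_ (Category.id_comp _).symm)
        exact congrArg (genIncl B).map ((genTrace B).desc_theta x.F x.G))
  have h := t.naturality f
  have h' : ((genTrace B).desc.map f).1 = f :=
    (Category.comp_id _).symm.trans (h.trans (Category.id_comp _))
  rw [← h']
  exact ((genTrace B).desc.map f).2

/-- A natural transformation between functors on `biHH(B)`, from a family of morphisms on
endo-1-cells. -/
def natTransOf {E : Type u'} [Category.{v'} E] {F G : BiHH B ⥤ E}
    (b : ∀ {X : B} (x : X ⟶ X), F.obj (ob x) ⟶ G.obj (ob x))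
    (h₀ : ∀ {X : B} {x y : X ⟶ X} (a : x ⟶ y), F.map (ofCell a) ≫ b y = b x ≫ G.map (ofCell a))
    (h₁ : ∀ {X Y : B} (P : X ⟶ Y) (Q : Y ⟶ X),
      F.map (theta P Q).hom ≫ b _ = b _ ≫ G.map (theta P Q).hom) : F ⟶ G :=
  natTransMk (D := cyc B) (fun x => b x.F) (by rintro _ _ ⟨a⟩; exact h₀ a)
    (fun x => h₁ x.F x.G)

end BiHH

namespace WalkingAdj

open Bicategory

/-! ### Induction principles for the walking adjunction -/

lemma associator_hom {a b c d : WalkingAdj} (p : a ⟶ b) (q : b ⟶ c) (r : c ⟶ d) :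
    (α_ p q r).hom = eqToHom (Strict.assoc p q r) := rfl

lemma associator_inv {a b c d : WalkingAdj} (p : a ⟶ b) (q : b ⟶ c) (r : c ⟶ d) :
    (α_ p q r).inv = eqToHom (Strict.assoc p q r).symm := rfl

lemma leftUnitor_hom {a b : WalkingAdj} (p : a ⟶ b) : (λ_ p).hom = eqToHom (Strict.id_comp p) := rfl

lemma leftUnitor_inv {a b : WalkingAdj} (p : a ⟶ b) : (λ_ p).inv = eqToHom (Strict.id_comp p).symm := rfl

lemma rightUnitor_hom {a b : WalkingAdj} (p : a ⟶ b) : (ρ_ p).hom = eqToHom (Strict.comp_id p) := rfl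

lemma rightUnitor_inv {a b : WalkingAdj} (p : a ⟶ b) : (ρ_ p).inv = eqToHom (Strict.comp_id p).symm := rfl

/-- The 2-cells of the walking adjunction are generated by the whiskered units and counits. -/
theorem hom_induction {a b : WalkingAdj} (P : ∀ {p q : a ⟶ b}, (p ⟶ q) → Prop)
    (heq : ∀ {p q : a ⟶ b} (h : p = q), P (eqToHom h))
    (hcomp : ∀ {p q r : a ⟶ b} (x : p ⟶ q) (y : q ⟶ r), P x → P y → P (x ≫ y))
    (hunit : ∀ (l : a ⟶ .zero) (r : .zero ⟶ b), P (l ◁ (u ▷ r)))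
    (hcounit : ∀ (l : a ⟶ .one) (r : .one ⟶ b), P (l ◁ (c ▷ r)))
    {p q : a ⟶ b} (x : p ⟶ q) : P x := by
  -- The induction is run for all whiskerings of a formal composite at once, since whiskerings may
  -- be nested inside it.
  have key {d e : WalkingAdj} {p q : Path d e} (x : Cell p q) :
      ∀ (l : a ⟶ d) (r : e ⟶ b), P (l ◁ ((x.cls : (p : d ⟶ e) ⟶ q) ▷ r)) := by
    induction x with
    | id p =>
      intro l r
      have h : l ◁ ((𝟙 (p : _ ⟶ _)) ▷ r) = eqToHom rfl := by simp
      exact h ▸ heq rfl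
    | vcomp x y hx hy =>
      intro l r
      have h : l ◁ ((x.cls ≫ y.cls) ▷ r) = l ◁ (x.cls ▷ r) ≫ l ◁ (y.cls ▷ r) :=
        (congrArg (l ◁ ·) (comp_whiskerRight _ _ _)).trans (whiskerLeft_comp _ _ _)
      exact h ▸ hcomp _ _ (hx l r) (hy l r)
    | @whiskerLeft a' b' c' p q q' x hx =>
      intro l r
      let p' : a' ⟶ b' := p
      let x' : (q : b' ⟶ c') ⟶ q' := x.cls
      have h : l ◁ ((p' ◁ x') ▷ r) = (l ◁ (α_ _ _ _).hom ≫ (α_ _ _ _).inv) ≫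
          (l ≫ p') ◁ (x' ▷ r) ≫ ((α_ _ _ _).hom ≫ l ◁ (α_ _ _ _).inv) := by
        simp
      have h' : P (l ◁ ((p' ◁ x') ▷ r)) := by
        rw [h]
        refine hcomp _ _ ?_ (hcomp _ _ (hx _ r) ?_)
        · simp only [associator_hom, associator_inv, whiskerLeft_eqToHom, eqToHom_trans]
          exact heq _
        · simp only [associator_hom, associator_inv, whiskerLeft_eqToHom, eqToHom_trans]
          exact heq _
      exact h'
    | @whiskerRight a' b' c' p q x s hx =>
      intro l r
      let s' : b' ⟶ c' := s
      let x' : (p : a' ⟶ b') ⟶ q := x.cls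
      have h : l ◁ ((x' ▷ s') ▷ r) = l ◁ (α_ _ _ _).hom ≫ l ◁ (x' ▷ (s' ≫ r)) ≫
          l ◁ (α_ _ _ _).inv := by
        simp
      have h' : P (l ◁ ((x' ▷ s') ▷ r)) := by
        rw [h]
        refine hcomp _ _ ?_ (hcomp _ _ (hx _ _) ?_)
        · simp only [associator_hom, whiskerLeft_eqToHom]
          exact heq _
        · simp only [associator_inv, whiskerLeft_eqToHom]
          exact heq _
      exact h'
    | unit => exact hunit
    | counit => exact hcounit
  have key' (x : p ⟶ q) : P (𝟙 a ◁ (x ▷ 𝟙 b)) :=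
    Quotient.inductionOn x (fun x => key x (𝟙 a) (𝟙 b))
  have h : x = ((ρ_ p).inv ≫ (λ_ _).inv) ≫ 𝟙 a ◁ (x ▷ 𝟙 b) ≫ (λ_ _).hom ≫ (ρ_ q).hom := by
    rw [id_whiskerLeft, whiskerRight_id]
    simp
  rw [h]
  refine hcomp _ _ ?_ (hcomp _ _ (key' x) ?_)
  · simp only [leftUnitor_inv, rightUnitor_inv, eqToHom_trans]
    exact heq _
  · simp only [leftUnitor_hom, rightUnitor_hom, eqToHom_trans]
    exact heq _

/-- Induction on 1-cells which end with a given `s`. -/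
lemma whisker_induction {a b d e : WalkingAdj} (P : ∀ {p q : a ⟶ b}, (p ⟶ q) → Prop)
    (heq : ∀ {p q : a ⟶ b} (h : p = q), P (eqToHom h))
    (hcomp : ∀ {p q r : a ⟶ b} (x : p ⟶ q) (y : q ⟶ r), P x → P y → P (x ≫ y))
    (s : b ⟶ b) (hstep : ∀ {p q : a ⟶ b} (x : p ⟶ q), P x → P (x ▷ s))
    (l : a ⟶ d) (r : e ⟶ b) {p q : d ⟶ e} (x : p ⟶ q) (h : P (l ◁ (x ▷ r))) :
    P (l ◁ (x ▷ (r ≫ s))) := by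
  have h' : l ◁ (x ▷ (r ≫ s)) = (l ◁ (α_ _ _ _).inv ≫ (α_ _ _ _).inv) ≫ (l ◁ (x ▷ r)) ▷ s ≫
      (α_ _ _ _).hom ≫ l ◁ (α_ _ _ _).hom := by
    simp
  rw [h']
  refine hcomp _ _ ?_ (hcomp _ _ (hstep _ h) ?_)
  · simp only [associator_inv, whiskerLeft_eqToHom, eqToHom_trans]
    exact heq _
  · simp only [associator_hom, whiskerLeft_eqToHom, eqToHom_trans]
    exact heq _

/-- Induction on 1-cells with target `0`. -/
lemma path_zero_induction : ∀ {a : WalkingAdj} (P : (a ⟶ .zero) → Prop)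
    (_ : ∀ h : a = .zero, P (h ▸ 𝟙 _)) (_ : ∀ h : a = .one, P (h ▸ g))
    (_ : ∀ p, P p → P (p ≫ (f ≫ g))) (p : Path a .zero), P p
  | _, _, hnil, _, _, .nil _ => hnil rfl
  | _, _, _, hg, _, .cons (.nil _) .g => hg rfl
  | _, P, hnil, hg, hstep, .cons (.cons p .f) .g =>
    hstep p (path_zero_induction P hnil hg hstep p)

/-- Induction on 1-cells with target `1`. -/
lemma path_one_induction : ∀ {a : WalkingAdj} (P : (a ⟶ .one) → Prop)
    (_ : ∀ h : a = .one, P (h ▸ 𝟙 _)) (_ : ∀ h : a = .zero, P (h ▸ f))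
    (_ : ∀ p, P p → P (p ≫ (g ≫ f))) (p : Path a .one), P p
  | _, _, hnil, _, _, .nil _ => hnil rfl
  | _, _, _, hf, _, .cons (.nil _) .f => hf rfl
  | _, P, hnil, hf, hstep, .cons (.cons p .g) .f =>
    hstep p (path_one_induction P hnil hf hstep p)

/-- Induction on 2-cells between 1-cells with target `0`. -/
theorem hom_zero_induction {a : WalkingAdj} (P : ∀ {p q : a ⟶ .zero}, (p ⟶ q) → Prop)
    (heq : ∀ {p q : a ⟶ .zero} (h : p = q), P (eqToHom h))
    (hcomp : ∀ {p q r : a ⟶ .zero} (x : p ⟶ q) (y : q ⟶ r), P x → P y → P (x ≫ y))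
    (hstep : ∀ {p q : a ⟶ .zero} (x : p ⟶ q), P x → P (x ▷ (f ≫ g)))
    (hunit : ∀ l : a ⟶ .zero, P (l ◁ u)) (hcounit : ∀ l : a ⟶ .one, P (l ◁ (c ▷ g)))
    {p q : a ⟶ .zero} (x : p ⟶ q) : P x := by
  refine hom_induction P heq hcomp (fun l r => ?_) (fun l r => ?_) x
  -- Factors `f ≫ g` are stripped from the right whiskering 1-cell. What remains is an identity next
  -- to a unit, and `g` next to a counit.
  · refine path_zero_induction (fun r => P (l ◁ (u ▷ r))) (fun _ => ?_) (by rintro ⟨⟩)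
      (fun r h => whisker_induction P heq hcomp _ hstep l r u h) r
    have h : l ◁ (u ▷ 𝟙 _) = l ◁ (ρ_ _).hom ≫ l ◁ u ≫ l ◁ (ρ_ _).inv := by simp
    change P (l ◁ (u ▷ 𝟙 _))
    rw [h]
    refine hcomp _ _ ?_ (hcomp _ _ (hunit l) ?_)
    · rw [rightUnitor_hom, whiskerLeft_eqToHom]; exact heq _
    · rw [rightUnitor_inv, whiskerLeft_eqToHom]; exact heq _
  · exact path_zero_induction (fun r => P (l ◁ (c ▷ r))) (by rintro ⟨⟩) (fun _ => hcounit l)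
      (fun r h => whisker_induction P heq hcomp _ hstep l r c h) r

/-- Induction on 2-cells between 1-cells with target `1`. -/
theorem hom_one_induction {a : WalkingAdj} (P : ∀ {p q : a ⟶ .one}, (p ⟶ q) → Prop)
    (heq : ∀ {p q : a ⟶ .one} (h : p = q), P (eqToHom h))
    (hcomp : ∀ {p q r : a ⟶ .one} (x : p ⟶ q) (y : q ⟶ r), P x → P y → P (x ≫ y))
    (hstep : ∀ {p q : a ⟶ .one} (x : p ⟶ q), P x → P (x ▷ (g ≫ f)))
    (hunit : ∀ l : a ⟶ .zero, P (l ◁ (u ▷ f))) (hcounit : ∀ l : a ⟶ .one, P (l ◁ c))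
    {p q : a ⟶ .one} (x : p ⟶ q) : P x := by
  refine hom_induction P heq hcomp (fun l r => ?_) (fun l r => ?_) x
  · exact path_one_induction (fun r => P (l ◁ (u ▷ r))) (by rintro ⟨⟩) (fun _ => hunit l)
      (fun r h => whisker_induction P heq hcomp _ hstep l r u h) r
  · refine path_one_induction (fun r => P (l ◁ (c ▷ r))) (fun _ => ?_) (by rintro ⟨⟩)
      (fun r h => whisker_induction P heq hcomp _ hstep l r c h) r
    have h : l ◁ (c ▷ 𝟙 _) = l ◁ (ρ_ _).hom ≫ l ◁ c ≫ l ◁ (ρ_ _).inv := by simp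
    change P (l ◁ (c ▷ 𝟙 _))
    rw [h]
    refine hcomp _ _ ?_ (hcomp _ _ (hcounit l) ?_)
    · rw [rightUnitor_hom, whiskerLeft_eqToHom]; exact heq _
    · rw [rightUnitor_inv, whiskerLeft_eqToHom]; exact heq _

end WalkingAdj

namespace WalkingAdj

open Bicategory

/-! ### Canonical 2-cells of the walking adjunction -/

lemma left_triangle : u ▷ f ≫ (α_ f g f).hom ≫ f ◁ c = (λ_ f).hom ≫ (ρ_ f).inv := by
  rw [← adjunction.left_triangle]
  change _ = leftZigzag u c
  bicategory

lemma right_triangle : g ◁ u ≫ (α_ g f g).inv ≫ c ▷ g = (ρ_ g).hom ≫ (λ_ g).inv := by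
  rw [← adjunction.right_triangle]
  change _ = rightZigzag u c
  bicategory

/-- The multiplication of the monad `f ≫ g` on `0`. -/
def mul : (f ≫ g) ≫ (f ≫ g) ⟶ f ≫ g :=
  (α_ f g (f ≫ g)).hom ≫ f ◁ ((α_ g f g).inv ≫ c ▷ g ≫ (λ_ g).hom)

/-- The left triangle identity whiskered by `g`; the other unit law is the right triangle identity
whiskered by `f`. -/
lemma unit_mul : u ▷ (f ≫ g) ≫ mul = (λ_ (f ≫ g)).hom := by
  have h := congrArg (· ▷ g) left_triangle
  simp only [comp_whiskerRight, whisker_assoc] at h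
  calc _ = (α_ _ _ _).inv ≫ (u ▷ f ▷ g ≫ (α_ f g f).hom ▷ g ≫
        (α_ f (g ≫ f) g).hom ≫ f ◁ c ▷ g ≫ (α_ f (𝟙 _) g).inv) ≫ (α_ _ _ _).hom ≫
          f ◁ (λ_ g).hom := by
        simp [mul]
    _ = _ := by rw [h]; simp

lemma mul_unit : (f ≫ g) ◁ u ≫ mul = (ρ_ (f ≫ g)).hom := by
  have h := right_triangle
  have h' : (f ≫ g) ◁ u ≫ mul = (α_ f g _).hom ≫ f ◁ (g ◁ u ≫ (α_ g f g).inv ≫ c ▷ g) ≫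
      f ◁ (λ_ g).hom := by
    simp [mul]
  rw [h', h]
  simp

/-- Associativity is the interchange law for the two counits, which act at disjoint places of the
string. -/
lemma mul_mul : mul ▷ (f ≫ g) ≫ mul = (α_ _ _ _).hom ≫ (f ≫ g) ◁ mul ≫ mul := by
  have h := whisker_exchange c (c ▷ g)
  calc _ = 𝟙 _ ⊗≫ f ◁ (c ▷ ((g ≫ f) ≫ g) ≫ 𝟙 _ ◁ (c ▷ g)) ⊗≫ 𝟙 _ := by
        simp only [mul]; bicategory
    _ = 𝟙 _ ⊗≫ f ◁ ((g ≫ f) ◁ (c ▷ g) ≫ c ▷ (𝟙 _ ≫ g)) ⊗≫ 𝟙 _ := by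
        rw [whisker_exchange]
    _ = _ := by simp only [mul]; bicategory

/-- Induction on 2-cells between endo-1-cells of `0`. -/
theorem endo_zero_induction
    (P : ∀ {p q : WalkingAdj.zero ⟶ WalkingAdj.zero}, (p ⟶ q) → Prop)
    (heq : ∀ {p q : WalkingAdj.zero ⟶ WalkingAdj.zero} (h : p = q), P (eqToHom h))
    (hcomp : ∀ {p q r : WalkingAdj.zero ⟶ WalkingAdj.zero} (x : p ⟶ q) (y : q ⟶ r),
      P x → P y → P (x ≫ y))
    (hstep : ∀ {p q : WalkingAdj.zero ⟶ WalkingAdj.zero} (x : p ⟶ q), P x → P (x ▷ (f ≫ g)))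
    (hunit : ∀ l : WalkingAdj.zero ⟶ WalkingAdj.zero, P (l ◁ u))
    (hmul : ∀ l : WalkingAdj.zero ⟶ WalkingAdj.zero, P (l ◁ mul))
    {p q : WalkingAdj.zero ⟶ WalkingAdj.zero} (x : p ⟶ q) : P x := by
  refine hom_zero_induction P heq hcomp hstep hunit (fun l => ?_) x
  -- A 1-cell from 0 to 1 ends in `f`, and `f ◁ (c ▷ g)` is the multiplication of the monad up to
  -- constraints.
  have key (l : WalkingAdj.zero ⟶ WalkingAdj.zero) : P ((l ≫ f) ◁ (c ▷ g)) := by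
    have h : (l ≫ f) ◁ (c ▷ g) = ((α_ _ _ _).hom ≫ l ◁ f ◁ (α_ _ _ _).hom ≫
        l ◁ (α_ _ _ _).inv) ≫ l ◁ mul ≫ (l ◁ f ◁ (λ_ _).inv ≫ (α_ _ _ _).inv) := by
      simp [mul]
    rw [h]
    refine hcomp _ _ ?_ (hcomp _ _ (hmul l) ?_)
    · simp only [associator_hom, associator_inv, whiskerLeft_eqToHom, eqToHom_trans]
      exact heq _
    · simp only [leftUnitor_inv, associator_inv, whiskerLeft_eqToHom, eqToHom_trans]
      exact heq _
  match l with
  | .cons l .f => exact key l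

/-! ### Initial and terminal endo-1-cells. -/

/-- The canonical 2-cell from an endo-1-cell of `1` to the identity. -/
def toOne : ∀ p : Path .one .one, ((p : WalkingAdj.one ⟶ WalkingAdj.one) ⟶ 𝟙 WalkingAdj.one)
  | .nil _ => 𝟙 (𝟙 WalkingAdj.one)
  | .cons (.cons p .g) .f =>
    let q : WalkingAdj.one ⟶ WalkingAdj.one := p
    q ◁ c ≫ (ρ_ q).hom ≫ toOne p

lemma toOne_id : toOne (𝟙 WalkingAdj.one) = 𝟙 _ := by
  change toOne (.nil _) = _
  rw [toOne]

lemma toOne_comp (p : WalkingAdj.one ⟶ WalkingAdj.one) :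
    toOne (p ≫ (g ≫ f)) = p ◁ c ≫ (ρ_ p).hom ≫ toOne p := by
  change toOne (.cons (.cons p .g) .f) = _
  rw [toOne]
  rfl

lemma eqToHom_toOne {p q : WalkingAdj.one ⟶ WalkingAdj.one} (h : p = q) :
    eqToHom h ≫ toOne q = toOne p := by
  subst h; simp

/-- With `toOne_id` this makes the identity terminal among the endo-1-cells of 1. On generators,
only the whiskered unit needs the adjunction: the counit contracts the inserted pair by the left
triangle identity. -/
lemma comp_toOne {p q : WalkingAdj.one ⟶ WalkingAdj.one} (x : p ⟶ q) :
    x ≫ toOne q = toOne p := by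
  refine hom_one_induction (fun {p q : WalkingAdj.one ⟶ WalkingAdj.one} x =>
    x ≫ toOne q = toOne p) eqToHom_toOne ?_ ?_ ?_ ?_ x
  · intro p q r x y hx hy
    rw [Category.assoc, hy, hx]
  · intro p q x hx
    rw [toOne_comp, toOne_comp, ← whisker_exchange_assoc, whiskerRight_id]
    simp [hx]
  · intro l
    have h1 : l ◁ (u ▷ f) ≫ toOne (l ≫ ((f ≫ g) ≫ f)) = l ◁ (u ▷ f ≫ (α_ f g f).hom ≫ f ◁ c) ≫
        l ◁ (ρ_ f).hom ≫ toOne (l ≫ f) := by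
      have h2 : toOne (l ≫ ((f ≫ g) ≫ f)) = (l ◁ (α_ f g f).hom ≫ (α_ _ _ _).inv) ≫
          (l ≫ f) ◁ c ≫ (ρ_ (l ≫ f)).hom ≫ toOne (l ≫ f) := by
        rw [← toOne_comp]
        simp only [associator_hom, associator_inv, whiskerLeft_eqToHom, eqToHom_trans,
          eqToHom_toOne]
      rw [h2]
      simp
    rw [h1, left_triangle]
    simp only [leftUnitor_hom, rightUnitor_inv, rightUnitor_hom, whiskerLeft_eqToHom,
      eqToHom_trans, eqToHom_toOne]
  · intro l
    have h : toOne (l ≫ 𝟙 _) = (ρ_ l).hom ≫ toOne l := by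
      rw [rightUnitor_hom, eqToHom_toOne]
    rw [toOne_comp, h]

/-- The canonical 2-cell from the identity to an endo-1-cell of `0`. -/
def ofZero : ∀ p : Path .zero .zero,
    (𝟙 WalkingAdj.zero ⟶ (p : WalkingAdj.zero ⟶ WalkingAdj.zero))
  | .nil _ => 𝟙 (𝟙 WalkingAdj.zero)
  | .cons (.cons p .f) .g =>
    let q : WalkingAdj.zero ⟶ WalkingAdj.zero := p
    ofZero p ≫ (ρ_ q).inv ≫ q ◁ u

lemma ofZero_id : ofZero (𝟙 WalkingAdj.zero) = 𝟙 _ := by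
  change ofZero (.nil _) = _
  rw [ofZero]

lemma ofZero_comp (p : WalkingAdj.zero ⟶ WalkingAdj.zero) :
    ofZero (p ≫ (f ≫ g)) = ofZero p ≫ (ρ_ p).inv ≫ p ◁ u := by
  change ofZero (.cons (.cons p .f) .g) = _
  rw [ofZero]
  rfl

lemma ofZero_eqToHom {p q : WalkingAdj.zero ⟶ WalkingAdj.zero} (h : p = q) :
    ofZero p ≫ eqToHom h = ofZero q := by
  subst h; simp

/-- The counterpart for the identity of 0: units are inserted instead of counits being applied. The
multiplication case is the right unit law of the monad. -/
lemma ofZero_comp_cell {p q : WalkingAdj.zero ⟶ WalkingAdj.zero} (x : p ⟶ q) :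
    ofZero p ≫ x = ofZero q := by
  refine endo_zero_induction (fun {p q : WalkingAdj.zero ⟶ WalkingAdj.zero} x =>
    ofZero p ≫ x = ofZero q) ofZero_eqToHom ?_ ?_ ?_ ?_ x
  · intro p q r x y hx hy
    rw [← Category.assoc, hx, hy]
  · intro p q x hx
    rw [ofZero_comp, ofZero_comp, Category.assoc, Category.assoc, whisker_exchange,
      whiskerRight_id]
    simp [reassoc_of% hx]
  · intro l
    have h : ofZero (l ≫ 𝟙 _) = ofZero l ≫ (ρ_ l).inv := by
      rw [rightUnitor_inv, ofZero_eqToHom]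
    rw [ofZero_comp, h, Category.assoc]
  · intro l
    have h : ofZero (l ≫ ((f ≫ g) ≫ (f ≫ g))) = ofZero (l ≫ (f ≫ g)) ≫ (ρ_ _).inv ≫
        (l ≫ (f ≫ g)) ◁ u ≫ (α_ _ _ _).hom := by
      rw [associator_hom, ← ofZero_eqToHom (Strict.assoc l (f ≫ g) (f ≫ g)), ofZero_comp]
      simp only [Category.assoc]
    rw [h]
    have h' := congrArg (l ◁ ·) mul_unit
    simp only [whiskerLeft_comp] at h'
    rw [comp_whiskerLeft]
    simp only [Category.assoc, Iso.inv_hom_id_assoc, h']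
    simp

/-- Associativity of a right action of `t` on `s`, used for the monad acting on itself. -/
lemma whiskerRight_mul {B : Type u} [Bicategory.{w, v} B] {X Y : B} {t : X ⟶ X} {m : t ≫ t ⟶ t}
    {l s : Y ⟶ X} {n : s ≫ t ⟶ s}
    (h : n ▷ t ≫ n = (α_ _ _ _).hom ≫ s ◁ m ≫ n) (x : l ⟶ s) :
    x ▷ (t ≫ t) ≫ s ◁ m ≫ n = (α_ _ _ _).inv ≫ (x ▷ t ≫ n) ▷ t ≫ n := by
  simp [h]

/-- The canonical 2-cell from an endo-1-cell of `0` to `f ≫ g`. -/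
def toMonad : ∀ p : Path .zero .zero, ((p : WalkingAdj.zero ⟶ WalkingAdj.zero) ⟶ f ≫ g)
  | .nil _ => u
  | .cons (.cons p .f) .g =>
    let x : (p : WalkingAdj.zero ⟶ WalkingAdj.zero) ⟶ f ≫ g := toMonad p
    x ▷ (f ≫ g) ≫ mul

lemma toMonad_id : toMonad (𝟙 WalkingAdj.zero) = u := by
  change toMonad (.nil _) = _
  rw [toMonad]

lemma toMonad_comp (p : WalkingAdj.zero ⟶ WalkingAdj.zero) :
    toMonad (p ≫ (f ≫ g)) = toMonad p ▷ (f ≫ g) ≫ mul := by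
  change toMonad (.cons (.cons p .f) .g) = _
  rw [toMonad]
  rfl

lemma eqToHom_toMonad {p q : WalkingAdj.zero ⟶ WalkingAdj.zero} (h : p = q) :
    eqToHom h ≫ toMonad q = toMonad p := by
  subst h; simp

/-- Iterated multiplication does not see how a power of the monad was produced. The unit case is the
right unit law and the multiplication case is associativity. -/
lemma comp_toMonad {p q : WalkingAdj.zero ⟶ WalkingAdj.zero} (x : p ⟶ q) :
    x ≫ toMonad q = toMonad p := by
  refine endo_zero_induction (fun {p q : WalkingAdj.zero ⟶ WalkingAdj.zero} x =>
    x ≫ toMonad q = toMonad p) eqToHom_toMonad ?_ ?_ ?_ ?_ x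
  · intro p q r x y hx hy
    rw [Category.assoc, hy, hx]
  · intro p q x hx
    rw [toMonad_comp, toMonad_comp, ← hx, comp_whiskerRight]
    exact (Category.assoc _ _ _).symm
  · intro l
    have h : toMonad (l ≫ 𝟙 _) = (ρ_ l).hom ≫ toMonad l := by
      rw [rightUnitor_hom, eqToHom_toMonad]
    rw [toMonad_comp, h, whisker_exchange_assoc, mul_unit, whiskerRight_id]
    simp
  · intro l
    have h : toMonad (l ≫ ((f ≫ g) ≫ (f ≫ g))) = (α_ _ _ _).inv ≫
        toMonad ((l ≫ (f ≫ g)) ≫ (f ≫ g)) := by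
      rw [associator_inv, eqToHom_toMonad]
    rw [h, toMonad_comp, toMonad_comp, toMonad_comp, whisker_exchange_assoc]
    exact whiskerRight_mul mul_mul _

/-- This turns the compatible family of 2-cells into terminality of the monad. The canonical 2-cell
starts from `u`, so the left unit law is what is needed. -/
lemma toMonad_monad : toMonad (f ≫ g) = 𝟙 (f ≫ g) := by
  have h : toMonad (𝟙 _ ≫ (f ≫ g)) = (λ_ _).hom ≫ toMonad (f ≫ g) := by
    rw [leftUnitor_hom, eqToHom_toMonad]
  rw [toMonad_comp, toMonad_id, unit_mul] at h
  rw [← cancel_epi (λ_ (f ≫ g)).hom, ← h, Category.comp_id]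

/-- The monad `f ≫ g` is terminal among the endo-1-cells of `0`. -/
lemma hom_monad_ext {p : WalkingAdj.zero ⟶ WalkingAdj.zero} (x y : p ⟶ f ≫ g) : x = y := by
  rw [← Category.comp_id x, ← Category.comp_id y, ← toMonad_monad, comp_toMonad, comp_toMonad]

/-- The identity is initial among the endo-1-cells of `0`. -/
lemma hom_id_ext {p : WalkingAdj.zero ⟶ WalkingAdj.zero} (x y : 𝟙 _ ⟶ p) : x = y := by
  rw [← Category.id_comp x, ← Category.id_comp y, ← ofZero_id, ofZero_comp_cell, ofZero_comp_cell]

end WalkingAdj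

namespace BiHH

open Bicategory

/-! ### The full rotation -/

section

variable {B : Type u} [Bicategory.{w, v} B]

lemma theta_right {X Y : B} (F : X ⟶ Y) {G G' : Y ⟶ X} (b : G ⟶ G') :
    ofCell (F ◁ b) ≫ (theta F G').hom = (theta F G).hom ≫ ofCell (b ▷ F) := by
  simpa using theta_naturality (𝟙 F) b

/-- The full rotation of an endo-1-cell. -/
def twist {X : B} (H : X ⟶ X) : ob H ⟶ ob H :=
  ofCell (λ_ H).inv ≫ (theta (𝟙 X) H).hom ≫ ofCell (ρ_ H).hom

lemma twist_naturality {X : B} {H H' : X ⟶ X} (a : H ⟶ H') :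
    ofCell a ≫ twist H' = twist H ≫ ofCell a := by
  have h := theta_right (𝟙 X) a
  have h₁ : a ≫ (λ_ H').inv = (λ_ H).inv ≫ 𝟙 X ◁ a := by simp
  have h₂ : (ρ_ H).hom ≫ a = a ▷ 𝟙 X ≫ (ρ_ H').hom := by simp
  simp only [twist, Category.assoc]
  rw [← ofCell_comp, h₂, ofCell_comp, ← reassoc_of% h, ← Category.assoc, ← ofCell_comp, h₁,
    ofCell_comp, Category.assoc]

lemma twist_id (X : B) : twist (𝟙 X) = 𝟙 _ := by
  simp only [twist, theta_unit, ← ofCell_comp]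
  simp [unitors_inv_equal]

/-- The hexagon with an identity as its first 1-cell. Cyclicity is not symmetric: exchanging twice
is a full rotation, and this is why the paracyclic category appears. -/
lemma theta_theta {X Y : B} (F : X ⟶ Y) (G : Y ⟶ X) :
    (theta F G).hom ≫ (theta G F).hom = twist (F ≫ G) := by
  have h := theta_hexagon (𝟙 X) F G
  have h₁ := theta_left (λ_ F).hom G
  have h₂ := theta_left (ρ_ G).hom F
  rw [twist, h]
  have e₁ : (λ_ (F ≫ G)).inv ≫ (α_ (𝟙 X) F G).inv = (λ_ F).inv ▷ G := by simp
  have e₂ : (α_ F G (𝟙 X)).inv ≫ (ρ_ (F ≫ G)).hom = F ◁ (ρ_ G).hom := by simp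
  have e₃ : G ◁ (λ_ F).inv ≫ (α_ G (𝟙 X) F).inv ≫ (ρ_ G).hom ▷ F = 𝟙 _ := by
    simp
  have h₃ := theta_left (λ_ F).inv G
  simp only [Category.assoc]
  rw [← Category.assoc (ofCell _), ← ofCell_comp, e₁, ← ofCell_comp, e₂, ← h₂, reassoc_of% h₃]
  simp only [← Category.assoc]
  congr 1
  simp only [Category.assoc]
  rw [← ofCell_comp, ← ofCell_comp, e₃, ofCell_id, Category.comp_id]

variable {X Y : B} {f : X ⟶ Y} {g : Y ⟶ X} {u : 𝟙 X ⟶ f ≫ g} {c : g ≫ f ⟶ 𝟙 Y}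

/-- A unit is inserted in front, its `f` is rotated to the end, and its `g` cancels the old `f`. By
naturality the cancellation may precede the rotation, where it is a triangle identity. -/
lemma theta_unit_left (h : u ▷ f ≫ (α_ f g f).hom ≫ f ◁ c = (λ_ f).hom ≫ (ρ_ f).inv)
    (P : Y ⟶ X) :
    ofCell ((λ_ (f ≫ P)).inv ≫ u ▷ (f ≫ P) ≫ (α_ f g (f ≫ P)).hom) ≫ (theta f (g ≫ f ≫ P)).hom ≫
      ofCell (((α_ g f P).inv ≫ c ▷ P ≫ (λ_ P).hom) ▷ f) = (theta f P).hom := by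
  have h' := congrArg (· ▷ P) h
  simp only [comp_whiskerRight, whisker_assoc] at h'
  have e : ((λ_ (f ≫ P)).inv ≫ u ▷ (f ≫ P) ≫ (α_ f g (f ≫ P)).hom) ≫
      f ◁ ((α_ g f P).inv ≫ c ▷ P ≫ (λ_ P).hom) = 𝟙 _ := by
    calc _ = (λ_ (f ≫ P)).inv ≫ (α_ _ _ _).inv ≫ (u ▷ f ▷ P ≫ (α_ f g f).hom ▷ P ≫
          (α_ f (g ≫ f) P).hom ≫ f ◁ c ▷ P ≫ (α_ f (𝟙 Y) P).inv) ≫ (α_ f (𝟙 Y) P).hom ≫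
            f ◁ (λ_ P).hom := by simp
      _ = 𝟙 _ := by rw [h']; simp
  rw [← theta_right, ← Category.assoc, ← ofCell_comp, e, ofCell_id, Category.id_comp]

/-- Here the unit is inserted behind `P`, and its `g` cancels the old `f` once that has been
rotated. By naturality the insertion may follow the rotation, where it meets the counit in a
triangle identity. -/
lemma theta_unit_right (h : u ▷ f ≫ (α_ f g f).hom ≫ f ◁ c = (λ_ f).hom ≫ (ρ_ f).inv)
    (P : Y ⟶ X) :
    ofCell (f ◁ ((ρ_ P).inv ≫ P ◁ u ≫ (α_ P f g).inv)) ≫ (theta f ((P ≫ f) ≫ g)).hom ≫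
      ofCell ((α_ (P ≫ f) g f).hom ≫ (P ≫ f) ◁ c ≫ (ρ_ (P ≫ f)).hom) = (theta f P).hom := by
  have h' := congrArg (P ◁ ·) h
  simp only [whiskerLeft_comp] at h'
  have e : ((ρ_ P).inv ≫ P ◁ u ≫ (α_ P f g).inv) ▷ f ≫ (α_ (P ≫ f) g f).hom ≫ (P ≫ f) ◁ c ≫
      (ρ_ (P ≫ f)).hom = 𝟙 _ := by
    calc _ = (ρ_ P).inv ▷ f ≫ (α_ _ _ _).hom ≫ (P ◁ u ▷ f ≫ P ◁ (α_ f g f).hom ≫ P ◁ f ◁ c) ≫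
          (α_ _ _ _).inv ≫ (ρ_ (P ≫ f)).hom := by simp
      _ = 𝟙 _ := by rw [h']; simp
  rw [← Category.assoc, theta_right, Category.assoc, ← ofCell_comp, e, ofCell_id,
    Category.comp_id]

/-- The inserted `f` is rotated to the end and cancels the old `g`, so that the inserted `g`
survives in front. The hexagon separates the rotation into two steps, and the right triangle
identity leaves a surplus full rotation. -/
lemma theta_unit_counit (h : g ◁ u ≫ (α_ g f g).inv ≫ c ▷ g = (ρ_ g).hom ≫ (λ_ g).inv)
    (P : X ⟶ Y) :
    ofCell (((λ_ P).inv ≫ u ▷ P ≫ (α_ f g P).hom) ▷ g ≫ (α_ f (g ≫ P) g).hom) ≫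
      (theta f ((g ≫ P) ≫ g)).hom ≫
        ofCell ((α_ (g ≫ P) g f).hom ≫ (g ≫ P) ◁ c ≫ (ρ_ (g ≫ P)).hom) =
      (theta P g).hom ≫ twist (g ≫ P) := by
  have h' := congrArg (· ▷ P) h
  simp only [comp_whiskerRight, whisker_assoc, Category.assoc] at h'
  have hx := theta_left ((λ_ P).inv ≫ u ▷ P ≫ (α_ f g P).hom) g
  have hc := theta_naturality c (𝟙 (g ≫ P))
  simp only [whiskerLeft_id, Category.comp_id, id_whiskerRight, Category.id_comp] at hc
  have e : g ◁ ((λ_ P).inv ≫ u ▷ P ≫ (α_ f g P).hom) ≫ (α_ g f (g ≫ P)).inv ≫ c ▷ (g ≫ P) =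
      (λ_ (g ≫ P)).inv := by
    calc _ = g ◁ (λ_ P).inv ≫ (α_ _ _ _).inv ≫ ((α_ _ _ _).hom ≫ g ◁ u ▷ P ≫ (α_ _ _ _).inv ≫
          (α_ g f g).inv ▷ P ≫ c ▷ g ▷ P) ≫ (α_ _ _ _).hom := by
          simp only [whiskerLeft_comp, Category.assoc, Iso.inv_hom_id_assoc]
          simp
      _ = _ := by
          rw [h']
          simp
  have e' : (α_ (g ≫ P) g f).inv ≫ (α_ (g ≫ P) g f).hom = 𝟙 _ := Iso.inv_hom_id _
  have e'' : (α_ f (g ≫ P) g).hom ≫ (α_ f (g ≫ P) g).inv = 𝟙 _ := Iso.hom_inv_id _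
  have e₁ := congrArg ofCell e
  have e₂ := congrArg ofCell e'
  have e₃ := congrArg ofCell e''
  simp only [ofCell_comp, ofCell_id] at e₁ e₂ e₃ hx hc ⊢
  simp only [theta_hexagon f (g ≫ P) g, Category.assoc, twist]
  rw [reassoc_of% e₃, reassoc_of% e₂, reassoc_of% hx, ← reassoc_of% hc]
  rw [reassoc_of% e₁]

end

/-! ### Initial and terminal objects of `biHH` of the walking adjunction -/

/-- Invariance of a family of morphisms under all cyclicity isomorphisms follows from invariance
under those which move a generating 1-cell. -/
lemma theta_invariant {E : Type u'} [Category.{v'} E] {F G : BiHH WalkingAdj ⥤ E}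
    (b : ∀ {X : WalkingAdj} (x : X ⟶ X), F.obj (ob x) ⟶ G.obj (ob x))
    (h₀ : ∀ {X : WalkingAdj} {x y : X ⟶ X} (a : x ⟶ y),
      F.map (ofCell a) ≫ b y = b x ≫ G.map (ofCell a))
    (hf : ∀ P : WalkingAdj.one ⟶ WalkingAdj.zero,
      F.map (theta P WalkingAdj.f).hom ≫ b _ = b _ ≫ G.map (theta P WalkingAdj.f).hom)
    (hg : ∀ P : WalkingAdj.zero ⟶ WalkingAdj.one,
      F.map (theta P WalkingAdj.g).hom ≫ b _ = b _ ≫ G.map (theta P WalkingAdj.g).hom)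
    {X Y : WalkingAdj} (P : X ⟶ Y) (Q : Y ⟶ X) :
    F.map (theta P Q).hom ≫ b _ = b _ ≫ G.map (theta P Q).hom := by
  -- The hexagon moves a composite past `P` one factor at a time: first `e`, then `Q`.
  have hcons {X Y Z : WalkingAdj} (P : X ⟶ Y) (Q : Y ⟶ Z) (e : Z ⟶ X)
      (hQ : F.map (theta (e ≫ P) Q).hom ≫ b _ = b _ ≫ G.map (theta (e ≫ P) Q).hom)
      (he : F.map (theta (P ≫ Q) e).hom ≫ b _ = b _ ≫ G.map (theta (P ≫ Q) e).hom) :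
      F.map (theta P (Q ≫ e)).hom ≫ b _ = b _ ≫ G.map (theta P (Q ≫ e)).hom := by
    simp only [theta_hexagon, F.map_comp, G.map_comp, Category.assoc, h₀]
    rw [reassoc_of% hQ, reassoc_of% h₀, reassoc_of% he, reassoc_of% h₀]
  -- The target of `Q` is tied to `X` only by an equation, since it has to vary in the induction
  -- along the string.
  have key {Y Z : WalkingAdj} (Q : WalkingAdj.Path Y Z) :
      ∀ {X : WalkingAdj} (hX : Z = X) (P : X ⟶ Y),
        F.map (theta P (hX ▸ Q : Y ⟶ X)).hom ≫ b _ = b _ ≫ G.map (theta P (hX ▸ Q : Y ⟶ X)).hom := by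
    induction Q with
    | nil =>
      rintro X rfl P
      change F.map (theta P (𝟙 _)).hom ≫ b _ = b _ ≫ G.map (theta P (𝟙 _)).hom
      simp only [theta_unit, F.map_comp, G.map_comp, Category.assoc, h₀]
      rw [reassoc_of% h₀]
    | cons Q e ih =>
      rintro X rfl P
      cases e with
      | f => exact hcons P Q WalkingAdj.f (ih rfl _) (hf _)
      | g => exact hcons P Q WalkingAdj.g (ih rfl _) (hg _)
  exact key Q rfl P

end BiHH

namespace WalkingAdj

open Bicategory BiHH

/-- The canonical morphism from an object of `biHH` to the unit of `1`. -/
def toUnitOne : ∀ {X : WalkingAdj} (p : X ⟶ X), ob p ⟶ ob (𝟙 WalkingAdj.one)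
  | .zero, p => ofCell ((λ_ p).inv ≫ u ▷ p ≫ (α_ f g p).hom) ≫ (theta f (g ≫ p)).hom ≫
      ofCell (toOne ((g ≫ p) ≫ f))
  | .one, p => ofCell (toOne p)

/-- The canonical morphism from the unit of `0` to an object of `biHH`. -/
def ofUnitZero : ∀ {X : WalkingAdj} (p : X ⟶ X), ob (𝟙 WalkingAdj.zero) ⟶ ob p
  | .zero, p => ofCell (ofZero p)
  | .one, p => ofCell (ofZero (f ≫ (p ≫ g))) ≫ (theta f (p ≫ g)).hom ≫
      ofCell ((α_ p g f).hom ≫ p ◁ c ≫ (ρ_ p).hom)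

/-- For an endo-1-cell of 0, inserting a unit and rotating are natural, which leaves a 2-cell
between endo-1-cells of 1; that is absorbed by terminality of the identity. -/
lemma ofCell_toUnitOne : ∀ {X : WalkingAdj} {p q : X ⟶ X} (x : p ⟶ q),
    ofCell x ≫ toUnitOne q = toUnitOne p
  | .zero, p, q, x => by
    have e : x ≫ (λ_ q).inv ≫ u ▷ q ≫ (α_ f g q).hom =
        ((λ_ p).inv ≫ u ▷ p ≫ (α_ f g p).hom) ≫ f ◁ (g ◁ x) := by
      have h := whisker_exchange u x
      rw [← cancel_epi (λ_ p).hom]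
      simp only [id_whiskerLeft, Category.assoc] at h
      have h' := congrArg (· ≫ (α_ f g q).hom) h
      simpa using h'
    simp only [toUnitOne]
    rw [← Category.assoc, ← ofCell_comp, e, ofCell_comp, Category.assoc,
      reassoc_of% (theta_right f (g ◁ x)), ← ofCell_comp, comp_toOne]
  | .one, p, q, x => by
    simp only [toUnitOne]
    rw [← ofCell_comp, comp_toOne]

lemma ofUnitZero_ofCell : ∀ {X : WalkingAdj} {p q : X ⟶ X} (x : p ⟶ q),
    ofUnitZero p ≫ ofCell x = ofUnitZero q
  | .zero, p, q, x => by
    simp only [ofUnitZero]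
    rw [← ofCell_comp, ofZero_comp_cell]
  | .one, p, q, x => by
    have e : ((α_ p g f).hom ≫ p ◁ c ≫ (ρ_ p).hom) ≫ x =
        (x ▷ g) ▷ f ≫ (α_ q g f).hom ≫ q ◁ c ≫ (ρ_ q).hom := by
      have h := whisker_exchange_assoc x c (ρ_ q).hom
      simp only [whiskerRight_id, Category.assoc, Iso.inv_hom_id, Category.comp_id] at h
      simp [h]
    simp only [ofUnitZero, Category.assoc]
    rw [← ofCell_comp, e, ofCell_comp, ← reassoc_of% (theta_right f (x ▷ g)), ← Category.assoc,
      ← ofCell_comp, ofZero_comp_cell]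

/-- The full rotation is natural and trivial on identity 1-cells, hence invisible after a 2-cell
into an identity. -/
lemma twist_toOne (p : WalkingAdj.one ⟶ WalkingAdj.one) :
    twist p ≫ ofCell (toOne p) = ofCell (toOne p) := by
  rw [← twist_naturality, twist_id, Category.comp_id]

lemma ofZero_twist (p : WalkingAdj.zero ⟶ WalkingAdj.zero) :
    ofCell (ofZero p) ≫ twist p = ofCell (ofZero p) := by
  rw [twist_naturality, twist_id, Category.id_comp]

lemma toUnitOne_f (P : WalkingAdj.one ⟶ WalkingAdj.zero) :
    toUnitOne (f ≫ P) = (theta f P).hom ≫ toUnitOne (P ≫ f) := by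
  have h := theta_unit_left left_triangle P
  rw [← h]
  simp only [toUnitOne, Category.assoc, ← ofCell_comp]
  simp only [comp_toOne]

/-- By `theta_unit_counit` the two sides differ by a full rotation, which the final 2-cell to the
identity absorbs. -/
lemma toUnitOne_g (P : WalkingAdj.zero ⟶ WalkingAdj.one) :
    toUnitOne (P ≫ g) = (theta P g).hom ≫ toUnitOne (g ≫ P) := by
  have h := theta_unit_counit right_triangle P
  have h' := theta_right f (α_ g P g).hom
  have e : ((λ_ P).inv ≫ u ▷ P ≫ (α_ f g P).hom) ▷ g ≫ (α_ f (g ≫ P) g).hom ≫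
      f ◁ (α_ g P g).hom = (λ_ (P ≫ g)).inv ≫ u ▷ (P ≫ g) ≫ (α_ f g (P ≫ g)).hom := by
    simp
  have e' : ((α_ (g ≫ P) g f).hom ≫ (g ≫ P) ◁ c ≫ (ρ_ (g ≫ P)).hom) ≫ toOne (g ≫ P) =
      (α_ g P g).hom ▷ f ≫ toOne ((g ≫ (P ≫ g)) ≫ f) := by
    rw [comp_toOne, comp_toOne]
  calc toUnitOne (P ≫ g) = ofCell ((λ_ (P ≫ g)).inv ≫ u ▷ (P ≫ g) ≫ (α_ f g (P ≫ g)).hom) ≫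
        (theta f (g ≫ P ≫ g)).hom ≫ ofCell (toOne ((g ≫ (P ≫ g)) ≫ f)) := rfl
    _ = ((theta P g).hom ≫ twist (g ≫ P)) ≫ ofCell (toOne (g ≫ P)) := by
      rw [← h, ← e]
      simp only [Category.assoc]
      rw [← ofCell_comp, e']
      simp only [ofCell_comp, Category.assoc]
      rw [← reassoc_of% h']
    _ = (theta P g).hom ≫ toUnitOne (g ≫ P) := by
      rw [Category.assoc, twist_toOne]; rfl

lemma ofUnitZero_f (P : WalkingAdj.one ⟶ WalkingAdj.zero) :
    ofUnitZero (P ≫ f) = ofUnitZero (f ≫ P) ≫ (theta f P).hom := by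
  have h := theta_unit_right left_triangle P
  calc ofUnitZero (P ≫ f) = ofCell (ofZero (f ≫ ((P ≫ f) ≫ g))) ≫
        (theta f ((P ≫ f) ≫ g)).hom ≫
          ofCell ((α_ (P ≫ f) g f).hom ≫ (P ≫ f) ◁ c ≫ (ρ_ (P ≫ f)).hom) := rfl
    _ = ofCell (ofZero (f ≫ P)) ≫ (theta f P).hom := by
      rw [← h, ← reassoc_of% ofCell_comp, ofZero_comp_cell]

/-- The surplus full rotation is carried back across the cyclicity isomorphism, and is then absorbed
by the 2-cell from the identity of 0. -/
lemma ofUnitZero_g (P : WalkingAdj.zero ⟶ WalkingAdj.one) :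
    ofUnitZero (g ≫ P) = ofUnitZero (P ≫ g) ≫ (theta P g).hom := by
  have h := theta_unit_counit right_triangle P
  have h' : (theta P g).hom ≫ twist (g ≫ P) = twist (P ≫ g) ≫ (theta P g).hom := by
    rw [← theta_theta, ← theta_theta, Category.assoc]
  calc ofUnitZero (g ≫ P) = ofCell (ofZero (f ≫ ((g ≫ P) ≫ g))) ≫
        (theta f ((g ≫ P) ≫ g)).hom ≫
          ofCell ((α_ (g ≫ P) g f).hom ≫ (g ≫ P) ◁ c ≫ (ρ_ (g ≫ P)).hom) := rfl
    _ = ofCell (ofZero (P ≫ g)) ≫ (theta P g).hom ≫ twist (g ≫ P) := by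
      rw [← h, ← reassoc_of% ofCell_comp, ofZero_comp_cell]
    _ = ofCell (ofZero (P ≫ g)) ≫ (theta P g).hom := by
      rw [h', reassoc_of% ofZero_twist]

/-- The unit of `1` is terminal. -/
def isTerminalUnitOne : Limits.IsTerminal (ob (𝟙 WalkingAdj.one)) := by
  -- A natural transformation from the identity functor to a constant functor, with identity
  -- component at the constant value, makes that value terminal.
  let t : 𝟭 (BiHH WalkingAdj) ⟶ (Functor.const _).obj (ob (𝟙 WalkingAdj.one)) :=
    natTransOf toUnitOne (fun a => (ofCell_toUnitOne a).trans (Category.comp_id _).symm)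
      (theta_invariant (F := 𝟭 (BiHH WalkingAdj))
        (G := (Functor.const _).obj (ob (𝟙 WalkingAdj.one))) toUnitOne
        (fun a => (ofCell_toUnitOne a).trans (Category.comp_id _).symm)
        (fun P => by
          refine Eq.trans ?_ (Category.comp_id _).symm
          change (theta P f).hom ≫ toUnitOne (f ≫ P) = toUnitOne (P ≫ f)
          -- The relation at hand concerns the cyclicity isomorphism that moves `f` the other way;
          -- the two differ by a full rotation.
          rw [toUnitOne_f, ← Category.assoc, theta_theta]
          exact twist_toOne _)
        (fun P => (toUnitOne_g P).symm.trans (Category.comp_id _).symm))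
  have ht : t.app (ob (𝟙 WalkingAdj.one)) = 𝟙 _ := by
    change ofCell (toOne (𝟙 WalkingAdj.one)) = _
    rw [toOne_id, ofCell_id]
    rfl
  exact Limits.IsTerminal.ofUniqueHom (fun a => t.app a) (fun a m => by
    have h := t.naturality m
    rw [ht] at h
    exact (Category.comp_id m).symm.trans (h.trans (Category.comp_id _)))

/-- The unit of `0` is initial. -/
def isInitialUnitZero : Limits.IsInitial (ob (𝟙 WalkingAdj.zero)) := by
  let t : (Functor.const _).obj (ob (𝟙 WalkingAdj.zero)) ⟶ 𝟭 (BiHH WalkingAdj) :=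
    natTransOf ofUnitZero (fun a => (Category.id_comp _).trans (ofUnitZero_ofCell a).symm)
      (theta_invariant (F := (Functor.const _).obj (ob (𝟙 WalkingAdj.zero)))
        (G := 𝟭 (BiHH WalkingAdj)) ofUnitZero
        (fun a => (Category.id_comp _).trans (ofUnitZero_ofCell a).symm)
        (fun P => by
          refine (Category.id_comp _).trans ?_
          change ofUnitZero (f ≫ P) = ofUnitZero (P ≫ f) ≫ (theta P f).hom
          rw [ofUnitZero_f, Category.assoc, theta_theta]
          exact (ofZero_twist _).symm)
        (fun P => (Category.id_comp _).trans (ofUnitZero_g P)))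
  have ht : t.app (ob (𝟙 WalkingAdj.zero)) = 𝟙 _ := by
    change ofCell (ofZero (𝟙 WalkingAdj.zero)) = _
    rw [ofZero_id, ofCell_id]
    rfl
  exact Limits.IsInitial.ofUniqueHom (fun a => t.app a) (fun a m => by
    have h := t.naturality m
    rw [ht] at h
    exact (Category.id_comp m).symm.trans (h.symm.trans (Category.id_comp _)))

end WalkingAdj

namespace WalkingAdj

open Bicategory

/-! ### The monotone map of a 2-cell of the walking adjunction -/

/-- The number of occurrences of `f` in a generating 1-cell. -/
def Gen.wt : ∀ {a b : WalkingAdj}, Gen a b → ℕ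
  | _, _, .f => 1
  | _, _, .g => 0

/-- The number of occurrences of `f` in a 1-cell. -/
def wt {a : WalkingAdj} : ∀ {b : WalkingAdj}, Path a b → ℕ
  | _, .nil _ => 0
  | _, .cons p e => wt p + e.wt

@[simp] lemma wt_nil (a : WalkingAdj) : wt (.nil a) = 0 := rfl

@[simp] lemma wt_id (a : WalkingAdj) : wt (𝟙 a) = 0 := rfl

@[simp] lemma wt_cons_f {a : WalkingAdj} (p : Path a .zero) : wt (.cons p .f) = wt p + 1 := rfl

@[simp] lemma wt_cons_g {a : WalkingAdj} (p : Path a .one) : wt (.cons p .g) = wt p := rfl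

@[simp] lemma wt_f : wt f = 1 := rfl

@[simp] lemma wt_g : wt g = 0 := rfl

@[simp]
lemma wt_pathComp {a b d : WalkingAdj} (p : Path a b) (q : Path b d) :
    wt (p.comp q) = wt p + wt q := by
  induction q with
  | nil => rfl
  | cons q e ih =>
    cases e with
    | f => exact congrArg (· + 1) ih
    | g => exact ih

@[simp]
lemma wt_comp {a b d : WalkingAdj} (p : a ⟶ b) (q : b ⟶ d) : wt (p ≫ q) = wt p + wt q :=
  wt_pathComp p q

/-- A 1-cell is determined by its end points and its number of occurrences of `f`. -/
lemma path_ext {a b : WalkingAdj} {p q : Path a b} (h : wt p = wt q) : p = q := by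
  induction p with
  | nil =>
    cases q with
    | nil => rfl
    | cons q e =>
      cases e with
      | f => simp at h
      | g => cases q with
        | cons q e => cases e; simp at h
  | cons p e ih =>
    cases e with
    | f =>
      cases q with
      | nil => simp at h
      | cons q e => cases e; rw [ih (by simpa using h)]
    | g =>
      cases q with
      | nil =>
        cases p with
        | cons q e => cases e; simp at h
      | cons q e => cases e; rw [ih (by simpa using h)]

/-- The properties of the map of a 2-cell between two 1-cells from `a` to `b` in which `f` occurs
`n` and `m` times. -/
structure Adm (a b : WalkingAdj) (n m : ℕ) (φ : ℤ → ℤ) : Prop where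
  mono : Monotone φ
  -- The meaningful indices run from 0 to `n - 1`, preceded by -1 if `a = .one`, for the region left
  -- of every `f`. Elsewhere the map is normalised to be the identity on the left and a translation
  -- on the right, so that right whiskering leaves it unchanged and left whiskering conjugates it by
  -- a translation. The other conditions describe the outer regions: one of type 1 is preserved, and
  -- one of type 0 cannot be entered.
  neg : ∀ i : ℤ, i < 0 → φ i = i
  start : a = .zero → ∀ i : ℤ, 0 ≤ i → 0 ≤ φ i
  large : ∀ i : ℤ, n ≤ i → φ i = i - n + m
  small : b = .zero → ∀ i : ℤ, i < n → φ i < m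
  last : b = .one → φ (n - 1) = m - 1

namespace Adm

variable {a b d : WalkingAdj} {n m k l : ℕ} {φ ψ : ℤ → ℤ}

lemma id (a b : WalkingAdj) (n : ℕ) : Adm a b n n (fun i => i) where
  mono _ _ h := h
  neg _ _ := rfl
  start _ _ h := h
  large _ _ := by simp
  small _ _ h := h
  last _ := rfl

lemma lt (h : Adm a b n m φ) {i : ℤ} (hi : i < n) : φ i < m := by
  cases b with
  | zero => exact h.small rfl i hi
  | one =>
    have h₁ := h.last rfl
    have h₂ := h.mono (show i ≤ n - 1 by omega)
    omega

lemma ge (h : Adm a b n m φ) {i : ℤ} (hi : -1 ≤ i) : -1 ≤ φ i := by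
  have h₁ := h.mono hi
  have h₂ := h.neg (-1) (by omega)
  omega

lemma comp (h : Adm a b n m φ) (h' : Adm a b m k ψ) : Adm a b n k (fun i => ψ (φ i)) where
  mono := h'.mono.comp h.mono
  neg i hi := by rw [h.neg i hi, h'.neg i hi]
  start ha i hi := h'.start ha _ (h.start ha i hi)
  large i hi := by rw [h.large i hi, h'.large _ (by omega)]; omega
  small hb i hi := h'.small hb _ (h.small hb i hi)
  last hb := by rw [h.last hb, h'.last hb]

/-- If `a = .one`, the map may take the value -1 on nonnegative indices. The translation by `l` must
make this nonnegative when the new source is 0, and it does, because a 1-cell from 0 to 1 contains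
an `f`. -/
lemma whiskerLeft (h : Adm a b n m φ) (hl : d = .zero → a = .one → 1 ≤ l) :
    Adm d b (l + n) (l + m) (fun i => φ (i - l) + l) where
  mono i j hij := by
    have := h.mono (show i - l ≤ j - l by omega)
    simpa using this
  neg i hi := by rw [h.neg _ (by omega)]; omega
  start hd i hi := by
    by_cases hi' : i < l
    · rw [h.neg _ (by omega)]; omega
    · cases a with
      | zero =>
        have := h.start rfl (i - l) (by omega)
        omega
      | one =>
        have := h.ge (show -1 ≤ i - l by omega)
        have := hl hd rfl
        omega
  large i hi := by
    push_cast at hi ⊢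
    rw [h.large _ (by omega)]; omega
  small hb i hi := by
    push_cast at hi ⊢
    have := h.small hb (i - l) (by omega)
    omega
  last hb := by
    have := h.last hb
    push_cast
    rw [show (l + n - 1 - l : ℤ) = n - 1 by ring, this]; ring

lemma whiskerRight (h : Adm a b n m φ) (hl : b = .zero → d = .one → 1 ≤ l) :
    Adm a d (n + l) (m + l) φ where
  mono := h.mono
  neg := h.neg
  start := h.start
  large i hi := by
    push_cast at hi ⊢
    rw [h.large _ (by omega)]; omega
  small hb i hi := by
    push_cast at hi ⊢
    by_cases hi' : i < n
    · have := h.lt hi'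
      omega
    · rw [h.large _ (by omega)]; omega
  last hd := by
    push_cast
    by_cases hl' : 1 ≤ l
    · rw [h.large _ (by omega)]; omega
    · have hb : b = .one := by
        cases b with
        | zero => exact absurd (hl rfl hd) hl'
        | one => rfl
      have := h.last hb
      rw [show (n + l - 1 : ℤ) = n - 1 by omega, this]; omega

end Adm

lemma one_le_wt (p : Path .zero .one) : 1 ≤ wt p := by
  cases p with
  | cons p e => cases e; simp

lemma one_le_wt_of {a b : WalkingAdj} (p : Path a b) (ha : a = .zero) (hb : b = .one) :
    1 ≤ wt p := by
  subst ha hb; exact one_le_wt p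

/-- The map of the unit. -/
def unitFn (i : ℤ) : ℤ := if i < 0 then i else i + 1

/-- The map of the counit. -/
def counitFn (i : ℤ) : ℤ := if i < 0 then i else i - 1

/-- The map of a formal composite of 2-cells: the regions of type `1` in the domain and in the
codomain are numbered by the preceding occurrences of `f`. -/
def Cell.fn : ∀ {a b : WalkingAdj} {p q : Path a b}, Cell p q → ℤ → ℤ
  | _, _, _, _, .id _ => fun i => i
  | _, _, _, _, .vcomp x y => fun i => y.fn (x.fn i)
  | _, _, _, _, .whiskerLeft p x => fun i => x.fn (i - wt p) + wt p
  | _, _, _, _, .whiskerRight x _ => x.fn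
  | _, _, _, _, .unit => unitFn
  | _, _, _, _, .counit => counitFn

lemma Cell.fn_id {a b : WalkingAdj} (p : Path a b) : (Cell.id p).fn = fun i => i := by
  rw [Cell.fn]

lemma Cell.fn_ofEq {a b : WalkingAdj} {p q : Path a b} (h : p = q) :
    (Cell.ofEq h).fn = fun i => i := by
  subst h; exact Cell.fn_id p

lemma Cell.adm {a b : WalkingAdj} {p q : Path a b} (x : Cell p q) :
    Adm a b (wt p) (wt q) x.fn := by
  induction x with
  | id p => rw [Cell.fn]; exact Adm.id _ _ _
  | vcomp x y hx hy => rw [Cell.fn]; exact hx.comp hy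
  | whiskerLeft p x hx =>
    rw [Cell.fn, wt_pathComp, wt_pathComp]
    exact hx.whiskerLeft (one_le_wt_of p)
  | whiskerRight x r hx =>
    rw [Cell.fn, wt_pathComp, wt_pathComp]
    exact hx.whiskerRight (one_le_wt_of r)
  | unit =>
    rw [Cell.fn]
    refine ⟨fun i j h => ?_, fun i h => ?_, fun _ i h => ?_, fun i h => ?_, fun _ i h => ?_,
      by rintro ⟨⟩⟩ <;> simp [unitFn, wt, Gen.wt, Path.comp] at * <;> grind
  | counit =>
    rw [Cell.fn]
    refine ⟨fun i j h => ?_, fun i h => ?_, by rintro ⟨⟩, fun i h => ?_, by rintro ⟨⟩,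
      fun _ => ?_⟩ <;> simp [counitFn, wt, Gen.wt, Path.comp] at * <;> grind

/-- Indices below `n` belong to the left string and the others to the right one. If the middle
object is 1, the region at the junction is numbered `n - 1` from the left and -1 from the right;
when `ψ` reaches -1, the two sides agree because `φ` preserves its last region. -/
lemma Adm.exchange {a b d : WalkingAdj} {n m k l : ℕ} {φ ψ : ℤ → ℤ} (hφ : Adm a b n m φ)
    (hψ : Adm b d k l ψ) (i : ℤ) : φ (ψ (i - n) + n) = ψ (φ i - m) + m := by
  by_cases hi : i < n
  · rw [hψ.neg _ (by omega), hψ.neg _ (by have := hφ.lt hi; omega)]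
    simp
  · rw [hφ.large i (by omega)]
    have h : 0 ≤ ψ (i - n) ∨ (b = .one ∧ -1 ≤ ψ (i - n)) := by
      cases b with
      | zero => exact Or.inl (hψ.start rfl _ (by omega))
      | one => exact Or.inr ⟨rfl, hψ.ge (by omega)⟩
    rw [show i - n + m - m = i - n by ring]
    by_cases h' : 0 ≤ ψ (i - n)
    · rw [hφ.large _ (by omega)]; ring
    · obtain ⟨hb, h⟩ := h.resolve_left h'
      have e : ψ (i - n) = -1 := by omega
      rw [e, show (-1 + n : ℤ) = n - 1 by ring, hφ.last hb]; ring

lemma Cell.fn_rel {a b : WalkingAdj} {p q : Path a b} {x y : Cell p q} (h : Rel x y) :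
    x.fn = y.fn := by
  induction h with
  | refl x => rfl
  | symm _ ih => exact ih.symm
  | trans _ _ ih ih' => exact ih.trans ih'
  | vcomp_congr _ _ ih ih' => simp only [Cell.fn, ih, ih']
  | whiskerLeft_congr p _ ih => simp only [Cell.fn, ih]
  | whiskerRight_congr r _ ih => simp only [Cell.fn, ih]
  | whisker_exchange x y =>
    ext i
    simp only [Cell.fn]
    exact x.adm.exchange y.adm i
  | left_triangle =>
    ext i
    simp [Cell.fn, unitFn, counitFn, wt, Gen.wt]
    grind
  | right_triangle =>
    ext i
    simp [Cell.fn, unitFn, counitFn, wt, Gen.wt]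
    grind
  | comp_whiskerLeft p q x =>
    ext i
    simp only [Cell.fn, Cell.fn_ofEq, wt_pathComp]
    push_cast
    rw [show i - (wt p + wt q : ℤ) = i - wt p - wt q by ring]; ring
  | whiskerRight_nil x =>
    rw [Cell.fn]
    rfl
  | _ => simp [Cell.fn, Cell.fn_ofEq]

/-- The map of a 2-cell. -/
def fn {a b : WalkingAdj} {p q : a ⟶ b} : (p ⟶ q) → ℤ → ℤ :=
  Quotient.lift Cell.fn (fun _ _ h => Cell.fn_rel h)

lemma adm {a b : WalkingAdj} {p q : a ⟶ b} (x : p ⟶ q) : Adm a b (wt p) (wt q) (fn x) :=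
  Quotient.inductionOn x Cell.adm

lemma fn_id {a b : WalkingAdj} (p : a ⟶ b) : fn (𝟙 p) = fun i => i := Cell.fn_id p

lemma fn_eqToHom {a b : WalkingAdj} {p q : a ⟶ b} (h : p = q) : fn (eqToHom h) = fun i => i := by
  subst h; exact fn_id p

lemma fn_comp {a b : WalkingAdj} {p q r : a ⟶ b} (x : p ⟶ q) (y : q ⟶ r) :
    fn (x ≫ y) = fun i => fn y (fn x i) := by
  revert x y
  rintro ⟨x⟩ ⟨y⟩
  change (Cell.vcomp x y).fn = _
  rw [Cell.fn]
  rfl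

lemma fn_whiskerLeft {a b d : WalkingAdj} (p : a ⟶ b) {q r : b ⟶ d} (x : q ⟶ r) :
    fn (p ◁ x) = fun i => fn x (i - wt p) + wt p := by
  revert x
  rintro ⟨x⟩
  change (Cell.whiskerLeft p x).fn = _
  rw [Cell.fn]
  rfl

lemma fn_whiskerRight {a b d : WalkingAdj} {p q : a ⟶ b} (x : p ⟶ q) (r : b ⟶ d) :
    fn (x ▷ r) = fn x := by
  revert x
  rintro ⟨x⟩
  change (Cell.whiskerRight x r).fn = _
  rw [Cell.fn]
  rfl

end WalkingAdj

namespace WalkingAdj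

open Bicategory

/-! ### The endo-1-cells of `0` -/

/-- The powers of the monad `f ≫ g`. -/
def pow : ℕ → (WalkingAdj.zero ⟶ WalkingAdj.zero)
  | 0 => 𝟙 _
  | n + 1 => pow n ≫ (f ≫ g)

@[simp]
lemma wt_pow (n : ℕ) : wt (pow n) = n := by
  induction n with
  | zero => rfl
  | succ n ih => simp [pow, ih]

/-- The letters alternate, so the only constraint on the number of `f` is that a 1-cell from 0 to 1
contains at least one. -/
lemma exists_wt : ∀ (a b : WalkingAdj) (n : ℕ), (a = .zero → b = .one → 1 ≤ n) →
    ∃ p : a ⟶ b, wt p = n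
  | .zero, .zero, n, _ => ⟨pow n, by simp⟩
  | .zero, .one, n, h => ⟨pow (n - 1) ≫ f, by have := h rfl rfl; simp; omega⟩
  | .one, .zero, n, _ => ⟨g ≫ pow n, by simp⟩
  | .one, .one, 0, _ => ⟨𝟙 _, by simp⟩
  | .one, .one, n + 1, _ => ⟨g ≫ pow n ≫ f, by simp⟩

/-- A 1-cell whose number of occurrences of `f` is large enough is divisible on the left. -/
lemma exists_left_factor {a b d : WalkingAdj} (p : a ⟶ d) (q : a ⟶ b) (h : wt q ≤ wt p)
    (h' : b = .zero → d = .one → wt q + 1 ≤ wt p) : ∃ r : b ⟶ d, p = q ≫ r := by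
  obtain ⟨r, hr⟩ := exists_wt b d (wt p - wt q) (fun hb hd => by have := h' hb hd; omega)
  exact ⟨r, path_ext (by rw [wt_comp]; omega)⟩

/-- A 1-cell whose number of occurrences of `f` is large enough is divisible on the right. -/
lemma exists_right_factor {a b d : WalkingAdj} (p : a ⟶ d) (q : b ⟶ d) (h : wt q ≤ wt p)
    (h' : a = .zero → b = .one → wt q + 1 ≤ wt p) : ∃ r : a ⟶ b, p = r ≫ q := by
  obtain ⟨r, hr⟩ := exists_wt a b (wt p - wt q) (fun hb hd => by have := h' hb hd; omega)
  exact ⟨r, path_ext (by rw [wt_comp]; omega)⟩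

/-! ### Splitting of 2-cells and comparison with monotone maps of finite ordinals. -/

/-- A 2-cell splits along a decomposition of its codomain. -/
def Splits {p r : WalkingAdj.zero ⟶ WalkingAdj.zero} (x : p ⟶ r) : Prop :=
  ∀ (q q' : WalkingAdj.zero ⟶ WalkingAdj.zero) (e : r = q ≫ q'),
    ∃ (p₁ p₂ : WalkingAdj.zero ⟶ WalkingAdj.zero) (e' : p = p₁ ≫ p₂) (x₁ : p₁ ⟶ q) (x₂ : p₂ ⟶ q'),
      x ≫ eqToHom e = eqToHom e' ≫ x₁ ▷ p₂ ≫ q ◁ x₂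

/-- The alternatives are the positions of the cut: inside `l`, or behind the codomain `s'` of the
generator. Either way the generator lies entirely in one factor, and the other factor is an
identity. -/
lemma Splits.whisker {b d : WalkingAdj} {l : .zero ⟶ b} {s s' : b ⟶ d} {r : d ⟶ .zero} (x : s ⟶ s')
    (h : ∀ q : WalkingAdj.zero ⟶ WalkingAdj.zero, (∃ k, l = q ≫ k) ∨ ∃ k, q = (l ≫ s') ≫ k ∧
      ∀ q', l ≫ s' ≫ r = q ≫ q' → r = k ≫ q') :
    Splits (l ◁ (x ▷ r)) := by
  intro q q' e
  obtain ⟨k, rfl⟩ | ⟨k, rfl, hk⟩ := h q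
  · have e' : q' = k ≫ (s' ≫ r) := path_ext (by
      have := congrArg wt e
      simp only [wt_comp] at this ⊢
      omega)
    subst e'
    refine ⟨q, k ≫ (s ≫ r), Strict.assoc _ _ _, 𝟙 q, k ◁ (x ▷ r), ?_⟩
    have h := comp_whiskerLeft q k (x ▷ r)
    rw [h, associator_inv, associator_hom]
    simp
  · have e' := hk q' e
    subst e'
    refine ⟨l ≫ s ≫ k, q', ?_, l ◁ (x ▷ k) ≫ (α_ _ _ _).inv, 𝟙 q', ?_⟩
    · simp only [Strict.assoc]
    · have h : l ◁ (x ▷ (k ≫ q')) = (l ◁ (α_ _ _ _).inv ≫ (α_ _ _ _).inv) ≫ (l ◁ (x ▷ k)) ▷ q' ≫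
          (α_ _ _ _).hom ≫ l ◁ (α_ _ _ _).hom := by
        simp
      rw [h]
      simp only [associator_hom, associator_inv, whiskerLeft_eqToHom, eqToHom_whiskerRight,
        comp_whiskerRight, whiskerLeft_id, Category.assoc, eqToHom_trans,
        Category.comp_id]

/-- Every 2-cell between endo-1-cells of `0` splits along a decomposition of its codomain into
endo-1-cells of `0`. -/
theorem splits {p r : WalkingAdj.zero ⟶ WalkingAdj.zero} (x : p ⟶ r) : Splits x := by
  refine hom_induction (fun {p r : WalkingAdj.zero ⟶ WalkingAdj.zero} x => Splits x) ?_ ?_ ?_ ?_ x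
  · rintro p r rfl q q' rfl
    exact ⟨q, q', rfl, 𝟙 q, 𝟙 q', by simp⟩
  · intro p r s x y hx hy q q' e
    obtain ⟨r₁, r₂, e₁, y₁, y₂, hy⟩ := hy q q' e
    obtain ⟨p₁, p₂, e₂, x₁, x₂, hx⟩ := hx r₁ r₂ e₁
    refine ⟨p₁, p₂, e₂, x₁ ≫ y₁, x₂ ≫ y₂, ?_⟩
    rw [Category.assoc, hy, reassoc_of% hx, comp_whiskerRight, whiskerLeft_comp,
      whisker_exchange_assoc, Category.assoc]
  · intro l r
    refine Splits.whisker u (fun q => ?_)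
    -- The cut lies at a region of type 0, so it cannot separate the new `f` from the new `g`.
    by_cases h : wt q ≤ wt l
    · exact Or.inl (exists_left_factor l q h (by rintro - ⟨⟩))
    · obtain ⟨k, hk⟩ := exists_left_factor q (l ≫ (f ≫ g)) (by simp; omega) (by rintro - ⟨⟩)
      refine Or.inr ⟨k, hk, fun q' e => path_ext ?_⟩
      subst hk
      have := congrArg wt e
      simp only [wt_comp] at this ⊢
      omega
  · intro l r
    refine Splits.whisker c (fun q => ?_)
    -- Here `l` ends at 1, so its quotient by `q` is a 1-cell from 0 to 1 and needs an `f` of its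
    -- own; hence the strict inequality.
    by_cases h : wt q + 1 ≤ wt l
    · exact Or.inl (exists_left_factor l q (by omega) (fun _ _ => h))
    · obtain ⟨k, hk⟩ := exists_left_factor q (l ≫ 𝟙 _) (by simp; omega) (by rintro ⟨⟩)
      refine Or.inr ⟨k, hk, fun q' e => path_ext ?_⟩
      subst hk
      have := congrArg wt e
      simp only [wt_comp] at this ⊢
      omega

lemma fn_split {p q p' q' : WalkingAdj.zero ⟶ WalkingAdj.zero} (x : p ⟶ q) (y : p' ⟶ q') (i : ℤ) :
    fn (x ▷ p' ≫ q ◁ y) i = if i < wt p then fn x i else fn y (i - wt p) + wt q := by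
  rw [fn_comp, fn_whiskerRight, fn_whiskerLeft]
  beta_reduce
  split_ifs with h
  · rw [(adm y).neg _ (by have := (adm x).lt h; omega)]; ring
  · rw [(adm x).large _ (by omega)]; simp

/-- A 2-cell between endo-1-cells of `0` is determined by its map. -/
theorem cell_ext {p q : WalkingAdj.zero ⟶ WalkingAdj.zero} (x y : p ⟶ q)
    (h : ∀ i : ℤ, 0 ≤ i → i < wt p → fn x i = fn y i) : x = y := by
  have key (m : ℕ) : ∀ {p : WalkingAdj.zero ⟶ WalkingAdj.zero} (x y : p ⟶ pow m),
      (∀ i : ℤ, 0 ≤ i → i < wt p → fn x i = fn y i) → x = y := by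
    induction m with
    | zero =>
      intro p x y _
      have hp : wt p = 0 := by
        by_contra hp
        have h₁ := (adm x).start rfl 0 le_rfl
        have h₂ := (adm x).lt (i := 0) (by omega)
        simp at h₂
        omega
      obtain rfl : p = 𝟙 _ := path_ext hp
      exact hom_id_ext x y
    | succ m ih =>
      intro p x y h
      change p ⟶ pow m ≫ (f ≫ g) at x y
      change ∀ i : ℤ, 0 ≤ i → i < wt p → fn x i = fn y i at h
      change x = y
      obtain ⟨p₁, p₂, e, x₁, x₂, hx⟩ := splits x (pow m) (f ≫ g) rfl
      subst e
      obtain ⟨p₁', p₂', e, y₁, y₂, hy⟩ := splits y (pow m) (f ≫ g) rfl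
      simp only [eqToHom_refl, Category.comp_id, Category.id_comp] at hx hy
      have hx' (i : ℤ) : fn x i = if i < wt p₁ then fn x₁ i else fn x₂ (i - wt p₁) + m := by
        rw [hx]; exact (fn_split x₁ x₂ i).trans (by simp)
      have hy' (i : ℤ) : fn y i = if i < wt p₁' then fn y₁ i else fn y₂ (i - wt p₁') + m := by
        rw [hy, fn_comp, fn_eqToHom]; exact (fn_split y₁ y₂ i).trans (by simp)
      have he := congrArg wt e
      simp only [wt_comp] at he
      -- The first factor of the domain consists of the indices with value below `m`, so its length
      -- is determined by the map. After that, the first components agree by induction and the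
      -- second ones because the monad is terminal.
      have h₁ : wt p₁ = wt p₁' := by
        by_contra hne
        rcases Nat.lt_or_gt_of_ne hne with hlt | hlt
        · have h₁ := h (wt p₁) (by omega) (by simp; omega)
          rw [hx', hy', if_neg (by omega), if_pos (by omega)] at h₁
          have h₂ := (adm y₁).lt (i := wt p₁) (by omega)
          have h₃ := (adm x₂).start rfl (wt p₁ - wt p₁) (by omega)
          simp at h₂
          omega
        · have h₁ := h (wt p₁') (by omega) (by simp; omega)
          rw [hx', hy', if_pos (by omega), if_neg (by omega)] at h₁
          have h₂ := (adm x₁).lt (i := wt p₁') (by omega)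
          have h₃ := (adm y₂).start rfl (wt p₁' - wt p₁') (by omega)
          simp at h₂
          omega
      obtain rfl : p₁ = p₁' := path_ext h₁
      obtain rfl : p₂ = p₂' := path_ext (by omega)
      have h₂ : x₁ = y₁ := ih x₁ y₁ (fun i hi hi' => by
        have := h i hi (by simp; omega)
        rwa [hx', hy', if_pos hi', if_pos hi'] at this)
      rw [hx, hy, h₂, hom_monad_ext x₂ y₂]
      simp
  obtain ⟨m, rfl⟩ : ∃ m, q = pow m := ⟨wt q, path_ext (by simp)⟩
  exact key _ x y h

/-- Every monotone map between finite ordinals is the map of a 2-cell. -/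
theorem exists_cell (p q : WalkingAdj.zero ⟶ WalkingAdj.zero) (φ : ℤ → ℤ) (hφ : Monotone φ)
    (h : ∀ i : ℤ, 0 ≤ i → i < wt p → 0 ≤ φ i ∧ φ i < wt q) :
    ∃ x : p ⟶ q, ∀ i : ℤ, 0 ≤ i → i < wt p → fn x i = φ i := by
  have key (m : ℕ) : ∀ n : ℕ, (∀ i : ℤ, 0 ≤ i → i < n → 0 ≤ φ i ∧ φ i < m) →
      ∃ x : pow n ⟶ pow m, ∀ i : ℤ, 0 ≤ i → i < n → fn x i = φ i := by
    induction m with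
    | zero =>
      intro n h
      obtain rfl : n = 0 := by
        by_contra hn
        have := h 0 le_rfl (by omega)
        omega
      exact ⟨𝟙 _, fun i hi hi' => by omega⟩
    | succ m ih =>
      intro n h
      -- `j` counts the indices with value below the top value `m`. The remaining ones form the
      -- fibre over `m`, which the canonical 2-cell to the monad collapses.
      obtain ⟨j, hj, hj₁, hj₂⟩ : ∃ j : ℕ, j ≤ n ∧ (∀ i : ℤ, 0 ≤ i → i < j → φ i < m) ∧
          ∀ i : ℤ, j ≤ i → i < n → φ i = m := by
        clear ih
        induction n with
        | zero => exact ⟨0, le_rfl, fun i hi hi' => by omega, fun i hi hi' => by omega⟩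
        | succ n ih =>
          obtain ⟨j, hj, hj₁, hj₂⟩ := ih (fun i hi hi' => h i hi (by push_cast; omega))
          have hn := h n (by omega) (by push_cast; omega)
          push_cast at hn
          by_cases hm : φ n < m
          · refine ⟨n + 1, le_rfl, fun i hi hi' => ?_, fun i hi hi' => by omega⟩
            exact lt_of_le_of_lt (hφ (by push_cast at hi'; omega)) hm
          · refine ⟨j, by omega, hj₁, fun i hi hi' => ?_⟩
            by_cases hi'' : i < n
            · exact hj₂ i hi hi''
            · obtain rfl : i = n := by push_cast at hi'; omega
              omega
      obtain ⟨x, hx⟩ := ih j (fun i hi hi' => ⟨(h i hi (by omega)).1, hj₁ i hi hi'⟩)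
      have e : pow n = pow j ≫ pow (n - j) := path_ext (by simp; omega)
      refine ⟨eqToHom e ≫ x ▷ _ ≫ pow m ◁ toMonad (pow (n - j)), fun i hi hi' => ?_⟩
      have h₁ := fn_split x (toMonad (pow (n - j))) i
      rw [fn_comp, fn_eqToHom]
      refine h₁.trans ?_
      simp only [wt_pow]
      split_ifs with hij
      · exact hx i hi hij
      · rw [hj₂ i (by omega) hi']
        have h₂ := (adm (toMonad (pow (n - j)))).lt (i := i - j) (by simp; omega)
        have h₃ := (adm (toMonad (pow (n - j)))).start rfl (i - j) (by omega)
        simp at h₂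
        omega
  obtain ⟨x, hx⟩ := key (wt q) (wt p) h
  have e₁ : p = pow (wt p) := path_ext (by simp)
  have e₂ : pow (wt q) = q := path_ext (by simp)
  exact ⟨eqToHom e₁ ≫ x ≫ eqToHom e₂, fun i hi hi' => by
    rw [fn_comp, fn_comp, fn_eqToHom, fn_eqToHom]; exact hx i hi hi'⟩

end WalkingAdj

namespace WalkingAdj

open Bicategory BiHH

/-! ### The functor to the paracyclic category -/

/-- The functor from the paracyclic category to its extension by an initial and a terminal
object. -/
abbrev paracyclicIncl : Paracyclic ⥤ WithTerminal (WithInitial Paracyclic) :=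
  WithInitial.incl ⋙ WithTerminal.incl

/-- The object of the extended paracyclic category given by an endo-1-cell of an object of the
walking adjunction in which `f` occurs `n` times. -/
def cycObj (X : WalkingAdj) : ℕ → WithTerminal (WithInitial Paracyclic)
  | 0 => match X with
    | .zero => WithTerminal.of WithInitial.star
    | .one => WithTerminal.star
  | n + 1 => paracyclicIncl.obj ⟨n⟩

/-- The adjoined initial object is initial. -/
def isInitialCycObj : Limits.IsInitial (cycObj .zero 0) :=
  Limits.IsInitial.ofUniqueHom
    (fun x => match x with
      | .of .star => 𝟙 (WithTerminal.of WithInitial.star : WithTerminal (WithInitial Paracyclic))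
      | .of (.of _) => PUnit.unit
      | .star => PUnit.unit)
    (fun x _ => match x with
      | .of .star => rfl
      | .of (.of _) => rfl
      | .star => rfl)

/-- The adjoined terminal object is terminal. -/
def isTerminalCycObj : Limits.IsTerminal (cycObj .one 0) := WithTerminal.starTerminal

lemma isEmpty_hom_initial (n : ℕ) (X : WalkingAdj) :
    IsEmpty (cycObj X (n + 1) ⟶ cycObj .zero 0) := ⟨fun x => PEmpty.elim x⟩

lemma isEmpty_terminal_hom (n : ℕ) (X : WalkingAdj) :
    IsEmpty (cycObj .one 0 ⟶ cycObj X (n + 1)) := ⟨fun x => PEmpty.elim x⟩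

lemma isEmpty_terminal_initial :
    IsEmpty (cycObj .one 0 ⟶ cycObj .zero 0) := ⟨fun x => PEmpty.elim x⟩

lemma subsingleton_hom (X Y : WalkingAdj) (n m : ℕ) (h : n = 0 ∨ m = 0) :
    Subsingleton (cycObj X n ⟶ cycObj Y m) := by
  cases Y with
  | one =>
    cases m with
    | zero => exact ⟨fun _ _ => isTerminalCycObj.hom_ext _ _⟩
    | succ m =>
      obtain rfl : n = 0 := by omega
      cases X with
      | zero => exact ⟨fun _ _ => isInitialCycObj.hom_ext _ _⟩
      | one =>
        have := isEmpty_terminal_hom m .one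
        infer_instance
  | zero =>
    cases n with
    | zero =>
      cases X with
      | zero => exact ⟨fun _ _ => isInitialCycObj.hom_ext _ _⟩
      | one =>
        cases m with
        | zero =>
          have := isEmpty_terminal_initial
          infer_instance
        | succ m =>
          have := isEmpty_terminal_hom m .zero
          infer_instance
    | succ n =>
      obtain rfl : m = 0 := by omega
      have := isEmpty_hom_initial n X
      infer_instance

/-- The maps which give morphisms of the extended paracyclic category. -/
structure Per (X Y : WalkingAdj) (n m : ℕ) (h : ℤ → ℤ) : Prop where
  -- An object of weight 0 is the initial or the terminal one, according to its vertex. The first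
  -- two conditions ensure that a morphism exists when a weight vanishes; `h` matters only when both
  -- weights are positive.
  source : n = 0 → X = .zero ∨ (Y = .one ∧ m = 0)
  target : m = 0 → Y = .one ∨ (X = .zero ∧ n = 0)
  mono : 1 ≤ n → 1 ≤ m → Monotone h
  shift : 1 ≤ n → 1 ≤ m → ∀ i, h (i + n) = h i + m

namespace Per

variable {X Y Z : WalkingAdj} {n m k : ℕ} {h h' : ℤ → ℤ}

/-- A composite between paracyclic objects cannot pass through an adjoined one: nothing nontrivial
maps to the initial object, and the terminal one maps to nothing nontrivial. -/
lemma middle (p : Per X Y n m h) (p' : Per Y Z m k h') (hn : 1 ≤ n) (hk : 1 ≤ k) : 1 ≤ m := by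
  by_contra hm
  obtain rfl : m = 0 := by omega
  have h₁ := p.target rfl
  have h₂ := p'.source rfl
  grind

lemma comp (p : Per X Y n m h) (p' : Per Y Z m k h') : Per X Z n k (fun i => h' (h i)) where
  source hn := by
    have h₁ := p.source hn
    have h₂ := p'.source
    grind
  target hk := by
    have h₁ := p'.target hk
    have h₂ := p.target
    grind
  mono hn hk := by
    have hm := p.middle p' hn hk
    exact (p'.mono hm hk).comp (p.mono hn hm)
  shift hn hk i := by
    have hm := p.middle p' hn hk
    rw [p.shift hn hm, p'.shift hm hk]

lemma nonempty_hom (p : Per X Y n m h) (h : n = 0 ∨ m = 0) :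
    Nonempty (cycObj X n ⟶ cycObj Y m) := by
  have h₁ := p.source
  have h₂ := p.target
  by_cases hn : n = 0
  · subst hn
    obtain rfl | ⟨rfl, rfl⟩ := h₁ rfl
    · exact ⟨isInitialCycObj.to _⟩
    · exact ⟨isTerminalCycObj.from _⟩
  · obtain rfl : m = 0 := h.resolve_left hn
    obtain rfl | ⟨-, h⟩ := h₂ rfl
    · exact ⟨isTerminalCycObj.from _⟩
    · exact absurd h hn

/-- The morphism of the extended paracyclic category given by a periodic monotone map. -/
noncomputable def hom : ∀ {n m : ℕ} (_ : Per X Y n m h), cycObj X n ⟶ cycObj Y m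
  -- Hom-sets in which a weight vanishes are subsingletons, so the choice is immaterial.
  | 0, _, p => Classical.choice (p.nonempty_hom (Or.inl rfl))
  | _, 0, p => Classical.choice (p.nonempty_hom (Or.inr rfl))
  | n + 1, m + 1, p => paracyclicIncl.map (X := ⟨n⟩) (Y := ⟨m⟩)
      ⟨h, p.mono (by omega) (by omega), fun l => by simpa using p.shift (by omega) (by omega) l⟩

lemma hom_comp (p : Per X Y n m h) (p' : Per Y Z m k h') : p.hom ≫ p'.hom = (p.comp p').hom := by
  have := subsingleton_hom X Z n k
  obtain _ | n := n
  · have := this (Or.inl rfl)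
    exact Subsingleton.elim _ _
  obtain _ | k := k
  · have := this (Or.inr rfl)
    exact Subsingleton.elim _ _
  obtain _ | m := m
  · exact absurd (p.middle p' (by omega) (by omega)) (by omega)
  · exact (paracyclicIncl.map_comp _ _).symm

lemma hom_congr (p : Per X Y n m h) (p' : Per X Y n m h') (e : 1 ≤ n → 1 ≤ m → ∀ i, h i = h' i) :
    p.hom = p'.hom := by
  have := subsingleton_hom X Y n m
  obtain _ | n := n
  · have := this (Or.inl rfl)
    exact Subsingleton.elim _ _
  obtain _ | m := m
  · have := this (Or.inr rfl)
    exact Subsingleton.elim _ _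
  · obtain rfl : h = h' := funext (e (by omega) (by omega))
    rfl

lemma hom_eq_id (p : Per X X n n h) (e : 1 ≤ n → ∀ i, h i = i) : p.hom = 𝟙 _ := by
  have := subsingleton_hom X X n n
  obtain _ | n := n
  · have := this (Or.inl rfl)
    exact Subsingleton.elim _ _
  · obtain rfl : h = fun i => i := funext (e (by omega))
    exact paracyclicIncl.map_id _

end Per

/-! ### Periodic extensions of maps of finite ordinals. -/

lemma shift_mul {n m : ℕ} {h : ℤ → ℤ} (hs : ∀ i, h (i + n) = h i + m) (i k : ℤ) :
    h (i + n * k) = h i + m * k := by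
  induction k using Int.induction_on with
  | zero => simp
  | succ k ih => rw [mul_add, ← add_assoc, mul_one, hs, ih]; ring
  | pred k ih =>
    have := hs (i + n * (-k - 1))
    rw [show i + n * (-k - 1 : ℤ) + n = i + n * (-k : ℤ) by ring, ih] at this
    linarith

lemma periodic_ext {n m : ℕ} (hn : 1 ≤ n) {h h' : ℤ → ℤ} (hs : ∀ i, h (i + n) = h i + m)
    (hs' : ∀ i, h' (i + n) = h' i + m) (e : ∀ i : ℤ, 0 ≤ i → i < n → h i = h' i) (i : ℤ) :
    h i = h' i := by
  rw [← Int.emod_add_mul_ediv i n, shift_mul hs, shift_mul hs',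
    e _ (Int.emod_nonneg _ (by omega)) (Int.emod_lt_of_pos _ (by omega))]

/-- The periodic extension of a map of finite ordinals. -/
def close (n m : ℕ) (φ : ℤ → ℤ) (i : ℤ) : ℤ := φ (i % n) + m * (i / n)

lemma close_shift {n m : ℕ} (hn : 1 ≤ n) (φ : ℤ → ℤ) (i : ℤ) :
    close n m φ (i + n) = close n m φ i + m := by
  unfold close
  rw [Int.add_emod_right, Int.add_ediv_of_dvd_right (dvd_refl _), Int.ediv_self (by omega)]
  ring

lemma close_of_lt {n m : ℕ} (φ : ℤ → ℤ) {i : ℤ} (h : 0 ≤ i) (h' : i < n) :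
    close n m φ i = φ i := by
  unfold close
  rw [Int.emod_eq_of_lt h h', Int.ediv_eq_zero_of_lt h h']
  ring

namespace Adm

variable {X : WalkingAdj} {n m k : ℕ} {φ ψ : ℤ → ℤ}

/-- For `X = .one` the indices -1 and `n - 1` are the two outer regions, which become one when the
string is closed up. Since both are preserved, the periodic extension has the correct value at -1.
-/
lemma close_eq (p : Adm X X n m φ) (hn : 1 ≤ n) {i : ℤ} (h : 0 ≤ i ∨ (X = .one ∧ -1 ≤ i))
    (h' : i < n) : close n m φ i = φ i := by
  by_cases hi : 0 ≤ i
  · exact close_of_lt φ hi h'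
  · obtain ⟨hX, h⟩ := h.resolve_left hi
    obtain rfl : i = -1 := by omega
    have h₁ := close_shift (m := m) hn φ (-1)
    rw [close_of_lt φ (by omega) (by omega), show (-1 + n : ℤ) = n - 1 by ring, p.last hX] at h₁
    rw [p.neg (-1) (by omega)]
    omega

lemma range (p : Adm X X n m φ) {i : ℤ} (hi : 0 ≤ i) : 0 ≤ φ i ∨ (X = .one ∧ -1 ≤ φ i) := by
  cases X with
  | zero => exact Or.inl (p.start rfl i hi)
  | one => exact Or.inr ⟨rfl, p.ge (by omega)⟩

lemma per (p : Adm X X n m φ) : Per X X n m (close n m φ) where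
  source hn := by
    subst hn
    cases X with
    | zero => exact Or.inl rfl
    | one =>
      have h₁ := p.last rfl
      have h₂ := p.neg (-1) (by omega)
      simp at h₁
      exact Or.inr ⟨rfl, by omega⟩
  target hm := by
    subst hm
    cases X with
    | zero =>
      refine Or.inr ⟨rfl, ?_⟩
      by_contra hn
      have h₁ := p.start rfl 0 le_rfl
      have h₂ := p.lt (i := 0) (by omega)
      simp at h₂
      omega
    | one => exact Or.inl rfl
  mono hn _ := by
    refine monotone_int_of_le_succ (fun i => ?_)
    have h₁ := Int.emod_nonneg i (show (n : ℤ) ≠ 0 by omega)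
    have h₂ := Int.emod_lt_of_pos i (show 0 < (n : ℤ) by omega)
    have h₃ := Int.emod_add_mul_ediv i n
    rw [← h₃, show i % n + n * (i / n) + 1 = (i % n + 1) + n * (i / n) by ring,
      shift_mul (close_shift hn φ), shift_mul (close_shift hn φ), close_of_lt _ h₁ h₂]
    by_cases h : i % n + 1 < n
    · rw [close_of_lt _ (by omega) h]
      have := p.mono (show i % n ≤ i % n + 1 by omega)
      linarith
    · have e : i % n + 1 = 0 + n := by omega
      rw [e, close_shift hn, close_of_lt _ le_rfl (by omega)]
      -- Here `i % n` is `n - 1`: this is monotonicity across the seam between two periods.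
      have h₄ : φ (i % n) ≤ φ 0 + m := by
        cases X with
        | zero =>
          have := p.start rfl 0 le_rfl
          have := p.lt h₂
          omega
        | one =>
          have h₅ := p.last rfl
          rw [show (n : ℤ) - 1 = i % n by omega] at h₅
          have := p.ge (i := 0) (by omega)
          omega
      linarith
  shift hn _ := close_shift hn φ

/-- Compare on one period. For `X = .one` the inner map may leave the period through -1, which
`close_eq` allows. -/
lemma close_comp (p : Adm X X n m φ) (q : Adm X X m k ψ) (hn : 1 ≤ n) (hm : 1 ≤ m) (i : ℤ) :
    close m k ψ (close n m φ i) = close n k (fun i => ψ (φ i)) i := by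
  refine periodic_ext hn (m := k) (h := fun i => close m k ψ (close n m φ i)) ?_ ?_ ?_ i
  · intro i
    rw [close_shift hn, close_shift hm]
  · exact close_shift hn _
  · intro i hi hi'
    rw [close_of_lt _ hi hi', close_of_lt _ hi hi', q.close_eq hm (p.range hi) (p.lt hi')]

end Adm

lemma close_fn_eqToHom {X : WalkingAdj} {p q : X ⟶ X} (h : p = q) (i : ℤ) :
    close (wt p) (wt q) (fn (eqToHom h)) i = i := by
  subst h
  rw [eqToHom_refl, fn_id]
  exact Int.emod_add_mul_ediv i _

/-- Putting `G` in front raises the index of each `f` of `F` by the weight of `G`. The same shift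
carries each `f` of `G` to its new place one period later, so full rotations are remembered. -/
lemma per_shift {X Y : WalkingAdj} (F : X ⟶ Y) (G : Y ⟶ X) :
    Per X Y (wt (F ≫ G)) (wt (G ≫ F)) (fun i => i + wt G) where
  source h := by
    rw [wt_comp] at h
    cases X
    · exact Or.inl rfl
    · cases Y
      · have := one_le_wt_of G rfl rfl
        omega
      · exact Or.inr ⟨rfl, by rw [wt_comp]; omega⟩
  target h := by
    rw [wt_comp] at h
    cases Y
    · cases X
      · exact Or.inr ⟨rfl, by rw [wt_comp]; omega⟩
      · have := one_le_wt_of G rfl rfl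
        omega
    · exact Or.inl rfl
  mono _ _ i j h := by simpa using h
  shift _ _ i := by simp only [wt_comp]; push_cast; ring

lemma per_unshift {X Y : WalkingAdj} (F : X ⟶ Y) (G : Y ⟶ X) :
    Per Y X (wt (G ≫ F)) (wt (F ≫ G)) (fun i => i - wt G) where
  source := (per_shift G F).source
  target := (per_shift G F).target
  mono _ _ i j h := by simpa using h
  shift _ _ i := by simp only [wt_comp]; push_cast; ring

/-- The trace on the walking adjunction with values in the extended paracyclic category. -/
noncomputable def paracyclicTrace :
    Trace WalkingAdj (WithTerminal (WithInitial Paracyclic)) where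
  obj {X} p := cycObj X (wt p)
  map x := (adm x).per.hom
  map_id p := Per.hom_eq_id _ (fun _ i => close_fn_eqToHom rfl i)
  map_comp {X p q r} x y := by
    rw [Per.hom_comp]
    refine Per.hom_congr _ _ (fun hn hk i => ?_)
    have hm : 1 ≤ wt q := (adm x).per.middle (adm y).per hn hk
    rw [(adm x).close_comp (adm y) hn hm, fn_comp]
  tr F G :=
    { hom := (per_shift F G).hom
      inv := (per_unshift F G).hom
      hom_inv_id := by
        rw [Per.hom_comp]
        exact Per.hom_eq_id _ (fun _ i => by ring)
      inv_hom_id := by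
        rw [Per.hom_comp]
        exact Per.hom_eq_id _ (fun _ i => by ring) }
  tr_nat {X Y F F' G G'} a b := by
    dsimp only
    rw [Per.hom_comp, Per.hom_comp]
    refine Per.hom_congr _ _ (fun hn hm i => ?_)
    have hn' : 1 ≤ wt (G ≫ F) := by rw [wt_comp] at hn ⊢; omega
    refine periodic_ext hn (m := wt (G' ≫ F'))
      (h := fun i => close _ _ (fn (a ▷ G ≫ F' ◁ b)) i + wt G')
      (h' := fun i => close _ _ (fn (b ▷ F ≫ G' ◁ a)) (i + wt G)) ?_ ?_ ?_ i
    · intro i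
      rw [close_shift hn]
      simp only [wt_comp]
      push_cast
      ring
    · intro i
      rw [← close_shift hn']
      congr 1
      simp only [wt_comp]
      push_cast
      ring
    · intro i hi hi'
      rw [close_of_lt _ hi hi', fn_comp, fn_comp, fn_whiskerLeft, fn_whiskerRight, fn_whiskerLeft,
        fn_whiskerRight]
      rw [wt_comp] at hi'
      push_cast at hi'
      -- Below `wt F` the index belongs to `F` and only `a` acts on it. Above, only `b` acts, and
      -- the rotated index lies in the next period.
      by_cases h : i < wt F
      · rw [close_of_lt _ (by omega) (by rw [wt_comp]; push_cast; omega)]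
        have h₁ := (adm a).lt h
        beta_reduce
        rw [(adm b).neg _ (by omega), (adm b).large _ (by omega)]
        simp
      · rw [show i + wt G = (i - wt F) + (wt (G ≫ F) : ℕ) by rw [wt_comp]; push_cast; ring,
          close_shift hn', close_of_lt _ (by omega) (by rw [wt_comp]; push_cast; omega)]
        have h₁ := (adm b).lt (show i - wt F < wt G by omega)
        beta_reduce
        rw [(adm a).large i (by omega), (adm a).neg _ (by omega)]
        rw [wt_comp]
        push_cast
        ring_nf
  tr_hexagon F G H := by
    simp only [associator_inv]
    rw [Per.hom_comp, Per.hom_comp, Per.hom_comp, Per.hom_comp]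
    refine Per.hom_congr _ _ (fun hn hm i => ?_)
    rw [close_fn_eqToHom, close_fn_eqToHom, close_fn_eqToHom, wt_comp]
    push_cast
    ring
  tr_unit F := by
    simp only [rightUnitor_hom, leftUnitor_inv]
    rw [Per.hom_comp]
    refine Per.hom_congr _ _ (fun hn hm i => ?_)
    rw [close_fn_eqToHom, close_fn_eqToHom]
    simp

/-- The functor from `biHH` of the walking adjunction to the extended paracyclic category. -/
noncomputable def toParacyclic : BiHH WalkingAdj ⥤ WithTerminal (WithInitial Paracyclic) :=
  paracyclicTrace.desc

lemma toParacyclic_ofCell {X : WalkingAdj} {p q : X ⟶ X} (x : p ⟶ q) :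
    toParacyclic.map (ofCell x) = (adm x).per.hom := rfl

lemma toParacyclic_theta {X Y : WalkingAdj} (F : X ⟶ Y) (G : Y ⟶ X) :
    toParacyclic.map (theta F G).hom = (per_shift F G).hom :=
  paracyclicTrace.desc_theta F G

end WalkingAdj

namespace WalkingAdj

open Bicategory BiHH

/-! ### Standard forms of the morphisms of `biHH` of the walking adjunction -/

lemma ofCell_eqToHom {X : WalkingAdj} {p q : X ⟶ X} (h : p = q) :
    ofCell (eqToHom h) = eqToHom (congrArg ob h) := by
  subst h; exact ofCell_id p

lemma theta_comp {X Y Z : WalkingAdj} (F : X ⟶ Y) (G : Y ⟶ Z) (H : Z ⟶ X) :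
    (theta F (G ≫ H)).hom = eqToHom (congrArg ob (Strict.assoc F G H).symm) ≫
      (theta (F ≫ G) H).hom ≫ eqToHom (congrArg ob (Strict.assoc H F G).symm) ≫
      (theta (H ≫ F) G).hom ≫ eqToHom (congrArg ob (Strict.assoc G H F).symm) := by
  rw [theta_hexagon]
  simp only [associator_inv, ofCell_eqToHom]

lemma theta_inv_comp {X Y Z : WalkingAdj} (F : X ⟶ Y) (G : Y ⟶ Z) (H : Z ⟶ X) :
    (theta F (G ≫ H)).inv = eqToHom (congrArg ob (Strict.assoc G H F)) ≫
      (theta (H ≫ F) G).inv ≫ eqToHom (congrArg ob (Strict.assoc H F G)) ≫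
      (theta (F ≫ G) H).inv ≫ eqToHom (congrArg ob (Strict.assoc F G H)) := by
  rw [theta_inv_hexagon]
  simp only [associator_hom, ofCell_eqToHom]

lemma theta_id {X : WalkingAdj} (F : X ⟶ X) :
    (theta F (𝟙 X)).hom =
      eqToHom (congrArg ob ((Strict.comp_id F).trans (Strict.id_comp F).symm)) := by
  rw [theta_unit, rightUnitor_hom, leftUnitor_inv, ofCell_eqToHom, ofCell_eqToHom, eqToHom_trans]

/-- The rotation of an endo-1-cell of `0`. -/
def rot (n : ℕ) : Aut (ob (pow (n + 1))) :=
  eqToIso rfl ≪≫ theta (pow n) (f ≫ g) ≪≫ eqToIso (congrArg ob (path_ext (by simp [add_comm])))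

lemma rot_hom {n : ℕ} (e : pow n ≫ f ≫ g = pow (n + 1)) (e' : (f ≫ g) ≫ pow n = pow (n + 1)) :
    Iso.hom (rot n) = eqToHom (congrArg ob e.symm) ≫ (theta (pow n) (f ≫ g)).hom ≫
      eqToHom (congrArg ob e') := rfl

/-- The powers of the rotation of an endo-1-cell of `0`. -/
def rotPow (n : ℕ) (k : ℤ) : ob (pow (n + 1)) ⟶ ob (pow (n + 1)) := Iso.hom (rot n ^ k : Aut _)

lemma rotPow_zero (n : ℕ) : rotPow n 0 = 𝟙 _ := congrArg Iso.hom (zpow_zero (rot n))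

lemma rotPow_one (n : ℕ) : rotPow n 1 = Iso.hom (rot n) := congrArg Iso.hom (zpow_one (rot n))

/-- Multiplication in `Aut` composes in the opposite order, whence the commutation of powers. -/
lemma rotPow_add (n : ℕ) (k l : ℤ) : rotPow n (k + l) = rotPow n k ≫ rotPow n l :=
  congrArg Iso.hom ((zpow_add (rot n) k l).trans (zpow_mul_comm _ _ _))

lemma rotPow_neg_comp (n : ℕ) (k : ℤ) : rotPow n (-k) ≫ rotPow n k = 𝟙 _ := by
  rw [← rotPow_add, neg_add_cancel, rotPow_zero]

lemma theta_eq_rot {n : ℕ} {s : WalkingAdj.zero ⟶ WalkingAdj.zero} (h : s = pow n)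
    (e : s ≫ f ≫ g = pow (n + 1)) (e' : (f ≫ g) ≫ s = pow (n + 1)) :
    (theta s (f ≫ g)).hom = eqToHom (congrArg ob e) ≫ rotPow n 1 ≫
      eqToHom (congrArg ob e'.symm) := by
  subst h; simp [rotPow_one, rot_hom e e']

/-- The cyclicity isomorphisms of endo-1-cells of `0` are powers of the rotation. -/
lemma theta_eq_rotPow {n : ℕ} (p q : WalkingAdj.zero ⟶ WalkingAdj.zero)
    (e : p ≫ q = pow (n + 1)) (e' : q ≫ p = pow (n + 1)) :
    (theta p q).hom = eqToHom (congrArg ob e) ≫ rotPow n (wt q) ≫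
      eqToHom (congrArg ob e'.symm) := by
  obtain ⟨j, hj⟩ : ∃ j, j = wt q := ⟨_, rfl⟩
  induction j generalizing p q with
  | zero =>
    obtain rfl : q = 𝟙 _ := path_ext hj.symm
    rw [theta_id, wt_id, Nat.cast_zero, rotPow_zero]
    simp
  | succ j ih =>
    obtain rfl : q = pow j ≫ (f ≫ g) := path_ext (by simp [← hj])
    have hp : wt p + (j + 1) = n + 1 := by simpa using congrArg wt e
    rw [theta_comp, theta_eq_rot (s := p ≫ pow j) (n := n) (path_ext (by simp; omega))
        (path_ext (by simp; omega)) (path_ext (by simp; omega)),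
      ih ((f ≫ g) ≫ p) (pow j) (path_ext (by simp; omega)) (path_ext (by simp; omega)) (by simp)]
    rw [show ((wt (pow j ≫ f ≫ g) : ℕ) : ℤ) = 1 + wt (pow j) by simp [add_comm], rotPow_add]
    simp

/-- A morphism is standard if it is a rotation followed by a 2-cell. -/
def Standard {n : ℕ} {q : WalkingAdj.zero ⟶ WalkingAdj.zero} (x : ob (pow (n + 1)) ⟶ ob q) :
    Prop :=
  ∃ (k : ℤ) (δ : pow (n + 1) ⟶ q), x = rotPow n k ≫ ofCell δ

namespace Standard

variable {n : ℕ} {p q : WalkingAdj.zero ⟶ WalkingAdj.zero}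

lemma ofCell {x : ob (pow (n + 1)) ⟶ ob p} (h : Standard x) (a : p ⟶ q) :
    Standard (x ≫ BiHH.ofCell a) := by
  obtain ⟨k, δ, rfl⟩ := h
  exact ⟨k, δ ≫ a, by rw [ofCell_comp, Category.assoc]⟩

lemma cast {x : ob (pow (n + 1)) ⟶ ob p} (h : Standard x) (e : p = q) :
    Standard (x ≫ eqToHom (congrArg ob e)) := by
  rw [← ofCell_eqToHom e]; exact h.ofCell _

/-- Split the 2-cell along the codomain decomposition. Naturality moves the cyclicity isomorphism in
front of both pieces, where it is a power of the rotation. -/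
lemma theta {x : ob (pow (n + 1)) ⟶ ob (p ≫ q)} (h : Standard x) :
    Standard (x ≫ (BiHH.theta p q).hom) := by
  obtain ⟨k, δ, rfl⟩ := h
  obtain ⟨p₁, p₂, e, δ₁, δ₂, h⟩ := splits δ p q rfl
  have e' : p₂ ≫ p₁ = pow (n + 1) := path_ext (by rw [e]; simp [add_comm])
  rw [eqToHom_refl, Category.comp_id] at h
  refine ⟨k + wt p₂, eqToHom e'.symm ≫ δ₂ ▷ p₁ ≫ q ◁ δ₁, ?_⟩
  rw [h, ofCell_comp, Category.assoc, Category.assoc, theta_naturality,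
    theta_eq_rotPow _ _ e.symm e', ofCell_comp _ (δ₂ ▷ p₁ ≫ q ◁ δ₁), ofCell_eqToHom,
    ofCell_eqToHom, rotPow_add]
  simp

lemma theta_inv {x : ob (pow (n + 1)) ⟶ ob (q ≫ p)} (h : Standard x) :
    Standard (x ≫ (BiHH.theta p q).inv) := by
  obtain ⟨k, δ, rfl⟩ := h
  obtain ⟨p₂, p₁, e, δ₂, δ₁, h⟩ := splits δ q p rfl
  have e' : p₁ ≫ p₂ = pow (n + 1) := path_ext (by rw [e]; simp [add_comm])
  rw [eqToHom_refl, Category.comp_id] at h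
  have h' : (BiHH.theta p₁ p₂).inv = eqToHom (congrArg ob e.symm) ≫ rotPow n (-wt p₂) ≫
      eqToHom (congrArg ob e'.symm) := by
    rw [← cancel_mono (BiHH.theta p₁ p₂).hom, Iso.inv_hom_id, theta_eq_rotPow _ _ e' e.symm]
    simp [reassoc_of% rotPow_neg_comp]
  refine ⟨k + (-wt p₂), eqToHom e'.symm ≫ δ₁ ▷ p₂ ≫ p ◁ δ₂, ?_⟩
  rw [h, ofCell_comp, Category.assoc, Category.assoc, theta_inv_naturality, h',
    ofCell_comp _ (δ₁ ▷ p₂ ≫ p ◁ δ₂), ofCell_eqToHom, ofCell_eqToHom, rotPow_add]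
  simp

lemma twist {x : ob (pow (n + 1)) ⟶ ob p} (h : Standard x) : Standard (x ≫ BiHH.twist p) := by
  have := ((h.ofCell (λ_ p).inv).theta).ofCell (ρ_ p).hom
  simpa [BiHH.twist] using this

lemma twist_inv {x : ob (pow (n + 1)) ⟶ ob p} (h : Standard x) :
    Standard (x ≫ BiHH.ofCell (ρ_ p).inv ≫ (BiHH.theta (𝟙 _) p).inv ≫ BiHH.ofCell (λ_ p).hom) := by
  have := ((h.ofCell (ρ_ p).inv).theta_inv).ofCell (λ_ p).hom
  simpa using this

/-- By the hexagon, the two ways back to an endo-1-cell of 0 differ by a cyclicity isomorphism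
between endo-1-cells of 0, which preserves standard morphisms in both directions. -/
lemma exchange {s : WalkingAdj.one ⟶ WalkingAdj.zero} {k : WalkingAdj.zero ⟶ WalkingAdj.zero}
    {s' : WalkingAdj.zero ⟶ WalkingAdj.one} (x : ob (pow (n + 1)) ⟶ ob (s ≫ (k ≫ s'))) :
    Standard (x ≫ (BiHH.theta s (k ≫ s')).hom) ↔
      Standard (x ≫ eqToHom (congrArg ob (Strict.assoc s k s').symm) ≫
        (BiHH.theta (s ≫ k) s').hom) := by
  rw [theta_comp]
  constructor
  · intro h
    have h₁ := ((h.cast (Strict.assoc k s' s)).theta_inv).cast (Strict.assoc s' s k)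
    simpa using h₁
  · intro h
    have h₁ := ((h.cast (Strict.assoc s' s k).symm).theta).cast (Strict.assoc k s' s).symm
    simpa using h₁

end Standard

/-! ### Passing standard forms through endo-1-cells of 1. -/

/-- A morphism to an endo-1-cell is standard if it is so after a cyclicity isomorphism which
leads to an endo-1-cell of `0`. -/
def StandardAt {n : ℕ} : ∀ {X : WalkingAdj} {p : X ⟶ X}, (ob (pow (n + 1)) ⟶ ob p) → Prop
  | .zero, _, x => Standard x
  | .one, p, x => ∀ (s : WalkingAdj.one ⟶ .zero) (s' : WalkingAdj.zero ⟶ .one) (e : p = s ≫ s'),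
      Standard (x ≫ eqToHom (congrArg ob e) ≫ (theta s s').hom)

namespace StandardAt

variable {n : ℕ}

/-- One factorization through 0 suffices: given two, the longer left factor is a multiple of the
shorter one, and `Standard.exchange` passes between them. -/
lemma of_factor {s : WalkingAdj.one ⟶ .zero} {s' : WalkingAdj.zero ⟶ .one}
    {x : ob (pow (n + 1)) ⟶ ob (s ≫ s')} (h : Standard (x ≫ (theta s s').hom)) :
    StandardAt x := by
  intro t t' e
  have e' : wt s + wt s' = wt t + wt t' := by simpa using congrArg wt e
  by_cases hw : wt s ≤ wt t
  · obtain ⟨k, rfl⟩ := exists_left_factor t s hw (by rintro - ⟨⟩)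
    obtain rfl : s' = k ≫ t' := path_ext (by rw [wt_comp] at e' ⊢; omega)
    exact (Standard.exchange x).1 h
  · obtain ⟨k, rfl⟩ := exists_left_factor s t (by omega) (by rintro - ⟨⟩)
    obtain rfl : t' = k ≫ s' := path_ext (by rw [wt_comp] at e' ⊢; omega)
    rw [← Category.assoc]
    refine (Standard.exchange _).2 ?_
    simpa using h

/-- The property of a morphism that composition with it preserves standard morphisms. -/
def Closed (n : ℕ) {X Y : WalkingAdj} {p : X ⟶ X} {q : Y ⟶ Y} (y : ob p ⟶ ob q) : Prop :=
  ∀ x : ob (pow (n + 1)) ⟶ ob p, StandardAt x → StandardAt (x ≫ y)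

namespace Closed

variable {X Y Z : WalkingAdj}

lemma comp {p : X ⟶ X} {q : Y ⟶ Y} {r : Z ⟶ Z} {y : ob p ⟶ ob q} {z : ob q ⟶ ob r}
    (hy : Closed n y) (hz : Closed n z) : Closed n (y ≫ z) := fun x hx => by
  rw [← Category.assoc]; exact hz _ (hy x hx)

lemma cast {p q : X ⟶ X} (h : p = q) : Closed n (eqToHom (congrArg ob h)) := by
  subst h
  intro x hx
  simpa using hx

lemma whisker {s t : WalkingAdj.one ⟶ .zero} {s' t' : WalkingAdj.zero ⟶ .one} (a : s ⟶ t)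
    (b : s' ⟶ t') : Closed n (ofCell (a ▷ s' ≫ t ◁ b)) := fun x hx => by
  refine of_factor ?_
  rw [Category.assoc, theta_naturality, ← Category.assoc]
  have h := hx s s' rfl
  rw [eqToHom_refl, Category.id_comp] at h
  exact h.ofCell _

lemma of_eq_whisker {p q : WalkingAdj.one ⟶ .one} {s t : WalkingAdj.one ⟶ .zero}
    {s' t' : WalkingAdj.zero ⟶ .one} {x : p ⟶ q} (a : s ⟶ t) (b : s' ⟶ t') (e : p = s ≫ s')
    (e' : t ≫ t' = q) (h : x = eqToHom e ≫ (a ▷ s' ≫ t ◁ b) ≫ eqToHom e') :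
    Closed n (ofCell x) := by
  rw [h, ofCell_comp, ofCell_comp, ofCell_eqToHom, ofCell_eqToHom]
  exact (cast e).comp ((whisker a b).comp (cast e'))

/-- At 1, a whiskered unit, or a whiskered counit with a nontrivial string on one side, acts inside
a factorization through 0, where cyclicity is natural. -/
lemma cell {p q : X ⟶ X} (a : p ⟶ q) : Closed n (ofCell a) := by
  cases X with
  | zero => exact fun x hx => Standard.ofCell hx a
  | one =>
    refine hom_induction (fun a => Closed n (ofCell a)) ?_ ?_ ?_ ?_ a
    · intro p q h
      rw [ofCell_eqToHom]
      exact cast h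
    · intro p q r x y hx hy
      rw [ofCell_comp]
      exact hx.comp hy
    · intro l r
      exact of_eq_whisker (𝟙 l) (u ▷ r) rfl rfl (by simp)
    · intro l r
      by_cases hl : 1 ≤ wt l
      · obtain ⟨k, rfl⟩ := exists_left_factor l g (by simp) (by simpa using hl)
        refine of_eq_whisker (𝟙 g) (k ◁ (c ▷ r)) (Strict.assoc _ _ _) (Strict.assoc _ _ _).symm ?_
        rw [comp_whiskerLeft, associator_hom, associator_inv]
        simp
      by_cases hr : 1 ≤ wt r
      · obtain ⟨k, rfl⟩ := exists_right_factor r f (by simpa using hr) (by rintro ⟨⟩)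
        refine of_eq_whisker (l ◁ (c ▷ k)) (𝟙 f) ?_ ?_ ?_
        · simp only [Strict.assoc]
        · simp only [Strict.assoc]
        · have h : l ◁ (c ▷ (k ≫ f)) = (l ◁ (α_ _ _ _).inv ≫ (α_ _ _ _).inv) ≫
              (l ◁ (c ▷ k)) ▷ f ≫ (α_ _ _ _).hom ≫ l ◁ (α_ _ _ _).hom := by
            simp
          rw [h]
          simp only [associator_hom, associator_inv, whiskerLeft_eqToHom, whiskerLeft_id,
            eqToHom_trans, Category.comp_id]
      -- With trivial whiskering the codomain is the identity of 1. It does not factor through 0,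
      -- since a 1-cell from 0 to 1 contains an `f`, so the condition is vacuous.
      · intro x _ s s' e
        have h₁ := congrArg wt e
        have h₂ := one_le_wt s'
        simp only [wt_comp, wt_id] at h₁
        change 1 ≤ wt s' at h₂
        omega

lemma theta_one_zero (F : WalkingAdj.one ⟶ .zero) (G : WalkingAdj.zero ⟶ .one) :
    Closed n (theta F G).hom := fun x hx => by
  have h := hx F G rfl
  rw [eqToHom_refl, Category.id_comp] at h
  exact h

/-- Returning to 0 by the opposite cyclicity isomorphism gives the full rotation of an endo-1-cell
of 0. -/
lemma theta_zero_one (F : WalkingAdj.zero ⟶ .one) (G : WalkingAdj.one ⟶ .zero) :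
    Closed n (theta F G).hom := fun x hx => by
  refine of_factor ?_
  rw [Category.assoc, theta_theta]
  exact Standard.twist hx

lemma theta_inv_one_zero (F : WalkingAdj.one ⟶ .zero) (G : WalkingAdj.zero ⟶ .one) :
    Closed n (theta F G).inv := fun x hx => by
  refine of_factor ?_
  rw [Category.assoc, Iso.inv_hom_id, Category.comp_id]
  exact hx

/-- The inverse is the opposite cyclicity isomorphism followed by the inverse full rotation. -/
lemma theta_inv_zero_one (F : WalkingAdj.zero ⟶ .one) (G : WalkingAdj.one ⟶ .zero) :
    Closed n (theta F G).inv := fun x hx => by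
  have h := Standard.twist_inv (p := F ≫ G) (theta_one_zero G F x hx)
  have e : (theta F G).inv = (theta G F).hom ≫ ofCell (ρ_ (F ≫ G)).inv ≫
      (theta (𝟙 _) (F ≫ G)).inv ≫ ofCell (λ_ (F ≫ G)).hom := by
    rw [← cancel_epi (BiHH.theta F G).hom, Iso.hom_inv_id, ← Category.assoc, theta_theta]
    have h' := ((ofIso (λ_ (F ≫ G))).symm ≪≫ BiHH.theta (𝟙 _) (F ≫ G) ≪≫
      ofIso (ρ_ (F ≫ G))).hom_inv_id
    simp only [Iso.trans_inv, Category.assoc] at h'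
    exact h'.symm
  rw [e, ← Category.assoc]
  exact h

lemma theta (F : X ⟶ Y) (G : Y ⟶ X) : Closed n (BiHH.theta F G).hom := by
  cases X <;> cases Y
  · exact fun x hx => Standard.theta hx
  · exact theta_zero_one F G
  · exact theta_one_zero F G
  -- A nontrivial endo-1-cell of 1 starts with `g`, and the hexagon then breaks its rotation into
  -- two that pass through 0.
  · by_cases hG : 1 ≤ wt G
    · obtain ⟨G, rfl⟩ := exists_left_factor G g (by simp) (by simpa using hG)
      rw [theta_comp]
      exact (cast (Strict.assoc F g G).symm).comp ((theta_one_zero _ _).comp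
        ((cast (Strict.assoc G F g).symm).comp ((theta_zero_one _ _).comp
          (cast (Strict.assoc g G F).symm))))
    · obtain rfl : G = 𝟙 _ := path_ext (by simp; omega)
      rw [theta_id]
      exact cast ((Strict.comp_id F).trans (Strict.id_comp F).symm)

lemma theta_inv (F : X ⟶ Y) (G : Y ⟶ X) : Closed n (BiHH.theta F G).inv := by
  cases X <;> cases Y
  · exact fun x hx => Standard.theta_inv hx
  · exact theta_inv_zero_one F G
  · exact theta_inv_one_zero F G
  · by_cases hG : 1 ≤ wt G
    · obtain ⟨G, rfl⟩ := exists_left_factor G g (by simp) (by simpa using hG)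
      rw [theta_inv_comp]
      exact (cast (Strict.assoc g G F)).comp ((theta_inv_zero_one _ _).comp
        ((cast (Strict.assoc G F g)).comp ((theta_inv_one_zero _ _).comp
          (cast (Strict.assoc F g G)))))
    · obtain rfl : G = 𝟙 _ := path_ext (by simp; omega)
      have h : (BiHH.theta F (𝟙 _)).inv =
          eqToHom (congrArg ob ((Strict.id_comp F).trans (Strict.comp_id F).symm)) := by
        rw [← cancel_epi (BiHH.theta F (𝟙 _)).hom, Iso.hom_inv_id, theta_id, eqToHom_trans,
          eqToHom_refl]
      rw [h]
      exact cast ((Strict.id_comp F).trans (Strict.comp_id F).symm)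

end Closed

end StandardAt

/-- Every morphism from a nontrivial endo-1-cell of `0` to an endo-1-cell of `0` is standard. -/
theorem standard {n : ℕ} {q : WalkingAdj.zero ⟶ WalkingAdj.zero} (y : ob (pow (n + 1)) ⟶ ob q) :
    Standard y := by
  have key {x y : Cyc₀ WalkingAdj} {z : ob x.F ⟶ ob y.F} (h : BiHH.Gen z) :
      StandardAt.Closed n z := by
    induction h with
    | cell a => exact .cell a
    | theta F G => exact .theta F G
    | theta_inv F G => exact .theta_inv F G
    | comp _ _ _ _ h h' => exact h.comp h'
  -- Closure under all generators is applied to the identity, which is standard with trivial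
  -- rotation.
  have h := key (gen (x := ⟨pow (n + 1)⟩) (y := ⟨q⟩) y) (𝟙 _)
    (show Standard _ from ⟨0, 𝟙 _, by rw [rotPow_zero, ofCell_id, Category.comp_id]⟩)
  rw [Category.id_comp] at h
  exact h

end WalkingAdj

namespace WalkingAdj

open Bicategory BiHH

/-! ### The equivalence with the extended paracyclic category -/

lemma Per.add (n : ℕ) (k : ℤ) : Per .zero .zero n n (fun i => i + k) where
  source _ := Or.inl rfl
  target h := Or.inr ⟨rfl, h⟩
  mono _ _ i j h := by simpa using h
  shift _ _ i := by ring

lemma Per.eq_of_hom_eq {X Y : WalkingAdj} {n m : ℕ} {h h' : ℤ → ℤ} (p : Per X Y n m h)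
    (p' : Per X Y n m h') (e : p.hom = p'.hom) (hn : 1 ≤ n) (hm : 1 ≤ m) : h = h' := by
  obtain ⟨n, rfl⟩ := Nat.exists_eq_add_of_le' hn
  obtain ⟨m, rfl⟩ := Nat.exists_eq_add_of_le' hm
  let x : (⟨n⟩ : Paracyclic) ⟶ ⟨m⟩ := ⟨h, p.mono hn hm, fun l => by simpa using p.shift hn hm l⟩
  let x' : (⟨n⟩ : Paracyclic) ⟶ ⟨m⟩ := ⟨h', p'.mono hn hm, fun l => by simpa using p'.shift hn hm l⟩
  have e' : paracyclicIncl.map x = paracyclicIncl.map x' := e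
  exact congrArg Paracyclic.Hom.toFun (paracyclicIncl.map_injective e')

lemma Per.exists_hom_eq {X Y : WalkingAdj} {n m : ℕ} (x : cycObj X n ⟶ cycObj Y m) (hn : 1 ≤ n)
    (hm : 1 ≤ m) : ∃ (h : ℤ → ℤ) (p : Per X Y n m h), p.hom = x := by
  obtain ⟨n, rfl⟩ := Nat.exists_eq_add_of_le' hn
  obtain ⟨m, rfl⟩ := Nat.exists_eq_add_of_le' hm
  let y : paracyclicIncl.obj ⟨n⟩ ⟶ paracyclicIncl.obj ⟨m⟩ := x
  obtain ⟨z, hz⟩ := paracyclicIncl.map_surjective y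
  exact ⟨z.toFun, ⟨by omega, by omega, fun _ _ => z.monotone,
    fun _ _ i => by simpa using z.shift i⟩, hz⟩

/-- A morphism between endo-1-cells is sent to the morphism of the extended paracyclic category
given by `h`. -/
def Realizes {X Y : WalkingAdj} {p : X ⟶ X} {q : Y ⟶ Y} (x : ob p ⟶ ob q) (h : ℤ → ℤ) : Prop :=
  ∃ P : Per X Y (wt p) (wt q) h, toParacyclic.map x = P.hom

namespace Realizes

variable {X Y Z : WalkingAdj} {p : X ⟶ X} {q : Y ⟶ Y} {r : Z ⟶ Z}

lemma comp {x : ob p ⟶ ob q} {y : ob q ⟶ ob r} {h h' : ℤ → ℤ} (hx : Realizes x h)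
    (hy : Realizes y h') : Realizes (x ≫ y) (fun i => h' (h i)) := by
  obtain ⟨P, hP⟩ := hx
  obtain ⟨Q, hQ⟩ := hy
  exact ⟨P.comp Q, (toParacyclic.map_comp x y).trans
    ((congrArg₂ (· ≫ ·) hP hQ).trans (P.hom_comp Q))⟩

lemma cell {p q : X ⟶ X} (x : p ⟶ q) : Realizes (ofCell x) (close (wt p) (wt q) (fn x)) :=
  ⟨(adm x).per, toParacyclic_ofCell x⟩

lemma cast {p q : X ⟶ X} (e : p = q) : Realizes (eqToHom (congrArg ob e)) (fun i => i) := by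
  have h := cell (eqToHom e)
  rw [ofCell_eqToHom] at h
  rwa [show close (wt p) (wt q) (fn (eqToHom e)) = fun i => i from
    funext (close_fn_eqToHom e)] at h

lemma theta (F : X ⟶ Y) (G : Y ⟶ X) : Realizes (BiHH.theta F G).hom (fun i => i + wt G) :=
  ⟨per_shift F G, toParacyclic_theta F G⟩

lemma inv {i : ob p ≅ ob q} {h h' : ℤ → ℤ} (hi : Realizes i.hom h)
    (P : Per Y X (wt q) (wt p) h') (e : ∀ i, h' (h i) = i) : Realizes i.inv h' := by
  obtain ⟨Q, hQ⟩ := hi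
  have e' : Q.hom ≫ P.hom = 𝟙 _ := (Q.hom_comp P).trans (Per.hom_eq_id _ (fun _ => e))
  rw [← hQ] at e'
  exact ⟨P, ((toParacyclic.mapIso i).hom_comp_eq_id.1 e').symm⟩

lemma rotPow_one (n : ℕ) : Realizes (rotPow n 1) (fun i => i + 1) := by
  have e : (f ≫ g) ≫ pow n = pow (n + 1) := path_ext (by simp [add_comm])
  rw [WalkingAdj.rotPow_one, rot_hom rfl e]
  exact (cast (q := pow n ≫ f ≫ g) rfl).comp ((theta (pow n) (f ≫ g)).comp (cast e))

lemma rotPow (n : ℕ) (k : ℤ) : Realizes (rotPow n k) (fun i => i + k) := by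
  induction k using Int.induction_on with
  | zero =>
    rw [rotPow_zero]
    simpa using cast (rfl : pow (n + 1) = _)
  | succ k ih =>
    rw [rotPow_add]
    simpa only [add_assoc] using ih.comp (rotPow_one n)
  | pred k ih =>
    have h := rotPow_one n
    rw [WalkingAdj.rotPow_one] at h
    have h' := inv h (Per.add _ (-1)) (fun i => by ring)
    have e : WalkingAdj.rotPow n (-1) = Iso.inv (rot n) :=
      congrArg Iso.hom (zpow_neg_one (rot n))
    rw [← e] at h'
    rw [sub_eq_add_neg, rotPow_add]
    simpa only [add_assoc] using ih.comp h'

lemma standard {n : ℕ} {q : WalkingAdj.zero ⟶ WalkingAdj.zero} (k : ℤ) (δ : pow (n + 1) ⟶ q) :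
    Realizes (WalkingAdj.rotPow n k ≫ ofCell δ)
      (fun i => close (wt (pow (n + 1))) (wt q) (fn δ) (i + k)) :=
  (rotPow n k).comp (cell δ)

end Realizes

/-- The value at 0 is nonnegative, and the value at -1 is `φ (n - 1) - m`, which is negative. So a
2-cell preserves the cut between periods, which makes the rotation in a standard form recoverable.
-/
lemma Adm.close_nonneg_iff {n m : ℕ} {φ : ℤ → ℤ} (h : Adm .zero .zero n m φ) (hn : 1 ≤ n)
    (hm : 1 ≤ m) (i : ℤ) : 0 ≤ close n m φ i ↔ 0 ≤ i := by
  have h₁ := h.start rfl 0 le_rfl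
  have h₂ := h.lt (i := n - 1) (by omega)
  have h₃ := close_of_lt (m := m) φ (le_refl 0) (show (0 : ℤ) < n by omega)
  have h₄ := close_shift (m := m) hn φ (-1)
  rw [close_of_lt φ (by omega) (by omega), show (-1 + n : ℤ) = n - 1 by ring] at h₄
  constructor
  · intro hi
    by_contra hi'
    have := h.per.mono hn hm (show i ≤ -1 by omega)
    omega
  · intro hi
    have := h.per.mono hn hm hi
    omega

/-- The functor to the extended paracyclic category is bijective on the morphisms between
nontrivial endo-1-cells of `0`. -/
theorem bijective_map_pow (n m : ℕ) : Function.Bijective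
    (toParacyclic.map : (ob (pow (n + 1)) ⟶ ob (pow (m + 1))) → _) := by
  have hn : 1 ≤ wt (pow (n + 1)) := by simp
  have hm : 1 ≤ wt (pow (m + 1)) := by simp
  constructor
  · intro x y e
    obtain ⟨k, δ, rfl⟩ := standard x
    obtain ⟨l, δ', rfl⟩ := standard y
    obtain ⟨P, hP⟩ := Realizes.standard k δ
    obtain ⟨Q, hQ⟩ := Realizes.standard l δ'
    have h := congrFun (P.eq_of_hom_eq Q (hP.symm.trans (e.trans hQ)) hn hm)
    have h₁ := (adm δ).close_nonneg_iff hn hm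
    have h₂ := (adm δ').close_nonneg_iff hn hm
    -- The common map becomes nonnegative exactly at `-k` and exactly at `-l`.
    obtain rfl : k = l := by
      have h₃ := h (-k)
      have h₄ := h (-l)
      have h₅ := h₁ (-k + k)
      have h₆ := h₁ (-l + k)
      beta_reduce at h₃ h₄
      rw [h₃, h₂] at h₅
      rw [h₄, h₂] at h₆
      omega
    rw [cell_ext δ δ' (fun i hi hi' => ?_)]
    have h₃ := h (i - k)
    beta_reduce at h₃
    rwa [sub_add_cancel, close_of_lt _ hi hi', close_of_lt _ hi hi'] at h₃
  · intro x
    obtain ⟨h, p, rfl⟩ := Per.exists_hom_eq (X := .zero) (Y := .zero)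
      (n := wt (pow (n + 1))) (m := wt (pow (m + 1))) x hn hm
    have hmono := p.mono hn hm
    have hs := p.shift hn hm
    -- `i₀` is where the map becomes nonnegative. The bounds are multiples of the period: `|h 0|`
    -- periods forward make the value nonnegative, and one more than that backward makes it
    -- negative.
    obtain ⟨i₀, h₀, h₁⟩ : ∃ i₀, 0 ≤ h i₀ ∧ ∀ i, 0 ≤ h i → i₀ ≤ i := by
      refine Int.exists_least_of_bdd ⟨0 + wt (pow (n + 1)) * (-|h 0| - 1), fun i hi => ?_⟩
        ⟨0 + wt (pow (n + 1)) * |h 0|, ?_⟩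
      · by_contra hi'
        have h₁ := hmono (not_le.1 hi').le
        rw [shift_mul hs] at h₁
        have := le_abs_self (h 0)
        have := abs_nonneg (h 0)
        nlinarith
      · rw [shift_mul hs]
        have := neg_abs_le (h 0)
        have := abs_nonneg (h 0)
        nlinarith
    -- The period starting at `i₀` is a map of finite ordinals: its values are nonnegative, and
    -- since `h (i₀ - 1)` is negative, they stay below the period of the target.
    obtain ⟨δ, hδ⟩ := exists_cell (pow (n + 1)) (pow (m + 1)) (fun i => h (i + i₀))
      (fun i j hij => hmono (by omega)) (fun i hi hi' => by
        refine ⟨h₀.trans (hmono (by omega)), ?_⟩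
        have h₂ := hs (i₀ - 1)
        have h₃ : h (i₀ - 1) < 0 := by
          by_contra h'
          have := h₁ _ (not_lt.1 h')
          omega
        have h₄ := hmono (show i + i₀ ≤ i₀ - 1 + wt (pow (n + 1)) by omega)
        omega)
    refine ⟨rotPow n (-i₀) ≫ ofCell δ, ?_⟩
    obtain ⟨P, hP⟩ := Realizes.standard (-i₀) δ
    rw [hP]
    refine Per.hom_congr _ _ (fun _ _ i => ?_)
    have h₂ := periodic_ext hn (close_shift (m := wt (pow (m + 1))) hn (fn δ))
      (h' := fun i => h (i + i₀))
      (fun i => by rw [← hs]; congr 1; ring)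
      (fun i hi hi' => by rw [close_of_lt _ hi hi', hδ i hi hi']) (i + -i₀)
    rw [h₂]
    simp

lemma bijective_map_of_iso {C : Type u₁} [Category.{v₁} C] {D : Type u₂} [Category.{v₂} D]
    (F : C ⥤ D) {x x' y y' : C} (e : x ≅ x') (e' : y ≅ y')
    (h : Function.Bijective (F.map : (x' ⟶ y') → _)) :
    Function.Bijective (F.map : (x ⟶ y) → _) := by
  constructor
  · intro a b hab
    rw [← cancel_epi e.inv, ← cancel_mono e'.hom]
    exact h.1 (by simp [hab])
  · intro b
    obtain ⟨a, ha⟩ := h.2 (F.map e.inv ≫ b ≫ F.map e'.hom)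
    refine ⟨e.hom ≫ a ≫ e'.inv, ?_⟩
    rw [F.map_comp, F.map_comp, ha]
    simp [← F.map_comp_assoc, ← F.map_comp]

/-- Every object of `biHH` is isomorphic to an endo-1-cell. -/
lemma exists_iso_ob {B : Type u} [Bicategory.{w, v} B] :
    ∀ a : BiHH B, ∃ x : Cyc₀ B, Nonempty (a ≅ ob x.F)
  | ⟨.zero, x⟩ => ⟨x, ⟨Iso.refl _⟩⟩
  | ⟨.one, x⟩ => ⟨faceD₀.obj x, ⟨Diagram.str (D := cyc B) .d₀ x⟩⟩
  | ⟨.two, x⟩ => ⟨faceD₀.obj (faceE₀.obj x),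
      ⟨Diagram.str (D := cyc B) .e₀ x ≪≫ Diagram.str (D := cyc B) .d₀ _⟩⟩

/-- Every object of `biHH` of the walking adjunction is isomorphic to an identity 1-cell or to a
nontrivial endo-1-cell of `0`. -/
lemma exists_iso (a : BiHH WalkingAdj) : Nonempty (a ≅ ob (𝟙 WalkingAdj.zero)) ∨
    Nonempty (a ≅ ob (𝟙 WalkingAdj.one)) ∨ ∃ n, Nonempty (a ≅ ob (pow (n + 1))) := by
  obtain ⟨⟨p⟩, ⟨i⟩⟩ := exists_iso_ob a
  have key (p : WalkingAdj.zero ⟶ WalkingAdj.zero) (i : a ≅ ob p) :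
      Nonempty (a ≅ ob (𝟙 WalkingAdj.zero)) ∨ ∃ n, Nonempty (a ≅ ob (pow (n + 1))) := by
    obtain ⟨n, rfl⟩ : ∃ n, p = pow n := ⟨wt p, path_ext (by simp)⟩
    cases n with
    | zero => exact Or.inl ⟨i⟩
    | succ n => exact Or.inr ⟨n, ⟨i⟩⟩
  rename_i X
  cases X with
  | zero =>
    obtain h | h := key p i
    · exact Or.inl h
    · exact Or.inr (Or.inr h)
  | one =>
    -- A nontrivial endo-1-cell of 1 starts with `g`, so rotating that `g` to the end gives an
    -- endo-1-cell of 0.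
    by_cases hp : 1 ≤ wt p
    · obtain ⟨s, rfl⟩ := exists_left_factor p g (by simp) (by simpa using hp)
      obtain h | h := key _ (i ≪≫ theta g s)
      · exact Or.inl h
      · exact Or.inr (Or.inr h)
    · obtain rfl : p = 𝟙 _ := path_ext (by simp; omega)
      exact Or.inr (Or.inl ⟨i⟩)

/-- After replacing the objects by their normal forms, the cases with an identity 1-cell are settled
by initiality and terminality on both sides, or by emptiness of the target hom-set, which forces
that of the source. -/
theorem bijective_map (a b : BiHH WalkingAdj) :
    Function.Bijective (toParacyclic.map : (a ⟶ b) → _) := by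
  have empty {a b : BiHH WalkingAdj} (h : IsEmpty (toParacyclic.obj a ⟶ toParacyclic.obj b)) :
      Function.Bijective (toParacyclic.map : (a ⟶ b) → _) :=
    ⟨fun x => h.elim (toParacyclic.map x), fun y => h.elim y⟩
  obtain ⟨⟨i⟩⟩ | ⟨⟨i⟩⟩ | ⟨n, ⟨i⟩⟩ := exists_iso a
  · exact bijective_map_of_iso _ i (Iso.refl b) ⟨fun _ _ _ => isInitialUnitZero.hom_ext _ _,
      fun _ => ⟨isInitialUnitZero.to _, isInitialCycObj.hom_ext _ _⟩⟩
  all_goals obtain ⟨⟨j⟩⟩ | ⟨⟨j⟩⟩ | ⟨m, ⟨j⟩⟩ := exists_iso b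
  · exact bijective_map_of_iso _ i j (empty isEmpty_terminal_initial)
  · exact bijective_map_of_iso _ i j ⟨fun _ _ _ => isTerminalUnitOne.hom_ext _ _,
      fun _ => ⟨isTerminalUnitOne.from _, isTerminalCycObj.hom_ext _ _⟩⟩
  · refine bijective_map_of_iso _ i j (empty ?_)
    have h := isEmpty_terminal_hom m .zero
    rwa [← wt_pow (m + 1)] at h
  · refine bijective_map_of_iso _ i j (empty ?_)
    have h := isEmpty_hom_initial n .zero
    rwa [← wt_pow (n + 1)] at h
  · exact bijective_map_of_iso _ i j ⟨fun _ _ _ => isTerminalUnitOne.hom_ext _ _,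
      fun _ => ⟨isTerminalUnitOne.from _, isTerminalCycObj.hom_ext _ _⟩⟩
  · exact bijective_map_of_iso _ i j (bijective_map_pow n m)

instance : toParacyclic.Faithful := ⟨fun h => (bijective_map _ _).1 h⟩

instance : toParacyclic.Full := ⟨fun x => (bijective_map _ _).2 x⟩

instance : toParacyclic.EssSurj where
  mem_essImage
    | .of .star => ⟨ob (𝟙 WalkingAdj.zero), ⟨Iso.refl _⟩⟩
    | .of (.of ⟨n⟩) => ⟨ob (pow (n + 1)), ⟨eqToIso (congrArg (cycObj .zero) (wt_pow (n + 1)))⟩⟩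
    | .star => ⟨ob (𝟙 WalkingAdj.one), ⟨Iso.refl _⟩⟩

instance : toParacyclic.IsEquivalence where

end WalkingAdj

namespace BiHH

open Bicategory WalkingAdj

/-! ### The Euler characteristic as a universal morphism -/

/-- The unit isomorphism of a pseudofunctor, as an isomorphism from the value of the induced functor
on `biHH`. -/
def mapUnitIso {A : Type u} [Bicategory.{w, v} A] {B : Type u'} [Bicategory.{w', v'} B]
    (σ : A ⥤ᵖ B) (X : A) : (map σ).obj (ob (𝟙 X)) ≅ ob (𝟙 (σ.obj X)) := unitIso σ X

/-- The Euler characteristic of the universal adjunction is a morphism out of an initial object,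
hence equal to `m`; its image under the pseudofunctor is already known. -/
lemma eulerChar_eq {B : Type u} [Bicategory.{w, v} B] (σ : AdjCat B)
    (m : ob (𝟙 WalkingAdj.zero) ⟶ ob (𝟙 WalkingAdj.one)) :
    eulerChar σ.adj = (mapUnitIso σ.toPseudofunctor .zero).inv ≫
      (map σ.toPseudofunctor).map m ≫ (mapUnitIso σ.toPseudofunctor .one).hom := by
  have h : (map σ.toPseudofunctor).map (eulerChar adjunction) =
      (mapUnitIso σ.toPseudofunctor .zero).hom ≫ eulerChar σ.adj ≫
        (mapUnitIso σ.toPseudofunctor .one).inv := map_eulerChar σ.toPseudofunctor adjunction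
  rw [isInitialUnitZero.hom_ext m (eulerChar adjunction), h]
  simp

/-- Applied to `I` and to `T`, this is naturality of the comparison in the adjunction: `unitConj` is
the component of the induced transformation at an identity 1-cell, corrected by unit constraints. -/
lemma unitConj_naturality {A : Type u} [Bicategory.{w, v} A] {B : Type u'}
    [Bicategory.{w', v'} B] {σ τ : A ⥤ᵖ B} (η : PsEquiv σ τ) {X : A} {a : BiHH A}
    (i : ob (𝟙 X) ⟶ a) :
    unitConj (η.2 X) ≫ (mapUnitIso τ X).inv ≫ (map τ).map i =
      ((mapUnitIso σ X).inv ≫ (map σ).map i) ≫ (natTrans η).app a := by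
  have h : unitConj (η.2 X) = (mapUnitIso σ X).inv ≫ (natTrans η).app (ob (𝟙 X)) ≫
      (mapUnitIso τ X).hom := unitConj_eq η X
  rw [h]
  simp

/-- The Euler characteristic is restriction along the morphism from an initial to a terminal object
of `biHH` of the walking adjunction. -/
noncomputable def chiHatIso (B : Type u) [Bicategory.{w, v} B] {I T : BiHH WalkingAdj}
    (hI : Limits.IsInitial I) (hT : Limits.IsTerminal T) :
    chiHat B ≅ functor WalkingAdj B ⋙ restrict (hI.to T) :=
  NatIso.ofComponents
    (fun σ => Arrow.isoMk
      ((mapUnitIso σ.toPseudofunctor .zero).symm ≪≫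
        (map σ.toPseudofunctor).mapIso (isInitialUnitZero.uniqueUpToIso hI))
      ((mapUnitIso σ.toPseudofunctor .one).symm ≪≫
        (map σ.toPseudofunctor).mapIso (isTerminalUnitOne.uniqueUpToIso hT))
      (by
        -- The formula holds for every morphism between the two identities, in particular for the
        -- one transported from `I` to `T`.
        have h := eulerChar_eq σ ((isInitialUnitZero.uniqueUpToIso hI).hom ≫ hI.to T ≫
          (isTerminalUnitOne.uniqueUpToIso hT).inv)
        change ((mapUnitIso σ.toPseudofunctor .zero).inv ≫ (map σ.toPseudofunctor).map
            (isInitialUnitZero.uniqueUpToIso hI).hom) ≫ (map σ.toPseudofunctor).map (hI.to T) =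
          eulerChar σ.adj ≫ (mapUnitIso σ.toPseudofunctor .one).inv ≫
            (map σ.toPseudofunctor).map (isTerminalUnitOne.uniqueUpToIso hT).hom
        rw [h]
        simp [← Functor.map_comp, isInitialUnitZero.hom_ext (isInitialUnitZero.to T) (hT.from _)]))
    (by
      rintro σ τ ⟨η⟩
      ext
      · exact unitConj_naturality η _
      · exact unitConj_naturality η _)

end BiHH

theorem mainTheorem9 :
    (∃ e : BiHH WalkingAdj ≌ WithTerminal (WithInitial Paracyclic),
      Nonempty (e.functor.obj (BiHH.ob (𝟙 WalkingAdj.zero)) ≅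
        WithTerminal.of (WithInitial.star : WithInitial Paracyclic)) ∧
      Nonempty (e.functor.obj (BiHH.ob (𝟙 WalkingAdj.one)) ≅ WithTerminal.star)) ∧
    Nonempty (Limits.IsInitial (BiHH.ob (𝟙 WalkingAdj.zero))) ∧
    Nonempty (Limits.IsTerminal (BiHH.ob (𝟙 WalkingAdj.one))) ∧
    (∀ (φ : BiHH.ob (WalkingAdj.f ≫ WalkingAdj.g) ≅ BiHH.ob (WalkingAdj.g ≫ WalkingAdj.f))
      (m : BiHH.ob (𝟙 WalkingAdj.zero) ⟶ BiHH.ob (𝟙 WalkingAdj.one)),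
      BiHH.ofCell WalkingAdj.u ≫ φ.hom ≫ BiHH.ofCell WalkingAdj.c = m) ∧
    (∀ (B : Type u) [Bicategory.{w, v} B] {I T : BiHH WalkingAdj} (hI : Limits.IsInitial I)
      (_ : Limits.IsTerminal T),
      Nonempty (BiHH.chiHat B ≅ BiHH.functor WalkingAdj B ⋙ BiHH.restrict (hI.to T))) ∧
    (∀ (B : Type u) [Bicategory.{w, v} B] (σ : BiHH.AdjCat B)
      (m : BiHH.ob (𝟙 WalkingAdj.zero) ⟶ BiHH.ob (𝟙 WalkingAdj.one)),
      BiHH.eulerChar σ.adj = (BiHH.unitIso σ.toPseudofunctor .zero).inv ≫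
        (BiHH.map σ.toPseudofunctor).map m ≫ (BiHH.unitIso σ.toPseudofunctor .one).hom) := by
  refine ⟨⟨WalkingAdj.toParacyclic.asEquivalence, ⟨Iso.refl _⟩, ⟨Iso.refl _⟩⟩,
    ⟨WalkingAdj.isInitialUnitZero⟩, ⟨WalkingAdj.isTerminalUnitOne⟩, ?_, ?_, ?_⟩
  -- Any composite with the given ends is the unique morphism out of the initial object, whichever
  -- isomorphism it contains.
  · exact fun φ m => WalkingAdj.isInitialUnitZero.hom_ext _ _
  · exact fun B _ I T hI hT => ⟨BiHH.chiHatIso B hI hT⟩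
  · exact fun B _ σ m => BiHH.eulerChar_eq σ m
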